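/- A left-invariant sub-Riemannian metric $d$ on $SO(3)$ is given by a proper subspace $\mathfrak p\subsetneq\mathfrak{so}(3)$ which generates the Lie algebra $\mathfrak{so}(3)$, together with a scalar product $\langle\cdot,\cdot\rangle$ on $\mathfrak p$: $d(g,h)$ is the infimum of the lengths $\int_0^T|\gamma^{-1}\dot\gamma|\,dt$ of piecewise smooth paths $\gamma:[0,T]\to SO(3)$ from $g$ to $h$ with $\gamma(t)^{-1}\dot\gamma(t)\in\mathfrak p$. A geodesic parametrized by arc length is a curve $g:\mathbb R\to SO(3)$ such that every $t$ has a neighbourhood in which $d(g(t_1),g(t_2))=|t_1-t_2|$. (0) A proper subspace of $\mathfrak{so}(3)$ generates $\mathfrak{so}(3)$ if and only if it is two-dimensional. Let $d$ be any left-invariant sub-Riemannian metric on $SO(3)$, given by $(\mathfrak p,\langle\cdot,\cdot\rangle)$. (1) There exist real numbers $0<a\le b$ and a basis $e_1,e_2,e_3$ of $\mathfrak{so}(3)$ such that $e_1,e_2$ is an orthonormal basis of $(\mathfrak p,\langle\cdot,\cdot\rangle)$ and $$[e_1,e_2]=ab\,e_3,\qquad [e_3,e_1]=\frac ba\,e_2,\qquad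 [e_2,e_3]=\frac ab\,e_1 .\qquad (*)$$ (2) For all such $a,b,e_1,e_2,e_3$ and every geodesic $g:\mathbb R\to SO(3)$ of $d$ parametrized by arc length, there is a smooth function $\xi:\mathbb R\to\mathbb R$ such that, for all $t$, $$\dot g(t)=g(t)u(t),\qquad u(t)=\cos\xi(t)\,e_1+\sin\xi(t)\,e_2,\qquad \ddot\xi(t)=\frac{a^2-b^2}{2}\sin 2\xi(t).$$ (3) Suppose $a<b$ in (2), and put $c=\sqrt{b^2-a^2}$. The metric $d'$ given by $(\mathfrak p,c^2\langle\cdot,\cdot\rangle)$ equals $c\,d$; a curve $t\mapsto g(t)$ is an arc-length geodesic of $d$ if and only if $t\mapsto g(t/c)$ is one of $d'$; and $e_1'=e_1/c$, $e_2'=e_2/c$, $e_3'=e_3$ is a basis as in (1) for $d'$, with the parameters $a'=a/c$, $b'=b/c$, which satisfy $a'^2-b'^2=-1$. For every arc-length geodesic of $d'$ there is a smooth $\xi$ as in (2) (with $a',b',e_i'$ in place of $a,b,e_i$) such that $\omega=2\xi$ satisfies the mathematical pendulum equation $$\ddot\omega(t)=-\sin\omega(t).$$ -/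

import Mathlib

open scoped ContDiff

/-- The Lie group `SO(3)`. -/
abbrev SO3 : Type := Matrix.specialOrthogonalGroup (Fin 3) ℝ

/-- The Lie algebra `so(3)` of skew-symmetric matrices with the commutator bracket. -/
abbrev so3 : Type := LieAlgebra.Orthogonal.so (Fin 3) ℝ

/-- The curve `g` in `SO(3)` has at time `t` the velocity `dl_{g(t)}(u) = g(t) u`, `u ∈ so(3)`. -/
def HasControlAt (g : ℝ → SO3) (u : so3) (t : ℝ) : Prop :=
  HasDerivAt (fun s => (g s : Matrix (Fin 3) (Fin 3) ℝ))
    ((g t : Matrix (Fin 3) (Fin 3) ℝ) * (u : Matrix (Fin 3) (Fin 3) ℝ)) t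

/-- The subspace `p` generates the Lie algebra `so(3)`. -/
def Generates (p : Submodule ℝ so3) : Prop :=
  LieSubalgebra.lieSpan ℝ so3 (p : Set so3) = ⊤

/-- The data of a left-invariant sub-Riemannian (not Riemannian) metric on `SO(3)`: a proper
generating subspace `p` of `so(3)` with a scalar product on `p`. -/
structure SubRiemannianSO3 where
  p : Submodule ℝ so3
  proper : p ≠ ⊤
  generates : Generates p
  ip : LinearMap.BilinForm ℝ p
  ip_symm : ∀ v w, ip v w = ip w v
  ip_pos : ∀ v, v ≠ 0 → 0 < ip v v

namespace SubRiemannianSO3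

/-- The norm on `p` of the scalar product. -/
noncomputable def norm (S : SubRiemannianSO3) (v : S.p) : ℝ := Real.sqrt (S.ip v v)

/-- `γ`, restricted to `[0, T]`, is a piecewise smooth path tangent to the left-invariant
distribution defined by `p`, and `u = γ⁻¹ γ'` outside the endpoints and a finite set of times `P`.
The path is smooth up to the endpoints on each closed interval without points of `P` inside. -/
def IsHorizontalPath (S : SubRiemannianSO3) (T : ℝ) (γ : ℝ → SO3) (u : ℝ → S.p) : Prop :=
  0 ≤ T ∧
  ContinuousOn (fun t => (γ t : Matrix (Fin 3) (Fin 3) ℝ)) (Set.Icc 0 T) ∧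
  ∃ P : Finset ℝ,
    (∀ t₀ t₁ : ℝ, 0 ≤ t₀ → t₀ < t₁ → t₁ ≤ T → (∀ t ∈ P, t ∉ Set.Ioo t₀ t₁) →
      ∀ i j : Fin 3,
        ContDiffOn ℝ ∞ (fun t => (γ t : Matrix (Fin 3) (Fin 3) ℝ) i j) (Set.Icc t₀ t₁)) ∧
    ∀ t ∈ Set.Ioo 0 T, t ∉ P → HasControlAt γ (u t : so3) t

/-- The sub-Riemannian distance: the infimum of the lengths of horizontal paths from `g` to `h`
(a priori `∞` if there are none). -/
noncomputable def dist (S : SubRiemannianSO3) (g h : SO3) : ENNReal :=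
  sInf {l | ∃ (T : ℝ) (γ : ℝ → SO3) (u : ℝ → S.p), S.IsHorizontalPath T γ u ∧
    γ 0 = g ∧ γ T = h ∧ l = ENNReal.ofReal (∫ t in (0 : ℝ)..T, S.norm (u t))}

/-- `g : ℝ → SO(3)` is a geodesic parametrized by arc length: locally it is a shortest arc of
the metric space `(SO(3), d)` parametrized by arc length. -/
def IsArcLengthGeodesic (S : SubRiemannianSO3) (g : ℝ → SO3) : Prop :=
  ∀ t : ℝ, ∃ ε > 0, ∀ t₁ t₂ : ℝ, t - ε < t₁ → t₁ ≤ t₂ → t₂ < t + ε →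
    S.dist (g t₁) (g t₂) = ENNReal.ofReal (t₂ - t₁)

/-- `e 0, e 1, e 2` (the vectors `e₁, e₂, e₃`) is a basis of `so(3)` whose first two vectors form
an orthonormal basis of `p` and whose structure constants are normalized with parameters
`0 < a ≤ b`. -/
structure IsNormalizedBasis (S : SubRiemannianSO3) (a b : ℝ) (e : Module.Basis (Fin 3) ℝ so3) :
    Prop where
  pos : 0 < a
  le : a ≤ b
  span_eq : Submodule.span ℝ {e 0, e 1} = S.p
  mem₁ : e 0 ∈ S.p
  mem₂ : e 1 ∈ S.p
  ip₁₁ : S.ip ⟨e 0, mem₁⟩ ⟨e 0, mem₁⟩ = 1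
  ip₂₂ : S.ip ⟨e 1, mem₂⟩ ⟨e 1, mem₂⟩ = 1
  ip₁₂ : S.ip ⟨e 0, mem₁⟩ ⟨e 1, mem₂⟩ = 0
  bracket₁₂ : ⁅e 0, e 1⁆ = (a * b) • e 2
  bracket₃₁ : ⁅e 2, e 0⁆ = (b / a) • e 1
  bracket₂₃ : ⁅e 1, e 2⁆ = (a / b) • e 0

/-- The same subspace `p` with the scalar product multiplied by `c²`, `c > 0`. -/
noncomputable def scale (S : SubRiemannianSO3) (c : ℝ) (hc : 0 < c) : SubRiemannianSO3 where
  p := S.p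
  proper := S.proper
  generates := S.generates
  ip := (c ^ 2) • S.ip
  ip_symm v w := by simp [S.ip_symm v w]
  ip_pos v hv := by
    have h := S.ip_pos v hv
    simp only [LinearMap.smul_apply, smul_eq_mul]
    positivity

end SubRiemannianSO3

/-! Parts (0), (1) and (3) are linear algebra and scaling. Taking axial vectors turns so(3) into ℝ³
with the cross product. Two independent vectors and their bracket therefore form a basis, while a
subspace of dimension at most one is an abelian subalgebra. Diagonalizing the Euclidean form on `p`
against the given scalar product yields e₁ and e₂ of Euclidean lengths b ≥ a, and (x × y) × x = |x|²
y − ⟨x, y⟩ x produces the structure constants.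

The core is (2): a geodesic, known only as a locally isometric curve, satisfies the normal extremal
equation g' = g u, where the coordinates of u are ⟨M, Ad_g e₁⟩ and ⟨M, Ad_g e₂⟩ and M ∈ ℝ³ is
locally constant. This is a Lagrange multiplier rule, proved by discretization, so that no prior
regularity of g is needed. A short arc is replaced by a product of exponentials of h w_j that stays
within O(h) of g (`exists_discretization`). The least squares projection of w onto the controls `cov
(P j) M` leaves a residual r that does not move the endpoint to first order. Hence w − s r, after a
correction of size O(s²), joins the same endpoints as the arc (`exists_correction`). By minimality
it cannot be too short, which forces the mean square of r to be O(s) (`exists_multiplier`). As s → 0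
with h ≤ s², a subsequence of the multipliers converges and g inherits the equation
(`exists_multiplier_arc`).

The correction needs the Gram operator of the arc to be uniformly coercive, that is, there must be
no abnormal extremals. A covector annihilating the distribution along the arc is, in the moving
frame, a multiple of e₃; since the brackets of e₃ with e₁ and e₂ span `p`, the arc would have to be
constant (`eq_of_cov_eq_zero`, `exists_coercive`).

Finally, the momenta m_i = ⟨M, Ad_g e_i⟩ obey Euler's equations. With u = m₁ + i m₂ these read u' =
i ab m₃ u and m₃' = (a/b − b/a) m₁ m₂. Since |u| = 1, u = e^{iξ} with ξ' = ab m₃, and another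
differentiation gives the pendulum equation. -/

open scoped Matrix Matrix.Norms.L2Operator InnerProductSpace
open NormedSpace

/-! ### Rotations as isometries of the matrix algebra, and the exponential map. -/

/-- Real three by three matrices. -/
abbrev Mat : Type := Matrix (Fin 3) (Fin 3) ℝ

namespace SO3

theorem transpose_mul (g : SO3) : (g : Mat)ᵀ * (g : Mat) = 1 := g.2.1.1

theorem mul_transpose (g : SO3) : (g : Mat) * (g : Mat)ᵀ = 1 := g.2.1.2

theorem norm_eq_one (g : SO3) : ‖(g : Mat)‖ = 1 := by
  have h := Matrix.l2_opNorm_conjTranspose_mul_self (𝕜 := ℝ) (g : Mat)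
  rw [Matrix.conjTranspose_eq_transpose_of_trivial, transpose_mul, norm_one] at h
  nlinarith [norm_nonneg (g : Mat)]

end SO3

theorem norm_transpose_mat (X : Mat) : ‖Xᵀ‖ = ‖X‖ := by
  rw [← Matrix.conjTranspose_eq_transpose_of_trivial, Matrix.l2_opNorm_conjTranspose]

namespace SO3

theorem norm_transpose_eq_one (g : SO3) : ‖(g : Mat)ᵀ‖ = 1 := by
  rw [norm_transpose_mat, norm_eq_one]

theorem norm_mul_le (g : SO3) (X : Mat) : ‖(g : Mat) * X‖ ≤ ‖X‖ := by
  simpa [norm_eq_one] using _root_.norm_mul_le (g : Mat) X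

theorem norm_transpose_mul_le (g : SO3) (X : Mat) : ‖(g : Mat)ᵀ * X‖ ≤ ‖X‖ := by
  simpa [norm_transpose_eq_one] using _root_.norm_mul_le (g : Mat)ᵀ X

theorem norm_mul_coe_le (g : SO3) (X : Mat) : ‖X * (g : Mat)‖ ≤ ‖X‖ := by
  simpa [norm_eq_one] using _root_.norm_mul_le X (g : Mat)

theorem norm_mul_transpose_le (g : SO3) (X : Mat) : ‖X * (g : Mat)ᵀ‖ ≤ ‖X‖ := by
  simpa [norm_transpose_eq_one] using _root_.norm_mul_le X (g : Mat)ᵀ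

theorem norm_conj_le (g : SO3) (X : Mat) : ‖(g : Mat) * X * (g : Mat)ᵀ‖ ≤ ‖X‖ :=
  (norm_mul_transpose_le g _).trans (norm_mul_le g X)

end SO3

theorem so3_transpose (x : so3) : (x : Mat)ᵀ = -(x : Mat) :=
  (LieAlgebra.Orthogonal.mem_so _ _ _).1 x.2

/-- The exponential map of `SO(3)`. -/
noncomputable def expSO3 (x : so3) : SO3 :=
  ⟨exp (x : Mat), by
    have key : ∀ y : so3, (exp (y : Mat))ᵀ * exp (y : Mat) = 1 := fun y => by
      rw [← Matrix.exp_transpose, so3_transpose, Matrix.exp_neg]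
      exact Matrix.nonsing_inv_mul _ ((Matrix.isUnit_iff_isUnit_det _).1 (Matrix.isUnit_exp _))
    -- The determinant of exp x is the square of that of exp (x/2), and orthogonality of exp (x/2)
    -- makes this square 1.
    have hdet : (exp (x : Mat)).det = 1 := by
      have h1 : exp (x : Mat) = exp (((1 / 2 : ℝ) • x : so3) : Mat) * exp (((1 / 2 : ℝ) • x : so3) : Mat) := by
        rw [← Matrix.exp_add_of_commute _ _ (Commute.refl _)]
        congr 1
        have : x = (1 / 2 : ℝ) • x + (1 / 2 : ℝ) • x := by rw [← add_smul]; norm_num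
        exact congrArg (fun y : so3 => (y : Mat)) this
      have h2 := congrArg Matrix.det (key ((1 / 2 : ℝ) • x))
      rw [Matrix.det_mul, Matrix.det_transpose, Matrix.det_one] at h2
      rw [h1, Matrix.det_mul, h2]
    exact ⟨⟨key x, mul_eq_one_comm.1 (key x)⟩, hdet⟩⟩

@[simp] theorem coe_expSO3 (x : so3) : (expSO3 x : Mat) = exp (x : Mat) := rfl

/-! ### First variation of products of exponentials. -/

/-- The derivative of exp − id vanishes at 0 and is Lipschitz near 0, so exp − id has Lipschitz
constant O(ρ) on the ball of radius ρ. Taking a = 0 gives the usual quadratic Taylor bound. -/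
theorem exists_norm_exp_sub_exp_le : ∃ C ≥ 0, ∃ r > 0, ∀ ρ ≤ r, ∀ a b : Mat, ‖a‖ ≤ ρ → ‖b‖ ≤ ρ →
    ‖exp b - exp a - (b - a)‖ ≤ C * ρ * ‖b - a‖ := by
  have han : AnalyticAt ℝ (exp : Mat → Mat) 0 := exp_analytic 0
  have hd : ContDiffAt ℝ 2 (exp : Mat → Mat) 0 := han.contDiffAt
  have hd1 : ContDiffAt ℝ 1 (fderiv ℝ (exp : Mat → Mat)) 0 := hd.fderiv_right (by norm_num)
  obtain ⟨K, t, ht, hK⟩ := hd1.exists_lipschitzOnWith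
  have hdiff : ∀ᶠ x in nhds (0 : Mat), DifferentiableAt ℝ (exp : Mat → Mat) x :=
    (han.eventually_analyticAt).mono fun x hx => hx.differentiableAt
  obtain ⟨r, hr, hball⟩ := Metric.nhds_basis_closedBall.mem_iff.1 (Filter.inter_mem ht hdiff)
  refine ⟨K, K.2, r, hr, fun ρ hρ a b ha hb => ?_⟩
  have h0 : fderiv ℝ (exp : Mat → Mat) 0 = 1 := (hasFDerivAt_exp_zero (𝕂 := ℝ)).fderiv
  have hρr : Metric.closedBall (0 : Mat) ρ ⊆ Metric.closedBall 0 r := Metric.closedBall_subset_closedBall hρ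
  have hρ0 : 0 ≤ ρ := (norm_nonneg a).trans ha
  have := Convex.norm_image_sub_le_of_norm_hasFDerivWithin_le (𝕜 := ℝ) (f := fun x : Mat => exp x - x)
    (f' := fun x => fderiv ℝ (exp : Mat → Mat) x - ContinuousLinearMap.id ℝ Mat)
    (s := Metric.closedBall (0 : Mat) ρ) (C := K * ρ) (x := a) (y := b)
    (fun x hx => ((hball (hρr hx)).2.hasFDerivAt.sub (hasFDerivAt_id x)).hasFDerivWithinAt)
    (fun x hx => by
      have h1 := hK.dist_le_mul x (hball (hρr hx)).1 0 (hball (by simpa using hr.le)).1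
      rw [dist_eq_norm, h0, dist_zero_right] at h1
      refine h1.trans ?_
      have : ‖x‖ ≤ ρ := by simpa using hx
      gcongr) (convex_closedBall _ _) (by simpa using ha) (by simpa using hb)
  simpa [sub_sub_sub_comm] using this

/-- A discrete derivative of the endpoint map, trivialized on the right. The product k_j = Q_j P_jᵀ
changes in one step by k_j · h Ad_{P_j}(b_j − a_j) up to O(h²δ). Since k_j − 1 = O(δ), replacing the
factor k_j by 1 costs O(hδ²) more. The number of steps is at most T/h. -/
theorem exists_first_variation (K T : ℝ) (hK : 0 < K) (hT : 0 < T) :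
    ∃ C ≥ 0, ∃ h₀ > 0, ∀ h > 0, h ≤ h₀ → ∀ (a b : ℕ → Mat) (P Q : ℕ → SO3),
      (∀ j, (P (j + 1) : Mat) = P j * exp (h • a j)) →
      (∀ j, (Q (j + 1) : Mat) = Q j * exp (h • b j)) → P 0 = Q 0 →
      (∀ j, ‖a j‖ ≤ K) → (∀ j, ‖b j‖ ≤ K) → ∀ δ, (∀ j, ‖b j - a j‖ ≤ δ) →
      ∀ N : ℕ, N * h ≤ T →
        ‖(Q N : Mat) - P N‖ ≤ C * δ ∧
        ‖(Q N : Mat) * (P N : Mat)ᵀ - 1 -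
          h • ∑ j ∈ Finset.range N, (P j : Mat) * (b j - a j) * (P j : Mat)ᵀ‖ ≤ C * (h + δ) * δ := by
  obtain ⟨C, hC, r, hr, hexp⟩ := exists_norm_exp_sub_exp_le
  -- The constant of the one-step error: the first term is the remainder of the two exponentials,
  -- the second comes from replacing exp(h a_j)ᵀ by 1.
  set B := C * K + (C * r + 1) * K with hB
  have hB0 : 0 ≤ B := by positivity
  set C₁ := 1 + B * (r / K) with hC₁
  have hC₁0 : 0 ≤ C₁ := by positivity
  refine ⟨T * (C₁ + B + C₁ * T), by positivity, r / K, by positivity, ?_⟩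
  intro h hh hh0 a b P Q hP hQ h0 ha hb δ hδ N hN
  have hδ0 : 0 ≤ δ := (norm_nonneg _).trans (hδ 0)
  have hhK : h * K ≤ r := by rwa [le_div_iff₀ hK] at hh0
  have hna : ∀ j, ‖h • a j‖ ≤ h * K := fun j => by
    rw [norm_smul, Real.norm_of_nonneg hh.le]; gcongr; exact ha j
  have hnb : ∀ j, ‖h • b j‖ ≤ h * K := fun j => by
    rw [norm_smul, Real.norm_of_nonneg hh.le]; gcongr; exact hb j
  set k : ℕ → Mat := fun j => (Q j : Mat) * (P j : Mat)ᵀ with hk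
  have hkn : ∀ j, ‖k j‖ ≤ 1 := fun j =>
    (SO3.norm_mul_le _ _).trans (SO3.norm_transpose_eq_one _).le
  have hstep : ∀ j, ‖k (j + 1) - k j - k j * (h • ((P j : Mat) * (b j - a j) * (P j : Mat)ᵀ))‖
      ≤ B * h ^ 2 * δ := by
    intro j
    set R := exp (h • a j) with hR
    have hRR : R = (P j : Mat)ᵀ * P (j + 1) := by
      rw [hP, ← mul_assoc, SO3.transpose_mul, one_mul]
    have hRn : ‖Rᵀ‖ ≤ 1 := by
      rw [norm_transpose_mat, hRR]
      exact (SO3.norm_transpose_mul_le _ _).trans (SO3.norm_eq_one _).le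
    have hRt : R * Rᵀ = 1 := by
      rw [hRR, Matrix.transpose_mul, Matrix.transpose_transpose, mul_assoc, ← mul_assoc (P (j+1) : Mat),
        SO3.mul_transpose, one_mul, SO3.transpose_mul]
    set E := exp (h • b j) - exp (h • a j) - (h • b j - h • a j) with hE
    have hEn : ‖E‖ ≤ C * (h * K) * (h * δ) := by
      refine (hexp (h * K) hhK _ _ (hna j) (hnb j)).trans ?_
      rw [← smul_sub, norm_smul, Real.norm_of_nonneg hh.le]
      gcongr
      exact hδ j
    have hR1 : ‖Rᵀ - 1‖ ≤ (C * r + 1) * K * h := by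
      have h1 := hexp (h * K) hhK 0 (h • a j) (by simp; positivity) (hna j)
      rw [exp_zero, sub_zero] at h1
      have h2 : ‖R - 1‖ ≤ C * (h * K) * ‖h • a j‖ + ‖h • a j‖ := by
        calc ‖R - 1‖ = ‖(R - 1 - h • a j) + h • a j‖ := by congr 1; abel
          _ ≤ _ := (norm_add_le _ _).trans (by gcongr)
      have h3 : ‖Rᵀ - 1‖ = ‖R - 1‖ := by
        rw [← norm_transpose_mat (R - 1), Matrix.transpose_sub, Matrix.transpose_one]
      rw [h3]
      calc _ ≤ C * (h * K) * ‖h • a j‖ + ‖h • a j‖ := h2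
        _ ≤ C * r * (h * K) + h * K := by gcongr <;> exact hna j
        _ = _ := by ring
    have hid : k (j + 1) - k j - k j * (h • ((P j : Mat) * (b j - a j) * (P j : Mat)ᵀ)) =
        (Q j : Mat) * (E * Rᵀ + (h • (b j - a j)) * (Rᵀ - 1)) * (P j : Mat)ᵀ := by
      have e1 : k (j + 1) = (Q j : Mat) * (exp (h • b j) * Rᵀ) * (P j : Mat)ᵀ := by
        simp only [hk, hP, hQ, Matrix.transpose_mul]; noncomm_ring
      have e2 : k j * (h • ((P j : Mat) * (b j - a j) * (P j : Mat)ᵀ)) =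
          (Q j : Mat) * (h • (b j - a j)) * (P j : Mat)ᵀ := by
        simp only [hk, mul_smul_comm, smul_mul_assoc]
        rw [mul_assoc (Q j : Mat), ← mul_assoc (P j : Mat)ᵀ, ← mul_assoc (P j : Mat)ᵀ,
          SO3.transpose_mul, one_mul, ← mul_assoc]
      have e3 : k j = (Q j : Mat) * (R * Rᵀ) * (P j : Mat)ᵀ := by rw [hRt, mul_one]
      rw [e1, e2, e3, hE, smul_sub]
      noncomm_ring
    rw [hid]
    refine (SO3.norm_mul_transpose_le _ _).trans ((SO3.norm_mul_le _ _).trans ?_)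
    calc _ ≤ ‖E‖ * ‖Rᵀ‖ + ‖h • (b j - a j)‖ * ‖Rᵀ - 1‖ :=
          (norm_add_le _ _).trans (add_le_add (norm_mul_le _ _) (norm_mul_le _ _))
      _ ≤ C * (h * K) * (h * δ) * 1 + h * δ * ((C * r + 1) * K * h) := by
          have : ‖h • (b j - a j)‖ ≤ h * δ := by
            rw [norm_smul, Real.norm_of_nonneg hh.le]; gcongr; exact hδ j
          gcongr
      _ = B * h ^ 2 * δ := by rw [hB]; ring
  have hconj : ∀ j, ‖h • ((P j : Mat) * (b j - a j) * (P j : Mat)ᵀ)‖ ≤ h * δ := fun j => by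
    rw [norm_smul, Real.norm_of_nonneg hh.le]
    gcongr
    exact (SO3.norm_conj_le _ _).trans (hδ j)
  have hk0 : k 0 = 1 := by simp only [hk, h0, SO3.mul_transpose]
  have hfirst : ∀ j : ℕ, ‖k j - 1‖ ≤ j * h * (C₁ * δ) := by
    intro j
    induction j with
    | zero => simp [hk0]
    | succ j ih =>
      have h1 : ‖k (j + 1) - k j‖ ≤ h * (C₁ * δ) := by
        calc ‖k (j + 1) - k j‖ = ‖(k (j + 1) - k j - k j * (h • ((P j : Mat) * (b j - a j) * (P j : Mat)ᵀ)))
              + k j * (h • ((P j : Mat) * (b j - a j) * (P j : Mat)ᵀ))‖ := by congr 1; abel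
          _ ≤ B * h ^ 2 * δ + 1 * (h * δ) := by
              refine (norm_add_le _ _).trans (add_le_add (hstep j) ((norm_mul_le _ _).trans ?_))
              gcongr
              exacts [hkn j, hconj j]
          _ ≤ h * (C₁ * δ) := by
              rw [hC₁]
              have : B * h ^ 2 * δ ≤ B * (h * (r / K)) * δ := by rw [sq]; gcongr
              linarith
      calc ‖k (j + 1) - 1‖ = ‖(k j - 1) + (k (j + 1) - k j)‖ := by congr 1; abel
        _ ≤ j * h * (C₁ * δ) + h * (C₁ * δ) := (norm_add_le _ _).trans (add_le_add ih h1)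
        _ = _ := by push_cast; ring
  have hfirst' : ∀ j : ℕ, j * h ≤ T → ‖k j - 1‖ ≤ T * (C₁ * δ) := fun j hj =>
    (hfirst j).trans (by gcongr)
  constructor
  · have : (Q N : Mat) - P N = (k N - 1) * P N := by
      rw [sub_mul, one_mul, hk]
      simp only [mul_assoc, SO3.transpose_mul, mul_one]
    rw [this]
    calc _ ≤ ‖k N - 1‖ := SO3.norm_mul_coe_le _ _
      _ ≤ T * (C₁ * δ) := hfirst' N hN
      _ ≤ T * (C₁ + B + C₁ * T) * δ := by
          have : 0 ≤ T * (B + C₁ * T) * δ := by positivity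
          linarith
  · have hsec : ∀ j : ℕ, j * h ≤ T → ‖k j - 1 -
        h • ∑ i ∈ Finset.range j, (P i : Mat) * (b i - a i) * (P i : Mat)ᵀ‖ ≤
          j * h * ((B + C₁ * T) * (h + δ) * δ) := by
      intro j
      induction j with
      | zero => intro _; simp [hk0]
      | succ j ih =>
        intro hj
        have hj' : (j : ℝ) * h ≤ T := by push_cast at hj; linarith
        set D := h • ((P j : Mat) * (b j - a j) * (P j : Mat)ᵀ) with hD
        have : k (j + 1) - 1 - h • ∑ i ∈ Finset.range (j + 1), (P i : Mat) * (b i - a i) * (P i : Mat)ᵀ =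
            (k j - 1 - h • ∑ i ∈ Finset.range j, (P i : Mat) * (b i - a i) * (P i : Mat)ᵀ) +
            ((k (j + 1) - k j - k j * D) + (k j - 1) * D) := by
          rw [Finset.sum_range_succ, smul_add, sub_mul, one_mul]
          abel
        rw [this]
        have h2 : ‖(k j - 1) * D‖ ≤ T * (C₁ * δ) * (h * δ) := by
          refine (norm_mul_le _ _).trans ?_
          gcongr
          exacts [hfirst' j hj', hconj j]
        calc _ ≤ j * h * ((B + C₁ * T) * (h + δ) * δ) + (B * h ^ 2 * δ + T * (C₁ * δ) * (h * δ)) :=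
              (norm_add_le _ _).trans (add_le_add (ih hj')
                ((norm_add_le _ _).trans (add_le_add (hstep j) h2)))
          _ ≤ _ := by
              push_cast
              have : 0 ≤ h * (B * δ * δ + C₁ * T * h * δ) := by positivity
              linarith
    refine (hsec N hN).trans ?_
    calc _ ≤ T * ((B + C₁ * T) * (h + δ) * δ) := by gcongr
      _ ≤ _ := by
        have : 0 ≤ T * C₁ * (h + δ) * δ := by positivity
        linarith

/-! ### Horizontal paths: controls, displacement, concatenation. -/

-- Induction on the exceptional points: one that lies inside the interval splits it in two. This
-- passes from the smooth pieces of a horizontal path to the whole path.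
open MeasureTheory in
theorem intervalIntegrable_of_forall_subinterval {E : Type*} [NormedAddCommGroup E] {f : ℝ → E} (P : Finset ℝ) :
    ∀ s t : ℝ, s ≤ t → (∀ s' t' : ℝ, s ≤ s' → s' < t' → t' ≤ t → (∀ p ∈ P, p ∉ Set.Ioo s' t') →
      IntervalIntegrable f volume s' t') → IntervalIntegrable f volume s t := by
  induction P using Finset.induction_on with
  | empty =>
    intro s t hst H
    rcases hst.eq_or_lt with rfl | hlt
    · exact IntervalIntegrable.refl
    · exact H s t le_rfl hlt le_rfl (by simp)
  | insert p P _ ih =>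
    intro s t hst H
    by_cases hp : p ∈ Set.Ioo s t
    · refine (ih s p hp.1.le fun s' t' h1 h2 h3 h4 => H s' t' h1 h2 (h3.trans hp.2.le) ?_).trans
        (ih p t hp.2.le fun s' t' h1 h2 h3 h4 => H s' t' (hp.1.le.trans h1) h2 h3 ?_)
      · intro q hq
        rcases Finset.mem_insert.1 hq with rfl | hq
        · exact fun h => absurd h.2 (not_lt.2 h3)
        · exact h4 q hq
      · intro q hq
        rcases Finset.mem_insert.1 hq with rfl | hq
        · exact fun h => absurd h.1 (not_lt.2 h1)
        · exact h4 q hq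
    · refine ih s t hst fun s' t' h1 h2 h3 h4 => H s' t' h1 h2 h3 ?_
      intro q hq
      rcases Finset.mem_insert.1 hq with rfl | hq
      · exact fun h => hp ⟨h1.trans_lt h.1, h.2.trans_le h3⟩
      · exact h4 q hq

/-- The entry of a matrix as a continuous linear map. -/
noncomputable def entryCLM (i j : Fin 3) : Mat →L[ℝ] ℝ :=
  LinearMap.toContinuousLinearMap (Matrix.entryLinearMap ℝ ℝ i j)

theorem contDiffOn_mat_iff {n : WithTop ℕ∞} {f : ℝ → Mat} {s : Set ℝ} :
    ContDiffOn ℝ n f s ↔ ∀ i j, ContDiffOn ℝ n (fun t => f t i j) s := by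
  constructor
  · intro h i j
    exact (entryCLM i j).contDiff.comp_contDiffOn h
  · intro h
    have : f = fun t => ∑ i, ∑ j, f t i j • Matrix.single i j (1 : ℝ) := by
      funext t
      conv_lhs => rw [Matrix.matrix_eq_sum_single (f t)]
      simp
    rw [this]
    exact ContDiffOn.sum fun i _ => ContDiffOn.sum fun j _ => (h i j).smul contDiffOn_const

/-- The element `x e₁ + y e₂` of `so(3)` with complex coordinate `x + i y`. -/
noncomputable def ctlSo (e₁ e₂ : so3) (z : ℂ) : so3 := z.re • e₁ + z.im • e₂

/-- The matrix `x e₁ + y e₂` with complex coordinate `x + i y`. -/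
noncomputable def ctl (e₁ e₂ : so3) : ℂ →L[ℝ] Mat :=
  Complex.reCLM.smulRight (e₁ : Mat) + Complex.imCLM.smulRight (e₂ : Mat)

theorem ctl_apply (e₁ e₂ : so3) (z : ℂ) : ctl e₁ e₂ z = z.re • (e₁ : Mat) + z.im • (e₂ : Mat) := rfl

theorem coe_ctlSo (e₁ e₂ : so3) (z : ℂ) : (ctlSo e₁ e₂ z : Mat) = ctl e₁ e₂ z := rfl

theorem transpose_ctl (e₁ e₂ : so3) (z : ℂ) : (ctl e₁ e₂ z)ᵀ = -ctl e₁ e₂ z :=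
  so3_transpose (ctlSo e₁ e₂ z)

namespace SubRiemannianSO3

/-- `e₁, e₂` is an orthonormal basis of the distribution of `S`. -/
structure IsFrame (S : SubRiemannianSO3) (e₁ e₂ : so3) : Prop where
  exists_coord : ∀ v : S.p, ∃ z : ℂ, (v : so3) = ctlSo e₁ e₂ z ∧ S.norm v = ‖z‖
  exists_vector : ∀ z : ℂ, ∃ v : S.p, (v : so3) = ctlSo e₁ e₂ z ∧ S.norm v = ‖z‖
  ctl_injective : Function.Injective (ctl e₁ e₂)

/-- There is a horizontal path of length `l` from `x` to `y`. -/
def Reach (S : SubRiemannianSO3) (x y : SO3) (l : ℝ) : Prop :=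
  ∃ (T : ℝ) (γ : ℝ → SO3) (u : ℝ → S.p), S.IsHorizontalPath T γ u ∧
    γ 0 = x ∧ γ T = y ∧ l = ∫ t in (0 : ℝ)..T, S.norm (u t)

variable {S : SubRiemannianSO3} {e₁ e₂ : so3}

theorem Reach.dist_le {x y : SO3} {l : ℝ} (h : S.Reach x y l) : S.dist x y ≤ ENNReal.ofReal l := by
  obtain ⟨T, γ, u, h1, h2, h3, rfl⟩ := h
  exact sInf_le ⟨T, γ, u, h1, h2, h3, rfl⟩

theorem Reach.nonneg {x y : SO3} {l : ℝ} (h : S.Reach x y l) : 0 ≤ l := by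
  obtain ⟨T, γ, u, h1, h2, h3, rfl⟩ := h
  exact intervalIntegral.integral_nonneg h1.1 fun t _ => Real.sqrt_nonneg _

theorem exists_reach_of_dist_lt {x y : SO3} {L : ℝ} (h : S.dist x y < ENNReal.ofReal L) :
    ∃ l < L, S.Reach x y l := by
  obtain ⟨_, ⟨T, γ, u, h1, h2, h3, rfl⟩, hl⟩ := sInf_lt_iff.1 h
  exact ⟨_, (ENNReal.ofReal_lt_ofReal_iff_of_nonneg
    (Reach.nonneg (S := S) ⟨T, γ, u, h1, h2, h3, rfl⟩)).1 hl, T, γ, u, h1, h2, h3, rfl⟩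

/-- The definition of a horizontal path imposes no regularity on the control. On each smooth closed
piece, however, the control is a left inverse of `ctl` applied to γᵀ γ', which is continuous up to
the ends, so it is integrable. -/
theorem IsFrame.exists_coord_fun (hF : S.IsFrame e₁ e₂) {T : ℝ} {γ : ℝ → SO3} {u : ℝ → S.p}
    (h : S.IsHorizontalPath T γ u) : ∃ z : ℝ → ℂ, (∀ t, (u t : so3) = ctlSo e₁ e₂ (z t)) ∧
      (∀ t, S.norm (u t) = ‖z t‖) ∧ IntervalIntegrable z MeasureTheory.volume 0 T := by
  choose z hz hzn using fun t => hF.exists_coord (u t)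
  refine ⟨z, hz, hzn, ?_⟩
  obtain ⟨hT, hcont, P, hP, hd⟩ := h
  obtain ⟨ζ₀, hζ₀⟩ := LinearMap.exists_leftInverse_of_injective (ctl e₁ e₂ : ℂ →ₗ[ℝ] Mat)
    (LinearMap.ker_eq_bot.2 hF.ctl_injective)
  let ζ : Mat →L[ℝ] ℂ := LinearMap.toContinuousLinearMap ζ₀
  have hζ : ∀ w, ζ (ctl e₁ e₂ w) = w := fun w => LinearMap.congr_fun hζ₀ w
  refine intervalIntegrable_of_forall_subinterval P 0 T hT fun s t h0s hst htT hclean => ?_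
  have hC : ContDiffOn ℝ ∞ (fun t => (γ t : Mat)) (Set.Icc s t) :=
    contDiffOn_mat_iff.2 (hP s t h0s hst htT hclean)
  have hder : ContinuousOn (derivWithin (fun t => (γ t : Mat)) (Set.Icc s t)) (Set.Icc s t) :=
    hC.continuousOn_derivWithin (uniqueDiffOn_Icc hst) (by simp)
  have hcomb : ContinuousOn (fun r => ζ ((γ r : Mat)ᵀ *
      derivWithin (fun t => (γ t : Mat)) (Set.Icc s t) r)) (Set.Icc s t) := by
    refine ζ.continuous.comp_continuousOn (ContinuousOn.mul ?_ hder)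
    exact (continuous_id.matrix_transpose).comp_continuousOn hC.continuousOn
  rw [intervalIntegrable_iff_integrableOn_Ioo_of_le hst.le]
  refine ((hcomb.integrableOn_Icc).mono_set Set.Ioo_subset_Icc_self).congr_fun ?_ measurableSet_Ioo
  intro r hr
  have hcontrol : HasDerivAt (fun s => (γ s : Mat)) ((γ r : Mat) * ((u r : so3) : Mat)) r :=
    hd r ⟨h0s.trans_lt hr.1, hr.2.trans_le htT⟩ fun hrP => hclean r hrP hr
  have h1 : derivWithin (fun t => (γ t : Mat)) (Set.Icc s t) r = (γ r : Mat) * ((u r : so3) : Mat) := by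
    rw [derivWithin_of_mem_nhds (Icc_mem_nhds hr.1 hr.2), hcontrol.deriv]
  simp only [h1, hz]
  rw [← mul_assoc, SO3.transpose_mul, one_mul, coe_ctlSo, hζ]

/-- The vector w is the integral of the control. In the integral equation for f = γ(0)ᵀ γ the error
is the integral of (f − 1) times the control, and ‖f − 1‖ is itself at most ‖ctl‖ l. -/
theorem IsFrame.exists_displacement (hF : S.IsFrame e₁ e₂) {x y : SO3} {l : ℝ} (h : S.Reach x y l) :
    ∃ w : ℂ, ‖w‖ ≤ l ∧ ‖(x : Mat)ᵀ * y - 1 - ctl e₁ e₂ w‖ ≤ (‖ctl e₁ e₂‖ * l) ^ 2 := by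
  have hl0 := h.nonneg
  obtain ⟨T, γ, u, hor, rfl, rfl, rfl⟩ := h
  obtain ⟨z, hz, hzn, hzi⟩ := hF.exists_coord_fun hor
  obtain ⟨hT, hcont, P, hP, hd⟩ := hor
  set l := ∫ t in (0 : ℝ)..T, S.norm (u t) with hl
  have hlz : l = ∫ t in (0 : ℝ)..T, ‖z t‖ := by simp only [hl, hzn]
  set K := ‖ctl e₁ e₂‖
  set f : ℝ → Mat := fun t => (γ 0 : Mat)ᵀ * γ t with hf
  have hfc : ContinuousOn f (Set.Icc 0 T) := continuousOn_const.mul hcont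
  have hfn : ∀ t X, ‖f t * X‖ ≤ ‖X‖ := fun t X => by
    rw [hf, mul_assoc]
    exact (SO3.norm_transpose_mul_le _ _).trans (SO3.norm_mul_le _ _)
  have hfd : ∀ t ∈ Set.Ioo 0 T, t ∉ P → HasDerivAt f (f t * ctl e₁ e₂ (z t)) t := by
    intro t ht htP
    have h1 : HasDerivAt (fun s => (γ s : Mat)) ((γ t : Mat) * ((u t : so3) : Mat)) t := hd t ht htP
    have h2 := h1.const_mul ((γ 0 : Mat)ᵀ)
    rw [hz, coe_ctlSo, ← mul_assoc] at h2
    exact h2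
  have hgi : IntervalIntegrable (fun t => ctl e₁ e₂ (z t)) MeasureTheory.volume 0 T :=
    ⟨(ctl e₁ e₂).integrable_comp hzi.1, (ctl e₁ e₂).integrable_comp hzi.2⟩
  have hfgi : IntervalIntegrable (fun t => f t * ctl e₁ e₂ (z t)) MeasureTheory.volume 0 T :=
    hgi.continuousOn_mul (by rwa [Set.uIcc_of_le hT])
  have hf0 : f 0 = 1 := SO3.transpose_mul _
  have hzK : ∀ t, ‖ctl e₁ e₂ (z t)‖ ≤ K * ‖z t‖ := fun t => (ctl e₁ e₂).le_opNorm _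
  have hsub : ∀ t ∈ Set.Icc 0 T, f t - 1 = ∫ s in (0 : ℝ)..t, f s * ctl e₁ e₂ (z s) := by
    intro t ht
    rw [← hf0]
    refine (MeasureTheory.integral_eq_of_hasDerivAt_off_countable_of_le f _ ht.1
      (s := (P : Set ℝ)) P.countable_toSet (hfc.mono (Set.Icc_subset_Icc_right ht.2)) ?_ ?_).symm
    · exact fun r hr => hfd r ⟨hr.1.1, hr.1.2.trans_le ht.2⟩ hr.2
    · exact hfgi.mono_set (by rw [Set.uIcc_of_le ht.1, Set.uIcc_of_le hT]; exact Set.Icc_subset_Icc_right ht.2)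
  have hfirst : ∀ t ∈ Set.Icc 0 T, ‖f t - 1‖ ≤ K * l := by
    intro t ht
    rw [hsub t ht]
    have hnn : ∀ s, 0 ≤ K * ‖z s‖ := fun s => by positivity
    calc _ ≤ ∫ s in (0 : ℝ)..t, K * ‖z s‖ := by
          refine intervalIntegral.norm_integral_le_of_norm_le ht.1 (.of_forall fun s _ =>
            (hfn _ _).trans (hzK s)) ?_
          exact (hzi.norm.const_mul K).mono_set
            (by rw [Set.uIcc_of_le ht.1, Set.uIcc_of_le hT]; exact Set.Icc_subset_Icc_right ht.2)
      _ ≤ ∫ s in (0 : ℝ)..T, K * ‖z s‖ :=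
          intervalIntegral.integral_mono_interval le_rfl ht.1 ht.2 (.of_forall hnn) (hzi.norm.const_mul K)
      _ = K * l := by rw [intervalIntegral.integral_const_mul, hlz]
  refine ⟨∫ t in (0 : ℝ)..T, z t, ?_, ?_⟩
  · rw [hlz]; exact intervalIntegral.norm_integral_le_integral_norm hT
  · have h1 : ctl e₁ e₂ (∫ t in (0 : ℝ)..T, z t) = ∫ t in (0 : ℝ)..T, ctl e₁ e₂ (z t) :=
      ((ctl e₁ e₂).intervalIntegral_comp_comm hzi).symm
    have h2 : (γ 0 : Mat)ᵀ * (γ T : Mat) - 1 = ∫ t in (0 : ℝ)..T, f t * ctl e₁ e₂ (z t) :=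
      hsub T ⟨hT, le_rfl⟩
    rw [h1, h2, ← intervalIntegral.integral_sub hfgi hgi]
    calc _ ≤ ∫ s in (0 : ℝ)..T, K * l * (K * ‖z s‖) := by
          refine intervalIntegral.norm_integral_le_of_norm_le hT (.of_forall fun s hs => ?_)
            ((hzi.norm.const_mul K).const_mul _)
          have : f s * ctl e₁ e₂ (z s) - ctl e₁ e₂ (z s) = (f s - 1) * ctl e₁ e₂ (z s) := by
            rw [sub_mul, one_mul]
          rw [this]
          refine (norm_mul_le _ _).trans ?_
          gcongr
          · exact hfirst s ⟨hs.1.le, hs.2⟩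
          · exact hzK s
      _ = (K * l) ^ 2 := by
          rw [intervalIntegral.integral_const_mul, intervalIntegral.integral_const_mul, ← hlz]; ring

theorem reach_refl (S : SubRiemannianSO3) (x : SO3) : S.Reach x x 0 := by
  refine ⟨0, fun _ => x, fun _ => 0, ⟨le_rfl, continuousOn_const, ∅, ?_, ?_⟩, rfl, rfl, by simp⟩
  · intro _ _ _ _ _ _ i j; exact contDiffOn_const
  · intro t ht; exact absurd ht (by simp)

theorem contDiff_exp_smul (X : Mat) : ContDiff ℝ ∞ fun t : ℝ => exp (t • X) := by
  have h : ContDiff ℝ ∞ (exp : Mat → Mat) :=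
    contDiff_iff_contDiffAt.2 fun x => (exp_analytic (𝕂 := ℝ) x).contDiffAt
  exact h.comp (contDiff_id.smul contDiff_const)

/-- The path is followed for one unit of time by the one-parameter subgroup of the new control. The
junction becomes a new exceptional time. -/
theorem IsFrame.reach_append (hF : S.IsFrame e₁ e₂) {x y : SO3} {l : ℝ} (h : S.Reach x y l) (z : ℂ) :
    S.Reach x (y * expSO3 (ctlSo e₁ e₂ z)) (l + ‖z‖) := by
  obtain ⟨T, γ, u, hor, rfl, rfl, rfl⟩ := h
  obtain ⟨w, hw, hwn, hwi⟩ := hF.exists_coord_fun hor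
  obtain ⟨hT, hcont, P, hP, hd⟩ := hor
  obtain ⟨v, hv, hvn⟩ := hF.exists_vector z
  set γ' : ℝ → SO3 := fun t =>
    if t ≤ T then γ t else γ T * expSO3 ((t - T) • ctlSo e₁ e₂ z) with hγ'
  set u' : ℝ → S.p := fun t => if t < T then u t else v with hu'
  have hle : ∀ t ≤ T, γ' t = γ t := fun t ht => if_pos ht
  have hge : ∀ t, T ≤ t → (γ' t : Mat) = γ T * exp ((t - T) • ctl e₁ e₂ z) := by
    intro t ht
    rcases ht.eq_or_lt with rfl | hlt
    · simp [hγ']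
    · simp only [hγ', if_neg (not_le.2 hlt)]; rfl
  have hsm : ContDiff ℝ ∞ fun t : ℝ => (γ T : Mat) * exp ((t - T) • ctl e₁ e₂ z) :=
    contDiff_const.mul ((contDiff_exp_smul (ctl e₁ e₂ z)).comp (contDiff_id.sub contDiff_const))
  refine ⟨T + 1, γ', u', ⟨by linarith, ?_, insert T P, ?_, ?_⟩, hle 0 hT, ?_, ?_⟩
  · rw [← Set.Icc_union_Icc_eq_Icc hT (by linarith : T ≤ T + 1)]
    refine ContinuousOn.union_of_isClosed ?_ ?_ isClosed_Icc isClosed_Icc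
    · exact hcont.congr fun t ht => by rw [hle t ht.2]
    · exact hsm.continuous.continuousOn.congr fun t ht => hge t ht.1
  · intro t₀ t₁ h0 h01 h1 hclean
    have hTc := hclean T (Finset.mem_insert_self _ _)
    rcases le_or_gt t₁ T with h | h
    · intro i j
      refine (hP t₀ t₁ h0 h01 h (fun t ht => hclean t (Finset.mem_insert_of_mem ht)) i j).congr ?_
      intro t ht
      simp only [hle t (ht.2.trans h)]
    · have h' : T ≤ t₀ := by
        by_contra hcon
        exact hTc ⟨not_le.1 hcon, h⟩
      refine contDiffOn_mat_iff.1 (hsm.contDiffOn.congr fun t ht => hge t (h'.trans ht.1))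
  · intro t ht htP
    have htT : t ≠ T := fun h => htP (h ▸ Finset.mem_insert_self _ _)
    rcases lt_or_gt_of_ne htT with h | h
    · have h1 : HasDerivAt (fun s => (γ s : Mat)) ((γ t : Mat) * ((u t : so3) : Mat)) t :=
        hd t ⟨ht.1, h⟩ fun hh => htP (Finset.mem_insert_of_mem hh)
      have h2 : HasDerivAt (fun s => (γ' s : Mat)) ((γ t : Mat) * ((u t : so3) : Mat)) t :=
        h1.congr_of_eventuallyEq ((eventually_lt_nhds h).mono fun s hs => by simp only [hle s hs.le])
      have e1 : u' t = u t := if_pos h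
      rw [← hle t h.le, ← e1] at h2
      exact h2
    · have h1 : HasDerivAt (fun s : ℝ => exp (s • ctl e₁ e₂ z)) (exp ((t - T) • ctl e₁ e₂ z) * ctl e₁ e₂ z)
          (t - T) := hasDerivAt_exp_smul_const _ _
      have h2 := (h1.comp_sub_const t T).const_mul (γ T : Mat)
      have h3 : HasDerivAt (fun s => (γ' s : Mat))
          ((γ T : Mat) * (exp ((t - T) • ctl e₁ e₂ z) * ctl e₁ e₂ z)) t :=
        h2.congr_of_eventuallyEq ((eventually_gt_nhds h).mono fun s hs => hge s hs.le)
      have e1 : u' t = v := if_neg (not_lt.2 h.le)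
      rw [← mul_assoc, ← hge t h.le, ← coe_ctlSo, ← hv, ← e1] at h3
      exact h3
  · apply Subtype.ext
    rw [hge _ (by linarith), Submonoid.coe_mul]
    simp [coe_ctlSo]
  · have hn : IntervalIntegrable (fun t => S.norm (u t)) MeasureTheory.volume 0 T := by
      simp only [hwn]; exact hwi.norm
    -- At the junction itself the control has already switched, which is a null set.
    have e1 : ∀ᵐ t, t ∈ Set.uIoc 0 T → S.norm (u' t) = S.norm (u t) := by
      have : ∀ᵐ t : ℝ, t ≠ T := by
        simp [MeasureTheory.ae_iff]
      filter_upwards [this] with t ht htI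
      rw [Set.uIoc_of_le hT] at htI
      simp only [hu', if_pos (lt_of_le_of_ne htI.2 ht)]
    have e2 : Set.EqOn (fun t => S.norm (u' t)) (fun _ => ‖z‖) (Set.uIcc T (T + 1)) := by
      intro t ht
      rw [Set.uIcc_of_le (by linarith)] at ht
      simp only [hu', if_neg (not_lt.2 ht.1), hvn]
    have i1 : IntervalIntegrable (fun t => S.norm (u' t)) MeasureTheory.volume 0 T := by
      refine hn.congr_ae ?_
      rw [Filter.EventuallyEq, MeasureTheory.ae_restrict_iff' measurableSet_uIoc]
      filter_upwards [e1] with t ht htI using (ht htI).symm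
    have i2 : IntervalIntegrable (fun t => S.norm (u' t)) MeasureTheory.volume T (T + 1) :=
      (intervalIntegrable_const (c := ‖z‖)).congr fun t ht => (e2 (Set.uIoc_subset_uIcc ht)).symm
    rw [← intervalIntegral.integral_add_adjacent_intervals i1 i2,
      intervalIntegral.integral_congr_ae e1, intervalIntegral.integral_congr e2]
    simp

theorem IsFrame.reach_prod (hF : S.IsFrame e₁ e₂) (P : ℕ → SO3) (z : ℕ → ℂ)
    (hP : ∀ j, P (j + 1) = P j * expSO3 (ctlSo e₁ e₂ (z j))) (N : ℕ) :
    S.Reach (P 0) (P N) (∑ j ∈ Finset.range N, ‖z j‖) := by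
  induction N with
  | zero => simpa using S.reach_refl (P 0)
  | succ N ih =>
    rw [Finset.sum_range_succ, hP]
    exact hF.reach_append ih _

end SubRiemannianSO3

/-! ### Axial vectors, transported controls and the Gram operator. -/

/-- Euclidean three-space. -/
abbrev V3 : Type := EuclideanSpace ℝ (Fin 3)

/-- The axial vector of the skew part of a matrix. -/
noncomputable def vee : Mat →L[ℝ] V3 :=
  LinearMap.toContinuousLinearMap
    { toFun := fun X => !₂[(X 2 1 - X 1 2) / 2, (X 0 2 - X 2 0) / 2, (X 1 0 - X 0 1) / 2]
      map_add' := fun X Y => by ext i; fin_cases i <;> simp <;> ring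
      map_smul' := fun c X => by ext i; fin_cases i <;> simp <;> ring }

theorem vee_apply (X : Mat) :
    vee X = !₂[(X 2 1 - X 1 2) / 2, (X 0 2 - X 2 0) / 2, (X 1 0 - X 0 1) / 2] := rfl

theorem vee_one : vee 1 = 0 := by
  ext i; fin_cases i <;> simp [vee_apply]

theorem transpose_eq_of_vee_eq_zero {X : Mat} (h : vee X = 0) : Xᵀ = X := by
  have h0 := congrArg (fun v : V3 => v 0) h
  have h1 := congrArg (fun v : V3 => v 1) h
  have h2 := congrArg (fun v : V3 => v 2) h
  simp [vee_apply] at h0 h1 h2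
  ext i j
  fin_cases i <;> fin_cases j <;> simp [Matrix.transpose_apply] <;> linarith

/-- A rotation with no skew part is symmetric, hence an involution, so 2(k − 1) = −(k − 1)². The
norm of k − 1 is then 0 or at least 2. Near the identity, three scalar equations thus suffice to hit
a prescribed endpoint. -/
theorem SO3.eq_one_of_vee_eq_zero (k : SO3) (h : vee (k : Mat) = 0) (hk : ‖(k : Mat) - 1‖ < 2) :
    k = 1 := by
  have hs := transpose_eq_of_vee_eq_zero h
  have h1 : (k : Mat) * k = 1 := by
    have := k.transpose_mul
    rwa [hs] at this
  have h2 : (2 : ℝ) • ((k : Mat) - 1) = -(((k : Mat) - 1) * ((k : Mat) - 1)) := by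
    rw [sub_mul, mul_sub, mul_one, one_mul, h1, two_smul]
    abel
  have h3 : 2 * ‖(k : Mat) - 1‖ ≤ ‖(k : Mat) - 1‖ * ‖(k : Mat) - 1‖ := by
    calc 2 * ‖(k : Mat) - 1‖ = ‖(2 : ℝ) • ((k : Mat) - 1)‖ := by
          rw [norm_smul, Real.norm_of_nonneg zero_le_two]
      _ = ‖((k : Mat) - 1) * ((k : Mat) - 1)‖ := by rw [h2, norm_neg]
      _ ≤ _ := _root_.norm_mul_le _ _
  have h4 : ‖(k : Mat) - 1‖ = 0 := by
    by_contra hne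
    have : 0 < ‖(k : Mat) - 1‖ := lt_of_le_of_ne (norm_nonneg _) (Ne.symm hne)
    nlinarith
  exact Subtype.ext (sub_eq_zero.1 (norm_eq_zero.1 h4))

/-- The map `z ↦ Ad_X (x e₁ + y e₂)`, `z = x + i y`, with values in `ℝ³`. -/
noncomputable def push (e₁ e₂ : so3) (X : Mat) : ℂ →L[ℝ] V3 :=
  vee ∘L (ContinuousLinearMap.mulLeftRight ℝ Mat X Xᵀ) ∘L ctl e₁ e₂

theorem push_apply (e₁ e₂ : so3) (X : Mat) (z : ℂ) :
    push e₁ e₂ X z = vee (X * ctl e₁ e₂ z * Xᵀ) := rfl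

/-- The adjoint of `push`. -/
noncomputable def cov (e₁ e₂ : so3) (X : Mat) : V3 →L[ℝ] ℂ :=
  ContinuousLinearMap.adjoint (push e₁ e₂ X)

theorem inner_cov (e₁ e₂ : so3) (X : Mat) (x : V3) (z : ℂ) :
    ⟪cov e₁ e₂ X x, z⟫_ℝ = ⟪x, push e₁ e₂ X z⟫_ℝ :=
  ContinuousLinearMap.adjoint_inner_left _ _ _

theorem inner_push (e₁ e₂ : so3) (X : Mat) (x : V3) (z : ℂ) :
    ⟪push e₁ e₂ X z, x⟫_ℝ = ⟪z, cov e₁ e₂ X x⟫_ℝ := by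
  rw [real_inner_comm, ← inner_cov, real_inner_comm]

/-- A bound for the norms of the maps `push` at rotations. -/
noncomputable def pushBound (e₁ e₂ : so3) : ℝ := ‖vee‖ * ‖ctl e₁ e₂‖

theorem pushBound_nonneg (e₁ e₂ : so3) : 0 ≤ pushBound e₁ e₂ := by unfold pushBound; positivity

theorem norm_mul_mul_transpose_sub_le (X Y Z : Mat) (hX : ‖X‖ ≤ 1) (hY : ‖Y‖ ≤ 1) :
    ‖X * Z * Xᵀ - Y * Z * Yᵀ‖ ≤ 2 * ‖X - Y‖ * ‖Z‖ := by
  have : X * Z * Xᵀ - Y * Z * Yᵀ = (X - Y) * Z * Xᵀ + Y * Z * (X - Y)ᵀ := by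
    rw [Matrix.transpose_sub]; noncomm_ring
  rw [this]
  have h1 : ‖(X - Y) * Z * Xᵀ‖ ≤ ‖X - Y‖ * ‖Z‖ * 1 := by
    refine (norm_mul_le _ _).trans ?_
    rw [norm_transpose_mat]
    gcongr
    exact norm_mul_le _ _
  have h2 : ‖Y * Z * (X - Y)ᵀ‖ ≤ 1 * ‖Z‖ * ‖X - Y‖ := by
    refine (norm_mul_le _ _).trans ?_
    rw [norm_transpose_mat]
    gcongr
    refine (norm_mul_le _ _).trans ?_
    gcongr
  calc _ ≤ _ := norm_add_le _ _
    _ ≤ _ := by linarith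

theorem norm_push_sub_le (e₁ e₂ : so3) (X Y : SO3) :
    ‖push e₁ e₂ X - push e₁ e₂ Y‖ ≤ 2 * pushBound e₁ e₂ * ‖(X : Mat) - Y‖ := by
  have := pushBound_nonneg e₁ e₂
  refine ContinuousLinearMap.opNorm_le_bound _ (by positivity) fun z => ?_
  rw [sub_apply, push_apply, push_apply, ← map_sub]
  calc _ ≤ ‖vee‖ * (2 * ‖(X : Mat) - Y‖ * (‖ctl e₁ e₂‖ * ‖z‖)) := by
        refine (vee.le_opNorm _).trans ?_
        gcongr
        refine (norm_mul_mul_transpose_sub_le _ _ _ X.norm_eq_one.le Y.norm_eq_one.le).trans ?_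
        gcongr
        exact (ctl e₁ e₂).le_opNorm z
    _ = _ := by unfold pushBound; ring

theorem norm_push_le (e₁ e₂ : so3) (X : SO3) : ‖push e₁ e₂ X‖ ≤ pushBound e₁ e₂ := by
  refine ContinuousLinearMap.opNorm_le_bound _ (pushBound_nonneg _ _) fun z => ?_
  rw [push_apply]
  calc _ ≤ ‖vee‖ * (‖ctl e₁ e₂‖ * ‖z‖) := by
        refine (vee.le_opNorm _).trans ?_
        gcongr
        exact (X.norm_conj_le _).trans ((ctl e₁ e₂).le_opNorm z)
    _ = _ := by unfold pushBound; ring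

theorem norm_cov_le (e₁ e₂ : so3) (X : SO3) (x : V3) :
    ‖cov e₁ e₂ X x‖ ≤ pushBound e₁ e₂ * ‖x‖ := by
  refine ((cov e₁ e₂ X).le_opNorm x).trans ?_
  gcongr
  rw [cov, LinearIsometryEquiv.norm_map]
  exact norm_push_le _ _ _

theorem norm_cov_sub_le (e₁ e₂ : so3) (X Y : SO3) (x : V3) :
    ‖cov e₁ e₂ X x - cov e₁ e₂ Y x‖ ≤ 2 * pushBound e₁ e₂ * ‖(X : Mat) - Y‖ * ‖x‖ := by
  rw [← sub_apply]
  refine (ContinuousLinearMap.le_opNorm _ x).trans ?_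
  gcongr
  rw [cov, cov, ← map_sub, LinearIsometryEquiv.norm_map]
  exact norm_push_sub_le _ _ _ _

/-- The Gram operator `h ∑ push cov` of a finite sequence of rotations. -/
noncomputable def gram (e₁ e₂ : so3) (h : ℝ) (N : ℕ) (P : ℕ → SO3) : V3 →L[ℝ] V3 :=
  h • ∑ j ∈ Finset.range N, push e₁ e₂ (P j) ∘L cov e₁ e₂ (P j)

theorem gram_apply (e₁ e₂ : so3) (h : ℝ) (N : ℕ) (P : ℕ → SO3) (x : V3) :
    gram e₁ e₂ h N P x = h • ∑ j ∈ Finset.range N, push e₁ e₂ (P j) (cov e₁ e₂ (P j) x) := by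
  simp [gram]

theorem inner_gram (e₁ e₂ : so3) (h : ℝ) (N : ℕ) (P : ℕ → SO3) (x : V3) :
    ⟪gram e₁ e₂ h N P x, x⟫_ℝ = h * ∑ j ∈ Finset.range N, ‖cov e₁ e₂ (P j) x‖ ^ 2 := by
  rw [gram_apply, real_inner_smul_left, sum_inner]
  simp only [inner_push, real_inner_self_eq_norm_sq]

theorem norm_le_of_coercive {f : V3 →L[ℝ] V3} {κ : ℝ} (hκ : 0 < κ)
    (hf : ∀ x, κ * ‖x‖ ^ 2 ≤ ⟪f x, x⟫_ℝ) (x : V3) : ‖x‖ ≤ κ⁻¹ * ‖f x‖ := by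
  rcases eq_or_ne x 0 with rfl | hx
  · simp
  · have hx' : 0 < ‖x‖ := norm_pos_iff.2 hx
    have h1 := (hf x).trans (real_inner_le_norm _ _)
    rw [inv_mul_eq_div, le_div_iff₀ hκ]
    nlinarith

theorem surjective_of_coercive {f : V3 →L[ℝ] V3} {κ : ℝ} (hκ : 0 < κ)
    (hf : ∀ x, κ * ‖x‖ ^ 2 ≤ ⟪f x, x⟫_ℝ) : Function.Surjective f := by
  have hinj : Function.Injective (f : V3 →ₗ[ℝ] V3) := by
    rw [injective_iff_map_eq_zero]
    intro x hx
    have := norm_le_of_coercive hκ hf x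
    have hx' : f x = 0 := hx
    rw [hx', norm_zero, mul_zero] at this
    exact norm_le_zero_iff.1 this
  exact LinearMap.injective_iff_surjective.1 hinj

/-- Puts the inverse of a coercive operator in the form required by the quantitative surjectivity
theorem for maps that approximate a linear one. -/
theorem exists_nonlinearRightInverse {f : V3 →L[ℝ] V3} {κ : ℝ} (hκ : 0 < κ)
    (hf : ∀ x, κ * ‖x‖ ^ 2 ≤ ⟪f x, x⟫_ℝ) : ∃ r : f.NonlinearRightInverse, (r.nnnorm : ℝ) = κ⁻¹ := by
  choose g hg using surjective_of_coercive hκ hf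
  refine ⟨⟨g, ⟨κ⁻¹, by positivity⟩, fun y => ?_, hg⟩, rfl⟩
  have := norm_le_of_coercive hκ hf (g y)
  rwa [hg] at this

/-! ### Variations with a prescribed endpoint. -/

/-- The product of the exponentials of a sequence of elements of `so(3)`. -/
noncomputable def expPath (P₀ : SO3) (z : ℕ → so3) : ℕ → SO3
  | 0 => P₀
  | j + 1 => expPath P₀ z j * expSO3 (z j)

theorem coe_mul_expSO3_ctlSo (e₁ e₂ : so3) (P : SO3) (h : ℝ) (z : ℂ) :
    ((P * expSO3 (ctlSo e₁ e₂ (h • z)) : SO3) : Mat) = P * exp (h • ctl e₁ e₂ z) := by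
  rw [Submonoid.coe_mul, coe_expSO3, coe_ctlSo, map_smul]

theorem eq_of_vee_mul_transpose_eq_zero (X Y : SO3) (h : vee ((X : Mat) * (Y : Mat)ᵀ) = 0)
    (hk : ‖(X : Mat) - Y‖ < 2) : X = Y := by
  have h1 : ‖((X * Y⁻¹ : SO3) : Mat) - 1‖ < 2 := by
    refine lt_of_le_of_lt ?_ hk
    have : ((X * Y⁻¹ : SO3) : Mat) - 1 = ((X : Mat) - Y) * (Y : Mat)ᵀ := by
      rw [sub_mul, SO3.mul_transpose]; rfl
    rw [this]
    exact Y.norm_mul_transpose_le _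
  exact mul_inv_eq_one.1 (SO3.eq_one_of_vee_eq_zero (X * Y⁻¹) h h1)

/-- Stability of the first variation under a change of the base path and of the end point. -/
theorem exists_endpoint_variation (e₁ e₂ : so3) (K T : ℝ) (hK : 0 < K) (hT : 0 < T) :
    ∃ C > 0, ∃ h₀ > 0, ∀ h > 0, h ≤ h₀ → ∀ (N : ℕ), N * h ≤ T →
      ∀ (P X X' : ℕ → SO3) (w z z' : ℕ → ℂ),
      (∀ j, P (j + 1) = P j * expSO3 (ctlSo e₁ e₂ (h • w j))) →
      (∀ j, X (j + 1) = X j * expSO3 (ctlSo e₁ e₂ (h • z j))) →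
      (∀ j, X' (j + 1) = X' j * expSO3 (ctlSo e₁ e₂ (h • z' j))) →
      X 0 = P 0 → X' 0 = P 0 → (∀ j, ‖w j‖ ≤ K) → (∀ j, ‖z j‖ ≤ K) → (∀ j, ‖z' j‖ ≤ K) →
      ∀ δ₀ δ : ℝ, (∀ j, ‖z j - w j‖ ≤ δ₀) → (∀ j, ‖z' j - z j‖ ≤ δ) →
      ∀ Y : SO3,
        ‖(X N : Mat) - P N‖ ≤ C * δ₀ ∧
        ‖vee ((X' N : Mat) * (Y : Mat)ᵀ) - vee ((X N : Mat) * (Y : Mat)ᵀ) -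
          h • ∑ j ∈ Finset.range N, push e₁ e₂ (P j) (z' j - z j)‖ ≤
          C * (h + δ + δ₀ + ‖(P N : Mat) - Y‖) * δ := by
  set Ke := ‖ctl e₁ e₂‖ + 1 with hKe
  have hKe0 : 0 < Ke := by positivity
  have hctl : ∀ z c, ‖z‖ ≤ c → ‖ctl e₁ e₂ z‖ ≤ Ke * c := fun z c hz =>
    ((ctl e₁ e₂).le_opNorm z).trans (by gcongr; linarith)
  obtain ⟨C, hC, h₀, hh₀, hFV⟩ := exists_first_variation (Ke * K) T (by positivity) hT
  refine ⟨(C * Ke + 1) + (‖vee‖ * (C * Ke)) * (1 + Ke + Ke * 2 * T + C * Ke), by positivity, h₀, hh₀, ?_⟩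
  intro h hh hhle N hN P X X' w z z' hP hX hX' hX0 hX0' hw hz hz' δ₀ δ hδ₀ hδ Y
  have hδ₀0 : 0 ≤ δ₀ := (norm_nonneg _).trans (hδ₀ 0)
  have hδ0 : 0 ≤ δ := (norm_nonneg _).trans (hδ 0)
  have cP : ∀ j, (P (j + 1) : Mat) = P j * exp (h • ctl e₁ e₂ (w j)) := fun j => by
    rw [hP, coe_mul_expSO3_ctlSo]
  have cX : ∀ j, (X (j + 1) : Mat) = X j * exp (h • ctl e₁ e₂ (z j)) := fun j => by
    rw [hX, coe_mul_expSO3_ctlSo]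
  have cX' : ∀ j, (X' (j + 1) : Mat) = X' j * exp (h • ctl e₁ e₂ (z' j)) := fun j => by
    rw [hX', coe_mul_expSO3_ctlSo]
  have base : ∀ j : ℕ, j * h ≤ T → ‖(X j : Mat) - P j‖ ≤ C * (Ke * δ₀) := fun j hj =>
    (hFV h hh hhle _ _ P X cP cX hX0.symm (fun j => hctl _ _ (hw j)) (fun j => hctl _ _ (hz j))
      (Ke * δ₀) (fun j => by rw [← map_sub]; exact hctl _ _ (hδ₀ j)) j hj).1
  have var := hFV h hh hhle _ _ X X' cX cX' (hX0.trans hX0'.symm) (fun j => hctl _ _ (hz j))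
    (fun j => hctl _ _ (hz' j)) (Ke * δ) (fun j => by rw [← map_sub]; exact hctl _ _ (hδ j)) N hN
  obtain ⟨var1, var2⟩ := var
  refine ⟨(base N hN).trans ?_, ?_⟩
  · have : 0 ≤ (1 + (‖vee‖ * (C * Ke)) * (1 + Ke + Ke * 2 * T + C * Ke)) * δ₀ := by positivity
    linarith
  set η := ‖(P N : Mat) - Y‖ with hη
  set Z : ℕ → Mat := fun j => ctl e₁ e₂ (z' j) - ctl e₁ e₂ (z j) with hZ
  have hZn : ∀ j, ‖Z j‖ ≤ Ke * δ := fun j => by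
    rw [hZ]; simp only; rw [← map_sub]; exact hctl _ _ (hδ j)
  set k := (X' N : Mat) * (X N : Mat)ᵀ with hk
  have hk1 : ‖k - 1‖ ≤ C * (Ke * δ) := by
    have : k - 1 = ((X' N : Mat) - X N) * (X N : Mat)ᵀ := by rw [sub_mul, SO3.mul_transpose]
    rw [this]
    exact (SO3.norm_mul_transpose_le _ _).trans var1
  have hY : ‖(X N : Mat) * (Y : Mat)ᵀ - 1‖ ≤ C * (Ke * δ₀) + η := by
    have : (X N : Mat) * (Y : Mat)ᵀ - 1 = (((X N : Mat) - P N) + ((P N : Mat) - Y)) * (Y : Mat)ᵀ := by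
      rw [sub_add_sub_cancel, sub_mul, SO3.mul_transpose]
    rw [this]
    exact (SO3.norm_mul_transpose_le _ _).trans ((norm_add_le _ _).trans (by gcongr; exact base N hN))
  have hsum : ‖h • ∑ j ∈ Finset.range N, (X j : Mat) * Z j * (X j : Mat)ᵀ -
      h • ∑ j ∈ Finset.range N, (P j : Mat) * Z j * (P j : Mat)ᵀ‖ ≤
        T * (2 * (C * (Ke * δ₀)) * (Ke * δ)) := by
    rw [← smul_sub, ← Finset.sum_sub_distrib, norm_smul, Real.norm_of_nonneg hh.le]
    calc _ ≤ h * ∑ j ∈ Finset.range N, 2 * (C * (Ke * δ₀)) * (Ke * δ) := by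
          gcongr
          refine norm_sum_le_of_le _ fun j hj => ?_
          refine (norm_mul_mul_transpose_sub_le _ _ _ (X j).norm_eq_one.le (P j).norm_eq_one.le).trans ?_
          have hj' : (j : ℝ) * h ≤ T := by
            have : (j : ℝ) ≤ N := by exact_mod_cast (Finset.mem_range.1 hj).le
            exact (mul_le_mul_of_nonneg_right this hh.le).trans hN
          gcongr
          exacts [base j hj', hZn j]
      _ = (N * h) * (2 * (C * (Ke * δ₀)) * (Ke * δ)) := by simp; ring
      _ ≤ _ := by gcongr
  have hpush : h • ∑ j ∈ Finset.range N, push e₁ e₂ (P j) (z' j - z j) =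
      vee (h • ∑ j ∈ Finset.range N, (P j : Mat) * Z j * (P j : Mat)ᵀ) := by
    simp only [map_smul, map_sum, push_apply, hZ, map_sub, mul_sub, sub_mul]
  rw [hpush, ← map_sub, ← map_sub]
  -- Three separate errors: the second-order term of the variation from X to X', the change of base
  -- path from X to P, and the failure of X_N to equal Y.
  have hid : (X' N : Mat) * (Y : Mat)ᵀ - (X N : Mat) * (Y : Mat)ᵀ -
      h • ∑ j ∈ Finset.range N, (P j : Mat) * Z j * (P j : Mat)ᵀ =
      (k - 1 - h • ∑ j ∈ Finset.range N, (X j : Mat) * Z j * (X j : Mat)ᵀ) +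
      (h • ∑ j ∈ Finset.range N, (X j : Mat) * Z j * (X j : Mat)ᵀ -
        h • ∑ j ∈ Finset.range N, (P j : Mat) * Z j * (P j : Mat)ᵀ) +
      (k - 1) * ((X N : Mat) * (Y : Mat)ᵀ - 1) := by
    have : (k - 1) * ((X N : Mat) * (Y : Mat)ᵀ - 1) =
        (X' N : Mat) * (Y : Mat)ᵀ - (X N : Mat) * (Y : Mat)ᵀ - (k - 1) := by
      rw [mul_sub, mul_one, sub_mul, one_mul, hk, mul_assoc (X' N : Mat), ← mul_assoc (X N : Mat)ᵀ,
        SO3.transpose_mul, one_mul]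
    rw [this]
    abel
  rw [hid]
  refine (vee.le_opNorm _).trans ?_
  calc _ ≤ ‖vee‖ * (C * (h + Ke * δ) * (Ke * δ) + T * (2 * (C * (Ke * δ₀)) * (Ke * δ)) +
        (C * (Ke * δ)) * (C * (Ke * δ₀) + η)) := by
        gcongr
        refine (norm_add_le _ _).trans (add_le_add ((norm_add_le _ _).trans (add_le_add var2 hsum)) ?_)
        refine (norm_mul_le _ _).trans ?_
        gcongr
    _ = (‖vee‖ * (C * Ke)) * (h + Ke * δ + Ke * 2 * T * δ₀ + C * Ke * δ₀ + η) * δ := by ring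
    _ ≤ (‖vee‖ * (C * Ke)) * ((1 + Ke + Ke * 2 * T + C * Ke) * (h + δ + δ₀ + η)) * δ := by
        have hη0 : 0 ≤ η := norm_nonneg _
        gcongr
        have : 0 ≤ (Ke + Ke * 2 * T + C * Ke) * h + (1 + Ke * 2 * T + C * Ke) * δ +
          (1 + Ke) * δ₀ + (Ke + Ke * 2 * T + C * Ke) * η := by positivity
        linarith
    _ ≤ _ := by
        have hη0 : 0 ≤ η := norm_nonneg _
        have : 0 ≤ (C * Ke + 1) * (h + δ + δ₀ + η) * δ := by positivity
        linarith

-- Since r lies in the kernel of the first variation, w − s r misses Y by O(s² + h) = O(s²) only.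
-- The gap is closed by controls of the form `cov (P j) x`: the resulting map from x to the endpoint
-- is uniformly close to the Gram operator, so its image of a ball of radius O(s²) covers the gap.
set_option maxHeartbeats 1000000 in
theorem exists_correction (e₁ e₂ : so3) (κ T C₀ R : ℝ) (hκ : 0 < κ) (hT : 0 < T) (hC₀ : 0 ≤ C₀)
    (hR : 0 ≤ R) :
    ∃ C > 0, ∃ s₀ > 0, ∀ s > 0, s ≤ s₀ → ∀ h > 0, h ≤ s ^ 2 → ∀ N : ℕ, N * h ≤ T →
      ∀ (P : ℕ → SO3) (w r : ℕ → ℂ),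
      (∀ j, P (j + 1) = P j * expSO3 (ctlSo e₁ e₂ (h • w j))) →
      (∀ j, ‖w j‖ ≤ 2) → (∀ j, ‖r j‖ ≤ R) →
      (∀ x, κ * ‖x‖ ^ 2 ≤ ⟪gram e₁ e₂ h N P x, x⟫_ℝ) →
      (∑ j ∈ Finset.range N, push e₁ e₂ (P j) (r j) = 0) →
      ∀ Y : SO3, ‖(P N : Mat) - Y‖ ≤ C₀ * h →
      ∃ x : V3, ‖x‖ ≤ C * s ^ 2 ∧ ∃ Q : ℕ → SO3, Q 0 = P 0 ∧ Q N = Y ∧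
        ∀ j, Q (j + 1) = Q j * expSO3 (ctlSo e₁ e₂ (h • (w j - s • r j + cov e₁ e₂ (P j) x))) := by
  set pb := pushBound e₁ e₂ with hpb
  have hpb0 : 0 ≤ pb := pushBound_nonneg _ _
  obtain ⟨C, hC, h₀, hh₀, hvar⟩ := exists_endpoint_variation e₁ e₂ (2 + R + pb) T (by positivity) hT
  set C₃ := C * (1 + R + C₀) * R + ‖vee‖ * C₀ + 1 with hC₃
  have hC₃0 : 0 < C₃ := by positivity
  set C₂ := 2 * C₃ / κ with hC₂
  have hC₂0 : 0 < C₂ := by positivity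
  set L := 1 + 3 * pb * C₂ + R + C₀ with hL
  have hL0 : 0 < L := by positivity
  set D := C * (R + pb * C₂) + C₀ with hD
  have hD0 : 0 ≤ D := by positivity
  -- Besides s ≤ 1 and h ≤ h₀, the bounds on s ensure in turn that ρ ≤ 1, that the linearization
  -- error is at most κ/2, and that the new endpoint is nearer than 2 to Y.
  refine ⟨C₂, hC₂0, min (min 1 h₀) (min (1 / (C₂ + 1)) (min (κ / (2 * (C * L * pb + 1))) (1 / (D + 1)))),
    by positivity, ?_⟩
  intro s hs hs0 h hh hhs N hN P w r hP hw hr hcoer hsum Y hY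
  simp only [le_min_iff] at hs0
  obtain ⟨⟨hs1, hsh₀⟩, hsC₂, hsκ, hsD⟩ := hs0
  rw [le_div_iff₀ (by positivity)] at hsC₂ hsκ hsD
  have hs2 : s ^ 2 ≤ s := by nlinarith
  have hhs' : h ≤ s := hhs.trans hs2
  set ρ := C₂ * s ^ 2 with hρ
  have hρ0 : 0 ≤ ρ := by positivity
  have hρs : ρ ≤ C₂ * s := by rw [hρ]; gcongr
  have hρ1 : ρ ≤ 1 := by nlinarith
  set z : V3 → ℕ → ℂ := fun x j => w j - s • r j + cov e₁ e₂ (P j) x with hz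
  set X : V3 → ℕ → SO3 := fun x => expPath (P 0) fun j => ctlSo e₁ e₂ (h • z x j) with hX
  have hXrec : ∀ x j, X x (j + 1) = X x j * expSO3 (ctlSo e₁ e₂ (h • z x j)) := fun _ _ => rfl
  have hX0 : ∀ x, X x 0 = P 0 := fun _ => rfl
  have hsr : ∀ j, ‖s • r j‖ ≤ s * R := fun j => by
    rw [norm_smul, Real.norm_of_nonneg hs.le]; gcongr; exact hr j
  have hcov : ∀ x j, ‖cov e₁ e₂ (P j) x‖ ≤ pb * ‖x‖ := fun x j => norm_cov_le _ _ _ _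
  have hznear : ∀ x, ‖x‖ ≤ ρ → ∀ j, ‖z x j - w j‖ ≤ s * R + pb * ρ := fun x hx j => by
    have : z x j - w j = -(s • r j) + cov e₁ e₂ (P j) x := by rw [hz]; ring
    rw [this]
    refine (norm_add_le _ _).trans ?_
    rw [norm_neg]
    have := hcov x j
    gcongr
    · exact hsr j
    · exact this.trans (by gcongr)
  have hzK : ∀ x, ‖x‖ ≤ ρ → ∀ j, ‖z x j‖ ≤ 2 + R + pb := fun x hx j => by
    have h1 := hznear x hx j
    have h2 : ‖z x j‖ ≤ ‖w j‖ + ‖z x j - w j‖ := by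
      have := norm_add_le (w j) (z x j - w j)
      rwa [add_sub_cancel] at this
    have h3 : s * R ≤ R := by nlinarith
    have h4 : pb * ρ ≤ pb := by nlinarith
    linarith [hw j]
  have hwK : ∀ j, ‖w j‖ ≤ 2 + R + pb := fun j => (hw j).trans (by linarith)
  set Φ : V3 → V3 := fun x => vee ((X x N : Mat) * (Y : Mat)ᵀ) with hΦ
  have happ : ApproximatesLinearOn Φ (gram e₁ e₂ h N P) (Metric.closedBall 0 ρ)
      ⟨κ / 2, by positivity⟩ := by
    intro y hy x hx
    rw [mem_closedBall_zero_iff] at hx hy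
    have hdiff : ∀ j, z y j - z x j = cov e₁ e₂ (P j) (y - x) := fun j => by
      rw [hz, map_sub]; ring
    have h1 := (hvar h hh (hhs'.trans hsh₀) N hN P (X x) (X y) w (z x) (z y) hP (hXrec x) (hXrec y)
      (hX0 x) (hX0 y) hwK (hzK x hx) (hzK y hy) (s * R + pb * ρ) (pb * ‖y - x‖) (hznear x hx)
      (fun j => by rw [hdiff]; exact hcov _ _) Y).2
    simp only [hdiff, ← gram_apply] at h1
    have h2 : ‖y - x‖ ≤ 2 * ρ := (norm_sub_le _ _).trans (by linarith)
    refine h1.trans ?_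
    change _ ≤ κ / 2 * ‖y - x‖
    calc _ ≤ C * (L * s) * (pb * ‖y - x‖) := by
          gcongr
          have : pb * ‖y - x‖ ≤ pb * (2 * (C₂ * s)) := by gcongr; linarith
          have : pb * ρ ≤ pb * (C₂ * s) := by gcongr
          have : C₀ * h ≤ C₀ * s := by gcongr
          rw [hL]
          linarith
      _ = (C * L * pb * s) * ‖y - x‖ := by ring
      _ ≤ _ := by
          gcongr
          linarith
  obtain ⟨inv, hinv⟩ := exists_nonlinearRightInverse hκ hcoer
  have hsurj := happ.surjOn_closedBall_of_nonlinearRightInverse inv hρ0 (b := 0) subset_rfl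
  rw [hinv, inv_inv] at hsurj
  have hΦ0 : ‖Φ 0‖ ≤ C₃ * s ^ 2 := by
    have hdiff : ∀ j, z 0 j - w j = -(s • r j) := fun j => by simp only [hz, map_zero]; ring
    have h1 := (hvar h hh (hhs'.trans hsh₀) N hN P P (X 0) w w (z 0) hP hP (hXrec 0)
      rfl (hX0 0) hwK hwK (hzK 0 (by simpa using hρ0)) 0 (s * R) (by simp)
      (fun j => by rw [hdiff, norm_neg]; exact hsr j) Y).2
    have h2 : ∑ j ∈ Finset.range N, push e₁ e₂ (P j) (z 0 j - w j) = 0 := by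
      simp only [hdiff, map_neg, map_smul]
      rw [Finset.sum_neg_distrib, ← Finset.smul_sum, hsum, smul_zero, neg_zero]
    rw [h2, smul_zero, sub_zero] at h1
    have h3 : ‖vee ((P N : Mat) * (Y : Mat)ᵀ)‖ ≤ ‖vee‖ * (C₀ * h) := by
      have : vee ((P N : Mat) * (Y : Mat)ᵀ) = vee (((P N : Mat) - Y) * (Y : Mat)ᵀ) := by
        rw [sub_mul, SO3.mul_transpose, map_sub, vee_one, sub_zero]
      rw [this]
      refine (vee.le_opNorm _).trans ?_
      gcongr
      exact (Y.norm_mul_transpose_le _).trans hY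
    calc ‖Φ 0‖ = ‖(Φ 0 - vee ((P N : Mat) * (Y : Mat)ᵀ)) + vee ((P N : Mat) * (Y : Mat)ᵀ)‖ := by
          rw [sub_add_cancel]
      _ ≤ C * (h + s * R + 0 + C₀ * h) * (s * R) + ‖vee‖ * (C₀ * h) := by
          refine (norm_add_le _ _).trans (add_le_add (h1.trans ?_) h3)
          gcongr
      _ ≤ C * (s + s * R + 0 + C₀ * s) * (s * R) + ‖vee‖ * (C₀ * s ^ 2) := by gcongr
      _ ≤ C₃ * s ^ 2 := by rw [hC₃]; linarith [sq_nonneg s]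
  -- The covered ball about Φ 0 has radius (κ − κ/2) ρ; `C₂` is chosen to make this C₃ s², the bound
  -- for Φ 0.
  obtain ⟨x, hx, hx0⟩ := hsurj (show (0 : V3) ∈ _ by
    rw [Metric.mem_closedBall, dist_zero_left]
    refine hΦ0.trans (le_of_eq ?_)
    change C₃ * s ^ 2 = (κ - κ / 2) * ρ
    rw [hρ, hC₂]
    field_simp
    ring)
  rw [mem_closedBall_zero_iff] at hx
  refine ⟨x, hx, X x, hX0 x, eq_of_vee_mul_transpose_eq_zero _ _ hx0 ?_, hXrec x⟩
  have h1 := (hvar h hh (hhs'.trans hsh₀) N hN P (X x) (X x) w (z x) (z x) hP (hXrec x) (hXrec x)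
    (hX0 x) (hX0 x) hwK (hzK x hx) (hzK x hx) (s * R + pb * ρ) 0 (hznear x hx) (by simp) Y).1
  calc ‖(X x N : Mat) - Y‖ = ‖((X x N : Mat) - P N) + ((P N : Mat) - Y)‖ := by rw [sub_add_sub_cancel]
    _ ≤ C * (s * R + pb * ρ) + C₀ * h := (norm_add_le _ _).trans (add_le_add h1 hY)
    _ ≤ C * (s * R + pb * (C₂ * s)) + C₀ * s := by gcongr
    _ = D * s := by rw [hD]; ring
    _ < 2 := by linarith

/-! ### Approximate multipliers from minimality. -/

namespace SubRiemannianSO3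

variable {S : SubRiemannianSO3} {e₁ e₂ : so3}

-- Let D be the energy of the residual r = w − cov M. By orthogonality the energy of w, at most T(1
-- + h)², is that of cov M plus D. The corrected competitor has energy at most that of cov M plus (1
-- − s)² D + O(s²), and minimality makes this at least T. Subtracting leaves s D = O(s²).
set_option maxHeartbeats 1000000 in
theorem IsFrame.exists_multiplier (hF : S.IsFrame e₁ e₂) (κ T C₀ : ℝ) (hκ : 0 < κ) (hT : 0 < T)
    (hC₀ : 0 ≤ C₀) :
    ∃ B > 0, ∃ C > 0, ∃ s₀ > 0, ∀ s > 0, s ≤ s₀ → ∀ h > 0, h ≤ s ^ 2 → ∀ N : ℕ, N * h = T →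
      ∀ (P : ℕ → SO3) (w : ℕ → ℂ),
      (∀ j, P (j + 1) = P j * expSO3 (ctlSo e₁ e₂ (h • w j))) →
      (∀ j, ‖w j‖ ≤ 1 + h) →
      (∀ x, κ * ‖x‖ ^ 2 ≤ ⟪gram e₁ e₂ h N P x, x⟫_ℝ) →
      ∀ Y : SO3, ‖(P N : Mat) - Y‖ ≤ C₀ * h → (∀ l, S.Reach (P 0) Y l → T ≤ l) →
      ∃ M : V3, ‖M‖ ≤ B ∧
        h * ∑ j ∈ Finset.range N, ‖w j - cov e₁ e₂ (P j) M‖ ^ 2 ≤ C * s := by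
  set pb := pushBound e₁ e₂ with hpb
  have hpb0 : 0 ≤ pb := pushBound_nonneg _ _
  set B := 4 * T / κ + 1 with hB
  have hB0 : 0 < B := by positivity
  obtain ⟨C, hC, s₀, hs₀, hcorr⟩ := exists_correction e₁ e₂ κ T C₀ (2 + pb * B) hκ hT hC₀ (by positivity)
  set C' := 3 * T + T * (pb ^ 2 * (2 * B + 1) * C) with hC'
  refine ⟨B, hB0, C', by positivity, min s₀ (min 1 (1 / (C + 1))), by positivity, ?_⟩
  intro s hs hs0 h hh hhs N hN P w hP hw hcoer Y hY hmin
  simp only [le_min_iff] at hs0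
  obtain ⟨hs0, hs1, hsC⟩ := hs0
  rw [le_div_iff₀ (by positivity)] at hsC
  have hs2 : s ^ 2 ≤ s := by nlinarith
  have hh1 : h ≤ 1 := by linarith
  have hw2 : ∀ j, ‖w j‖ ≤ 2 := fun j => (hw j).trans (by linarith)
  -- The normal equation of the least squares approximation of w by the controls `cov (P j) M`.
  obtain ⟨M, hM⟩ := surjective_of_coercive hκ hcoer
    (h • ∑ j ∈ Finset.range N, push e₁ e₂ (P j) (w j))
  set r : ℕ → ℂ := fun j => w j - cov e₁ e₂ (P j) M with hr
  have hpush : ∑ j ∈ Finset.range N, push e₁ e₂ (P j) (r j) = 0 := by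
    have : h • ∑ j ∈ Finset.range N, push e₁ e₂ (P j) (r j) = 0 := by
      simp only [hr, map_sub, Finset.sum_sub_distrib, smul_sub]
      rw [← hM, gram_apply, sub_self]
    exact (smul_eq_zero.1 this).resolve_left hh.ne'
  have horth : ∀ x, ∑ j ∈ Finset.range N, ⟪cov e₁ e₂ (P j) x, r j⟫_ℝ = 0 := fun x => by
    simp only [inner_cov]
    rw [← inner_sum, hpush, inner_zero_right]
  set D := h * ∑ j ∈ Finset.range N, ‖r j‖ ^ 2 with hD
  have hD0 : 0 ≤ D := by positivity
  have hW : h * ∑ j ∈ Finset.range N, ‖w j‖ ^ 2 =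
      h * ∑ j ∈ Finset.range N, ‖cov e₁ e₂ (P j) M‖ ^ 2 + D := by
    rw [hD, ← mul_add, ← Finset.sum_add_distrib]
    congr 1
    have h1 : ∀ j, ‖w j‖ ^ 2 = ‖cov e₁ e₂ (P j) M‖ ^ 2 + ‖r j‖ ^ 2 +
        2 * ⟪cov e₁ e₂ (P j) M, r j⟫_ℝ := fun j => by
      have : w j = cov e₁ e₂ (P j) M + r j := by rw [hr]; ring
      rw [this, norm_add_sq_real]; ring
    simp only [h1]
    rw [Finset.sum_add_distrib, ← Finset.mul_sum, horth, mul_zero, add_zero]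
  have hWle : h * ∑ j ∈ Finset.range N, ‖w j‖ ^ 2 ≤ T * (1 + h) ^ 2 := by
    calc _ ≤ h * ∑ j ∈ Finset.range N, (1 + h) ^ 2 := by gcongr with j _; exact hw j
      _ = N * h * (1 + h) ^ 2 := by simp; ring
      _ = _ := by rw [hN]
  have hMB : ‖M‖ ≤ B := by
    have h1 := hcoer M
    rw [inner_gram] at h1
    have h2 : T * (1 + h) ^ 2 ≤ T * 4 := by gcongr; nlinarith
    have h3 : ‖M‖ ^ 2 ≤ 4 * T / κ := by
      rw [le_div_iff₀ hκ]
      linarith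
    nlinarith [norm_nonneg M, sq_nonneg (‖M‖ - 1)]
  have hcov : ∀ x j, ‖cov e₁ e₂ (P j) x‖ ≤ pb * ‖x‖ := fun x j => norm_cov_le _ _ _ _
  have hrR : ∀ j, ‖r j‖ ≤ 2 + pb * B := fun j => by
    refine (norm_sub_le _ _).trans (add_le_add (hw2 j) ((hcov M j).trans ?_))
    gcongr
  obtain ⟨x, hx, Q, hQ0, hQN, hQ⟩ := hcorr s hs hs0 h hh hhs N hN.le P w r hP hw2 hrR hcoer hpush Y hY
  have hx1 : ‖x‖ ≤ 1 := by nlinarith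
  have hlen := hmin _ (by
    have := hF.reach_prod Q _ hQ N
    rwa [hQ0, hQN] at this)
  set z : ℕ → ℂ := fun j => w j - s • r j + cov e₁ e₂ (P j) x with hz
  have hNpos : (0 : ℝ) < N := by
    by_contra hcon
    nlinarith
  -- By Cauchy–Schwarz over the total time N h = T, T² ≤ length² ≤ T · energy.
  have hlen2 : T ≤ h * ∑ j ∈ Finset.range N, ‖z j‖ ^ 2 := by
    have h1 : T ≤ h * ∑ j ∈ Finset.range N, ‖z j‖ := by
      refine hlen.trans (le_of_eq ?_)
      rw [Finset.mul_sum]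
      exact Finset.sum_congr rfl fun j _ => by rw [norm_smul, Real.norm_of_nonneg hh.le]
    have h2 := sq_sum_le_card_mul_sum_sq (s := Finset.range N) (f := fun j => ‖z j‖)
    rw [Finset.card_range] at h2
    have h3 : T ^ 2 ≤ T * (h * ∑ j ∈ Finset.range N, ‖z j‖ ^ 2) := by
      calc T ^ 2 ≤ (h * ∑ j ∈ Finset.range N, ‖z j‖) ^ 2 := by gcongr
        _ = h ^ 2 * (∑ j ∈ Finset.range N, ‖z j‖) ^ 2 := by ring
        _ ≤ h ^ 2 * (N * ∑ j ∈ Finset.range N, ‖z j‖ ^ 2) := by gcongr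
        _ = _ := by rw [← hN]; ring
    nlinarith
  have hzsum : h * ∑ j ∈ Finset.range N, ‖z j‖ ^ 2 ≤
      h * ∑ j ∈ Finset.range N, ‖cov e₁ e₂ (P j) M‖ ^ 2 + (1 - s) ^ 2 * D +
        T * (pb ^ 2 * (2 * B + 1) * ‖x‖) := by
    have h1 : ∀ j, ‖z j‖ ^ 2 ≤ (‖cov e₁ e₂ (P j) M‖ ^ 2 + (1 - s) ^ 2 * ‖r j‖ ^ 2) +
        (2 * (1 - s) * ⟪cov e₁ e₂ (P j) (M + x), r j⟫_ℝ + pb ^ 2 * (2 * B + 1) * ‖x‖) := fun j => by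
      have e1 : z j = cov e₁ e₂ (P j) (M + x) + (1 - s) • r j := by
        simp only [hz, hr, map_add, sub_smul, one_smul]; ring
      have e2 : ‖cov e₁ e₂ (P j) (M + x)‖ ^ 2 ≤
          ‖cov e₁ e₂ (P j) M‖ ^ 2 + pb ^ 2 * (2 * B + 1) * ‖x‖ := by
        rw [map_add]
        calc _ ≤ (‖cov e₁ e₂ (P j) M‖ + ‖cov e₁ e₂ (P j) x‖) ^ 2 := by
              gcongr; exact norm_add_le _ _
          _ = ‖cov e₁ e₂ (P j) M‖ ^ 2 + (2 * ‖cov e₁ e₂ (P j) M‖ + ‖cov e₁ e₂ (P j) x‖) *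
              ‖cov e₁ e₂ (P j) x‖ := by ring
          _ ≤ ‖cov e₁ e₂ (P j) M‖ ^ 2 + (2 * (pb * B) + pb * 1) * (pb * ‖x‖) := by
              have a1 : ‖cov e₁ e₂ (P j) M‖ ≤ pb * B := (hcov M j).trans (by gcongr)
              have a2 : ‖cov e₁ e₂ (P j) x‖ ≤ pb * 1 := (hcov x j).trans (by gcongr)
              have a3 := hcov x j
              gcongr
          _ = _ := by ring
      rw [e1, norm_add_sq_real, inner_smul_right, norm_smul, mul_pow, Real.norm_eq_abs, sq_abs]
      linarith
    calc _ ≤ h * ∑ j ∈ Finset.range N, ((‖cov e₁ e₂ (P j) M‖ ^ 2 + (1 - s) ^ 2 * ‖r j‖ ^ 2) +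
        (2 * (1 - s) * ⟪cov e₁ e₂ (P j) (M + x), r j⟫_ℝ + pb ^ 2 * (2 * B + 1) * ‖x‖)) := by
          gcongr with j _
          exact h1 j
      _ = h * ∑ j ∈ Finset.range N, ‖cov e₁ e₂ (P j) M‖ ^ 2 + (1 - s) ^ 2 * D +
        (N * h) * (pb ^ 2 * (2 * B + 1) * ‖x‖) := by
          rw [Finset.sum_add_distrib, Finset.sum_add_distrib, Finset.sum_add_distrib,
            ← Finset.mul_sum, ← Finset.mul_sum, horth, Finset.sum_const, Finset.card_range, hD,
            nsmul_eq_mul]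
          ring
      _ = _ := by rw [hN]
  have hxs : T * (pb ^ 2 * (2 * B + 1) * ‖x‖) ≤ T * (pb ^ 2 * (2 * B + 1) * (C * s ^ 2)) := by gcongr
  have hfin : s * D ≤ C' * s ^ 2 := by
    have h1 : T * (1 + h) ^ 2 ≤ T + T * (3 * s ^ 2) := by
      have h2 : h * h ≤ 1 * h := by gcongr
      have : (1 + h) ^ 2 ≤ 1 + 3 * s ^ 2 := by
        have : (1 + h) ^ 2 = 1 + 2 * h + h * h := by ring
        linarith
      calc _ ≤ T * (1 + 3 * s ^ 2) := by gcongr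
        _ = _ := by ring
    have h2 : s * D ≤ (1 - (1 - s) ^ 2) * D := by
      have : (1 - s) ^ 2 = 1 - 2 * s + s ^ 2 := by ring
      gcongr
      linarith
    rw [hC']
    linarith
  have : s * D ≤ s * (C' * s) := by linarith
  exact ⟨M, hMB, le_of_mul_le_mul_left this hs⟩

end SubRiemannianSO3

/-! ### The invariant scalar product and normalized bases. -/

theorem vee_inj_of_skew {A B : Mat} (hA : Aᵀ = -A) (hB : Bᵀ = -B) (h : vee A = vee B) : A = B := by
  have h1 : vee (A - B) = 0 := by rw [map_sub, h, sub_self]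
  have h2 := transpose_eq_of_vee_eq_zero h1
  rw [Matrix.transpose_sub, hA, hB] at h2
  have h3 : (2 : ℝ) • (A - B) = 0 := by
    have h4 : (A - B) + (A - B) = 0 := by
      nth_rewrite 1 [← h2]
      abel
    rw [two_smul, h4]
  exact sub_eq_zero.1 ((smul_eq_zero.1 h3).resolve_left two_ne_zero)

theorem skew_ext_entries {A : Mat} (hA : Aᵀ = -A) (i j : Fin 3) : A j i = -A i j := by
  simpa using congrFun (congrFun hA i) j

theorem inner_vee_vee {A B : Mat} (hA : Aᵀ = -A) (hB : Bᵀ = -B) :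
    ⟪vee A, vee B⟫_ℝ = -(1 / 2) * (A * B).trace := by
  have a := skew_ext_entries hA
  have b := skew_ext_entries hB
  have a00 := a 0 0; have a11 := a 1 1; have a22 := a 2 2
  have b00 := b 0 0; have b11 := b 1 1; have b22 := b 2 2
  have z : ∀ x : ℝ, x = -x → x = 0 := fun x hx => by linarith
  simp only [vee_apply, PiLp.inner_apply, Fin.sum_univ_three, Matrix.trace, Matrix.diag, Matrix.mul_apply]
  simp [a 0 1, a 0 2, a 1 2, b 0 1, b 0 2, b 1 2, z _ a00, z _ a11, z _ a22, z _ b00, z _ b11, z _ b22]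
  ring

/-- The skew matrix with a given axial vector. -/
def hat (x : V3) : Mat := !![0, -x 2, x 1; x 2, 0, -x 0; -x 1, x 0, 0]

theorem hat_transpose (x : V3) : (hat x)ᵀ = -hat x := by
  ext i j; fin_cases i <;> fin_cases j <;> simp [hat]

theorem vee_hat (x : V3) : vee (hat x) = x := by
  ext i; fin_cases i <;> simp [vee_apply, hat]

theorem conj_transpose_skew {A : Mat} (hA : Aᵀ = -A) (X : Mat) : (X * A * Xᵀ)ᵀ = -(X * A * Xᵀ) := by
  simp [Matrix.transpose_mul, hA, mul_assoc]

/-- On skew matrices the scalar product is −½ tr(AB), and cyclicity of the trace makes conjugation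
by g adjoint to conjugation by its inverse. -/
theorem inner_vee_conj (g : SO3) {A B : Mat} (hA : Aᵀ = -A) (hB : Bᵀ = -B) :
    ⟪vee A, vee ((g : Mat) * B * (g : Mat)ᵀ)⟫_ℝ = ⟪vee ((g : Mat)ᵀ * A * g), vee B⟫_ℝ := by
  have h1 := conj_transpose_skew hB (g : Mat)
  have h2 := conj_transpose_skew hA (g : Mat)ᵀ
  rw [Matrix.transpose_transpose] at h2
  rw [inner_vee_vee hA h1, inner_vee_vee h2 hB]
  congr 1
  rw [← mul_assoc, Matrix.trace_mul_comm]
  congr 1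
  simp only [mul_assoc]

namespace SubRiemannianSO3

variable {S : SubRiemannianSO3} {a b : ℝ} {e : Module.Basis (Fin 3) ℝ so3}

theorem IsNormalizedBasis.pos' (hb : S.IsNormalizedBasis a b e) : 0 < b := hb.pos.trans_le hb.le

theorem IsNormalizedBasis.isFrame (hb : S.IsNormalizedBasis a b e) : S.IsFrame (e 0) (e 1) := by
  have key : ∀ z : ℂ, ∃ v : S.p, (v : so3) = ctlSo (e 0) (e 1) z ∧ S.norm v = ‖z‖ := by
    intro z
    refine ⟨z.re • ⟨e 0, hb.mem₁⟩ + z.im • ⟨e 1, hb.mem₂⟩, rfl, ?_⟩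
    have h21 := S.ip_symm ⟨e 1, hb.mem₂⟩ ⟨e 0, hb.mem₁⟩
    rw [hb.ip₁₂] at h21
    rw [norm, Complex.norm_eq_sqrt_sq_add_sq]
    congr 1
    simp only [map_add, map_smul, LinearMap.add_apply, LinearMap.smul_apply, smul_eq_mul,
      hb.ip₁₁, hb.ip₂₂, hb.ip₁₂, h21]
    ring
  refine ⟨fun v => ?_, key, ?_⟩
  · have hv : (v : so3) ∈ Submodule.span ℝ {e 0, e 1} := hb.span_eq.symm ▸ v.2
    rw [Submodule.mem_span_pair] at hv
    obtain ⟨x, y, hxy⟩ := hv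
    obtain ⟨v', hv', hn⟩ := key ⟨x, y⟩
    have : v' = v := Subtype.ext (hv'.trans hxy)
    exact ⟨⟨x, y⟩, hxy.symm, this ▸ hn⟩
  · rw [injective_iff_map_eq_zero]
    intro z hz
    have h1 : ctlSo (e 0) (e 1) z = 0 := Subtype.ext hz
    have h2 := congrArg e.repr h1
    have h3 : z.re = 0 := by
      have := DFunLike.congr_fun h2 0
      simpa [ctlSo] using this
    have h4 : z.im = 0 := by
      have := DFunLike.congr_fun h2 1
      simpa [ctlSo] using this
    exact Complex.ext h3 h4

theorem IsNormalizedBasis.coe_bracket₁₂ (hb : S.IsNormalizedBasis a b e) :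
    (e 0 : Mat) * e 1 - e 1 * e 0 = (a * b) • (e 2 : Mat) :=
  congrArg (fun y : so3 => (y : Mat)) hb.bracket₁₂

theorem IsNormalizedBasis.coe_bracket₃₁ (hb : S.IsNormalizedBasis a b e) :
    (e 2 : Mat) * e 0 - e 0 * e 2 = (b / a) • (e 1 : Mat) :=
  congrArg (fun y : so3 => (y : Mat)) hb.bracket₃₁

theorem IsNormalizedBasis.coe_bracket₂₃ (hb : S.IsNormalizedBasis a b e) :
    (e 1 : Mat) * e 2 - e 2 * e 1 = (a / b) • (e 0 : Mat) :=
  congrArg (fun y : so3 => (y : Mat)) hb.bracket₂₃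

/-- By cyclicity, tr([A, B] A) = tr([A, B] B) = 0. Hence a normalized basis is orthogonal for the
trace form. -/
theorem inner_vee_eq_zero_of_bracket {A B C : so3} {c : ℝ} (hc : c ≠ 0)
    (h : (A : Mat) * B - B * A = c • (C : Mat)) : ⟪vee (C : Mat), vee (A : Mat)⟫_ℝ = 0 ∧
      ⟪vee (C : Mat), vee (B : Mat)⟫_ℝ = 0 := by
  have h1 : (C : Mat) = c⁻¹ • ((A : Mat) * B - B * A) := by rw [h, smul_smul, inv_mul_cancel₀ hc, one_smul]
  constructor
  · rw [inner_vee_vee (so3_transpose _) (so3_transpose _), h1, smul_mul_assoc, sub_mul, Matrix.trace_smul,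
      Matrix.trace_sub, Matrix.trace_mul_comm ((A : Mat) * (B : Mat)) (A : Mat), ← mul_assoc (A : Mat),
      mul_assoc (B : Mat),
      Matrix.trace_mul_comm (B : Mat), sub_self]
    simp
  · rw [inner_vee_vee (so3_transpose _) (so3_transpose _), h1, smul_mul_assoc, sub_mul, Matrix.trace_smul,
      Matrix.trace_sub, Matrix.trace_mul_comm ((B : Mat) * (A : Mat)) (B : Mat), ← mul_assoc (B : Mat),
      mul_assoc (A : Mat),
      Matrix.trace_mul_comm (A : Mat), sub_self]
    simp

theorem IsNormalizedBasis.inner₂₀ (hb : S.IsNormalizedBasis a b e) :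
    ⟪vee (e 2 : Mat), vee (e 0 : Mat)⟫_ℝ = 0 :=
  (inner_vee_eq_zero_of_bracket (mul_pos hb.pos hb.pos').ne' hb.coe_bracket₁₂).1

theorem IsNormalizedBasis.inner₂₁ (hb : S.IsNormalizedBasis a b e) :
    ⟪vee (e 2 : Mat), vee (e 1 : Mat)⟫_ℝ = 0 :=
  (inner_vee_eq_zero_of_bracket (mul_pos hb.pos hb.pos').ne' hb.coe_bracket₁₂).2

theorem IsNormalizedBasis.inner₀₁ (hb : S.IsNormalizedBasis a b e) :
    ⟪vee (e 0 : Mat), vee (e 1 : Mat)⟫_ℝ = 0 :=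
  (inner_vee_eq_zero_of_bracket (div_pos hb.pos hb.pos').ne' hb.coe_bracket₂₃).1

theorem vee_basis_ne_zero (e : Module.Basis (Fin 3) ℝ so3) (i : Fin 3) : vee (e i : Mat) ≠ 0 := by
  intro h
  have h1 : (e i : Mat) = 0 := vee_inj_of_skew (so3_transpose _) (by simp) (by rw [h, map_zero])
  exact e.ne_zero i (Subtype.ext h1)

theorem ctl_one (e₁ e₂ : so3) : ctl e₁ e₂ 1 = (e₁ : Mat) := by simp [ctl_apply]

theorem ctl_I (e₁ e₂ : so3) : ctl e₁ e₂ Complex.I = (e₂ : Mat) := by simp [ctl_apply]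

/-- A skew matrix orthogonal to `e₁, e₂` is a multiple of `e₃`. -/
theorem IsNormalizedBasis.exists_smul_of_orthogonal (hb : S.IsNormalizedBasis a b e) {A : Mat}
    (hA : Aᵀ = -A) (h0 : ⟪vee A, vee (e 0 : Mat)⟫_ℝ = 0) (h1 : ⟪vee A, vee (e 1 : Mat)⟫_ℝ = 0) :
    ∃ c : ℝ, A = c • (e 2 : Mat) := by
  set y : so3 := ⟨A, (LieAlgebra.Orthogonal.mem_so _ _ _).2 hA⟩ with hy
  have hrep := e.sum_repr y
  rw [Fin.sum_univ_three] at hrep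
  have hrep' : e.repr y 0 • (e 0 : Mat) + e.repr y 1 • (e 1 : Mat) + e.repr y 2 • (e 2 : Mat) = A :=
    congrArg (fun y : so3 => (y : Mat)) hrep
  have n0 := real_inner_self_eq_norm_sq (vee (e 0 : Mat))
  have n1 := real_inner_self_eq_norm_sq (vee (e 1 : Mat))
  have p0 : ‖vee (e 0 : Mat)‖ ^ 2 ≠ 0 := pow_ne_zero _ (norm_ne_zero_iff.2 (vee_basis_ne_zero e 0))
  have p1 : ‖vee (e 1 : Mat)‖ ^ 2 ≠ 0 := pow_ne_zero _ (norm_ne_zero_iff.2 (vee_basis_ne_zero e 1))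
  have i10 := hb.inner₀₁
  rw [real_inner_comm] at i10
  rw [← hrep'] at h0 h1
  simp only [map_add, map_smul, inner_add_left, real_inner_smul_left, hb.inner₂₀, hb.inner₂₁, hb.inner₀₁,
    i10, n0, n1, mul_zero, add_zero, zero_add] at h0 h1
  refine ⟨e.repr y 2, ?_⟩
  rw [← hrep', (mul_eq_zero.1 h0).resolve_right p0, (mul_eq_zero.1 h1).resolve_right p1]
  simp

/-- Converts a distance into a displacement by a single control, with errors quadratic in τ. -/
theorem IsFrame.exists_displacement_of_dist {e₁ e₂ : so3} (hF : S.IsFrame e₁ e₂) :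
    ∃ C ≥ 0, ∃ τ₀ > 0, τ₀ ≤ 1 ∧ ∀ τ > 0, τ ≤ τ₀ → ∀ x y : SO3, S.dist x y = ENNReal.ofReal τ →
      ∃ w : ℂ, ‖w‖ ≤ τ + τ ^ 2 ∧ ‖(x : Mat)ᵀ * y - 1 - ctl e₁ e₂ w‖ ≤ C * τ ^ 2 ∧
        ‖(x : Mat)ᵀ * y - exp (ctl e₁ e₂ w)‖ ≤ C * τ ^ 2 := by
  obtain ⟨C₁, hC₁, r, hr, hexp⟩ := exists_norm_exp_sub_exp_le
  set K := ‖ctl e₁ e₂‖ with hK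
  have hK0 : 0 ≤ K := norm_nonneg (ctl e₁ e₂)
  refine ⟨(K * 2) ^ 2 + C₁ * (K * 2) ^ 2, by positivity, min 1 (r / (2 * K + 1)), by positivity,
    min_le_left _ _, ?_⟩
  intro τ hτ hτ0 x y hd
  rw [le_min_iff, le_div_iff₀ (by positivity)] at hτ0
  have hτ2 : τ ^ 2 ≤ τ := by nlinarith
  -- No minimizer is needed: a slack of τ² in the length is of the same order as the other errors.
  obtain ⟨l, hl, hreach⟩ := exists_reach_of_dist_lt (S := S) (x := x) (y := y) (L := τ + τ ^ 2) (by
    rw [hd]; exact (ENNReal.ofReal_lt_ofReal_iff_of_nonneg hτ.le).2 (by nlinarith))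
  obtain ⟨w, hw, hdisp⟩ := hF.exists_displacement hreach
  have hl2 : l ≤ 2 * τ := by linarith
  have h1 : ‖(x : Mat)ᵀ * y - 1 - ctl e₁ e₂ w‖ ≤ (K * 2) ^ 2 * τ ^ 2 := by
    refine hdisp.trans ?_
    have := hreach.nonneg
    calc _ ≤ (K * (2 * τ)) ^ 2 := by gcongr
      _ = _ := by ring
  have hcw : ‖ctl e₁ e₂ w‖ ≤ K * 2 * τ := by
    refine ((ctl e₁ e₂).le_opNorm w).trans ?_
    rw [mul_assoc]
    gcongr
    linarith
  have h2 : ‖exp (ctl e₁ e₂ w) - 1 - ctl e₁ e₂ w‖ ≤ C₁ * (K * 2) ^ 2 * τ ^ 2 := by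
    have := hexp (K * 2 * τ) (by nlinarith) 0 (ctl e₁ e₂ w) (by rw [norm_zero]; positivity) hcw
    rw [exp_zero, sub_zero] at this
    calc _ ≤ _ := this
      _ ≤ C₁ * (K * 2 * τ) * (K * 2 * τ) := by gcongr
      _ = _ := by ring
  refine ⟨w, hw.trans hl.le, h1.trans ?_, ?_⟩
  · have : 0 ≤ C₁ * (K * 2) ^ 2 * τ ^ 2 := by positivity
    linarith
  · calc _ = ‖((x : Mat)ᵀ * y - 1 - ctl e₁ e₂ w) - (exp (ctl e₁ e₂ w) - 1 - ctl e₁ e₂ w)‖ := by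
          congr 1; abel
      _ ≤ _ := (norm_sub_le _ _).trans (add_le_add h1 h2)
      _ = _ := by ring

end SubRiemannianSO3

/-! ### Curves that are horizontal up to quadratic errors. -/

theorem hasDerivAt_of_quadratic {E : Type*} [NormedAddCommGroup E] [NormedSpace ℝ E] {f : ℝ → E} {f' : E}
    {x C δ : ℝ} (hδ : 0 < δ)
    (h : ∀ y, |y - x| < δ → ‖f y - f x - (y - x) • f'‖ ≤ C * |y - x| ^ 2) : HasDerivAt f f' x := by
  rw [hasDerivAt_iff_isLittleO]
  have h1 : (fun y => f y - f x - (y - x) • f') =O[nhds x] fun y => (y - x) ^ 2 := by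
    refine Asymptotics.IsBigO.of_bound C ?_
    filter_upwards [Metric.ball_mem_nhds x hδ] with y hy
    have := h y (by rwa [Metric.mem_ball, Real.dist_eq] at hy)
    rwa [Real.norm_eq_abs, abs_pow]
  refine h1.trans_isLittleO ?_
  have h2 : (fun y : ℝ => y - x) =o[nhds x] fun _ => (1 : ℝ) := by
    rw [Asymptotics.isLittleO_one_iff]
    have : Continuous fun y : ℝ => y - x := by fun_prop
    simpa using this.tendsto x
  simpa [sq] using (Asymptotics.isBigO_refl (fun y : ℝ => y - x) (nhds x)).mul_isLittleO h2

theorem eq_of_quadratic {E : Type*} [NormedAddCommGroup E] [NormedSpace ℝ E] {f : ℝ → E} {α β C : ℝ}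
    (hαβ : α ≤ β) (h : ∀ s t, α ≤ s → s < t → t ≤ β → ‖f t - f s‖ ≤ C * (t - s) ^ 2) : f β = f α := by
  have hder : ∀ x ∈ Set.Icc α β, HasDerivWithinAt f 0 (Set.Icc α β) x := by
    intro x hx
    rw [hasDerivWithinAt_iff_isLittleO]
    have h1 : (fun y => f y - f x - (y - x) • (0 : E)) =O[nhdsWithin x (Set.Icc α β)]
        fun y => (y - x) ^ 2 := by
      refine Asymptotics.IsBigO.of_bound C ?_
      filter_upwards [self_mem_nhdsWithin] with y hy
      rw [smul_zero, sub_zero, norm_pow, Real.norm_eq_abs, sq_abs]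
      rcases lt_trichotomy x y with hxy | rfl | hxy
      · exact h x y hx.1 hxy hy.2
      · simp
      · rw [norm_sub_rev, show (y - x) ^ 2 = (x - y) ^ 2 by ring]
        exact h y x hy.1 hxy hx.2
    refine h1.trans_isLittleO ?_
    have h2 : (fun y : ℝ => y - x) =o[nhdsWithin x (Set.Icc α β)] fun _ => (1 : ℝ) := by
      rw [Asymptotics.isLittleO_one_iff]
      have : Continuous fun y : ℝ => y - x := by fun_prop
      simpa using (this.tendsto x).mono_left nhdsWithin_le_nhds
    simpa [sq] using (Asymptotics.isBigO_refl (fun y : ℝ => y - x) _).mul_isLittleO h2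
  refine constant_of_has_deriv_right_zero (fun x hx => (hder x hx).continuousWithinAt) ?_ β ⟨hαβ, le_rfl⟩
  intro x hx
  exact ((hder x ⟨hx.1, hx.2.le⟩).mono_of_mem_nhdsWithin (Icc_mem_nhdsGE_of_mem hx))

/-- Short arcs of `g` in `[α, α + T]` are horizontal up to quadratic errors, with speed at most one. -/
structure HasDisplacement (e₁ e₂ : so3) (g : ℝ → SO3) (α T C : ℝ) : Prop where
  nonneg : 0 ≤ C
  pos : 0 < T
  le_one : T ≤ 1
  exists_disp : ∀ s t, α ≤ s → s < t → t ≤ α + T → ∃ w : ℂ, ‖w‖ ≤ (t - s) + (t - s) ^ 2 ∧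
    ‖(g s : Mat)ᵀ * g t - 1 - ctl e₁ e₂ w‖ ≤ C * (t - s) ^ 2 ∧
    ‖(g s : Mat)ᵀ * g t - exp (ctl e₁ e₂ w)‖ ≤ C * (t - s) ^ 2

theorem SO3.norm_transpose_mul_sub_one (x y : SO3) :
    ‖(y : Mat) - x‖ = ‖(x : Mat)ᵀ * y - 1‖ := by
  apply le_antisymm
  · have : (y : Mat) - x = x * ((x : Mat)ᵀ * y - 1) := by
      rw [mul_sub, ← mul_assoc, SO3.mul_transpose, one_mul, mul_one]
    rw [this]
    exact SO3.norm_mul_le _ _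
  · have : (x : Mat)ᵀ * y - 1 = (x : Mat)ᵀ * (y - x) := by
      rw [mul_sub, SO3.transpose_mul]
    rw [this]
    exact SO3.norm_transpose_mul_le _ _

namespace HasDisplacement

variable {e₁ e₂ : so3} {g : ℝ → SO3} {α T C : ℝ}

/-- A Lipschitz constant. -/
theorem lipschitz_aux (H : HasDisplacement e₁ e₂ g α T C) {s t : ℝ} (hs : α ≤ s) (hst : s < t)
    (ht : t ≤ α + T) : ‖(g t : Mat) - g s‖ ≤ (2 * ‖ctl e₁ e₂‖ + C) * (t - s) := by
  obtain ⟨w, hw, h1, -⟩ := H.exists_disp s t hs hst ht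
  have hτ : 0 < t - s := by linarith
  have hτ1 : t - s ≤ 1 := by linarith [H.le_one]
  have hτ2 : (t - s) ^ 2 ≤ t - s := by nlinarith
  have hC := H.nonneg
  rw [SO3.norm_transpose_mul_sub_one]
  calc _ = ‖((g s : Mat)ᵀ * g t - 1 - ctl e₁ e₂ w) + ctl e₁ e₂ w‖ := by rw [sub_add_cancel]
    _ ≤ C * (t - s) ^ 2 + ‖ctl e₁ e₂‖ * ‖w‖ :=
      (norm_add_le _ _).trans (add_le_add h1 ((ctl e₁ e₂).le_opNorm w))
    _ ≤ C * (t - s) + ‖ctl e₁ e₂‖ * (2 * (t - s)) := by gcongr; linarith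
    _ = _ := by ring

theorem lipschitz (H : HasDisplacement e₁ e₂ g α T C) {s t : ℝ} (hs : s ∈ Set.Icc α (α + T))
    (ht : t ∈ Set.Icc α (α + T)) : ‖(g t : Mat) - g s‖ ≤ (2 * ‖ctl e₁ e₂‖ + C) * |t - s| := by
  rcases lt_trichotomy s t with h | rfl | h
  · rw [abs_of_pos (by linarith)]
    exact H.lipschitz_aux hs.1 h ht.2
  · simp
  · rw [abs_of_neg (by linarith), neg_sub, norm_sub_rev]
    exact H.lipschitz_aux ht.1 h hs.2

end HasDisplacement

/-! ### Absence of abnormal extremals. -/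

namespace SubRiemannianSO3

variable {S : SubRiemannianSO3} {a b : ℝ} {e : Module.Basis (Fin 3) ℝ so3}

theorem bracket_ctl (hb : S.IsNormalizedBasis a b e) (w : ℂ) :
    ctl (e 0) (e 1) w * (e 2 : Mat) - (e 2 : Mat) * ctl (e 0) (e 1) w =
      (w.im * (a / b)) • (e 0 : Mat) - (w.re * (b / a)) • (e 1 : Mat) := by
  rw [mul_smul, mul_smul, ← hb.coe_bracket₂₃, ← hb.coe_bracket₃₁, ctl_apply]
  simp only [add_mul, mul_add, smul_sub, smul_mul_assoc, mul_smul_comm]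
  abel

-- If x annihilates the distribution along the arc, then gᵀ X g = c(t) e₃, where X is the skew
-- matrix of x and |c| is bounded below. Comparing two times, c times the bracket of the
-- displacement w with e₃ lies in the span of e₁ and e₂ and can only be balanced by a multiple of e₃
-- and by O(τ²). Orthogonality of the basis gives w = O(τ²), so g has zero derivative and the arc
-- would be constant.
set_option maxHeartbeats 1000000 in
theorem IsNormalizedBasis.eq_of_cov_eq_zero (hb : S.IsNormalizedBasis a b e) {g : ℝ → SO3} {α T C : ℝ}
    (H : HasDisplacement (e 0) (e 1) g α T C) (hne : g (α + T) ≠ g α) {x : V3}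
    (hx : ∀ t ∈ Set.Icc α (α + T), cov (e 0) (e 1) (g t) x = 0) : x = 0 := by
  by_contra hx0
  set X := hat x with hX
  have hXs : Xᵀ = -X := hat_transpose x
  have hvX : vee X = x := vee_hat x
  have hXpos : 0 < ‖X‖ := by
    rw [norm_pos_iff]
    intro h
    rw [h, map_zero] at hvX
    exact hx0 hvX.symm
  have hskew : ∀ k : SO3, ((k : Mat)ᵀ * X * (k : Mat))ᵀ = -((k : Mat)ᵀ * X * (k : Mat)) := fun k => by
    have := conj_transpose_skew hXs (k : Mat)ᵀ
    rwa [Matrix.transpose_transpose] at this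
  have hex : ∀ t, ∃ c : ℝ, t ∈ Set.Icc α (α + T) → (g t : Mat)ᵀ * X * g t = c • (e 2 : Mat) := by
    intro t
    by_cases ht : t ∈ Set.Icc α (α + T)
    · have h0 : ∀ z, ⟪x, push (e 0) (e 1) (g t) z⟫_ℝ = 0 := fun z => by
        rw [← inner_cov, hx t ht, inner_zero_left]
      obtain ⟨c, hc⟩ := hb.exists_smul_of_orthogonal (hskew (g t))
        (by
          have := h0 1
          rwa [push_apply, ctl_one, ← hvX, inner_vee_conj _ hXs (so3_transpose _)] at this)
        (by
          have := h0 Complex.I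
          rwa [push_apply, ctl_I, ← hvX, inner_vee_conj _ hXs (so3_transpose _)] at this)
      exact ⟨c, fun _ => hc⟩
    · exact ⟨0, fun h => absurd h ht⟩
  choose c hc using hex
  have he2 : 0 < ‖(e 2 : Mat)‖ := by
    rw [norm_pos_iff]
    exact fun h => e.ne_zero 2 (Subtype.ext h)
  have hcle : ∀ t ∈ Set.Icc α (α + T), |c t| * ‖(e 2 : Mat)‖ ≤ ‖X‖ := fun t ht => by
    rw [← Real.norm_eq_abs, ← norm_smul, ← hc t ht, mul_assoc]
    exact (SO3.norm_transpose_mul_le _ _).trans (SO3.norm_mul_coe_le _ _)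
  have hcge : ∀ t ∈ Set.Icc α (α + T), ‖X‖ / ‖(e 2 : Mat)‖ ≤ |c t| := fun t ht => by
    rw [div_le_iff₀ he2, ← Real.norm_eq_abs, ← norm_smul, ← hc t ht]
    have : X = (g t : Mat) * ((g t : Mat)ᵀ * X * g t) * (g t : Mat)ᵀ := by
      calc X = ((g t : Mat) * (g t : Mat)ᵀ) * X * ((g t : Mat) * (g t : Mat)ᵀ) := by
            rw [SO3.mul_transpose, one_mul, mul_one]
        _ = _ := by noncomm_ring
    nth_rewrite 1 [this]
    exact SO3.norm_conj_le _ _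
  set L := 2 * ‖ctl (e 0) (e 1)‖ + C with hL
  have hC := H.nonneg
  have hL0 : 0 ≤ L := by positivity
  set Kc := ‖ctl (e 0) (e 1)‖ with hKc
  have hKc0 : 0 ≤ Kc := norm_nonneg (ctl (e 0) (e 1))
  set Cr := 2 * ‖X‖ * L * (Kc * 2) + 2 * ‖X‖ * C with hCr
  have hCr0 : 0 ≤ Cr := by positivity
  set m := ‖X‖ / ‖(e 2 : Mat)‖ with hm
  have hm0 : 0 < m := by positivity
  set n0 := ‖vee (e 0 : Mat)‖ with hn0
  set n1 := ‖vee (e 1 : Mat)‖ with hn1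
  have hn0p : 0 < n0 := norm_pos_iff.2 (vee_basis_ne_zero e 0)
  have hn1p : 0 < n1 := norm_pos_iff.2 (vee_basis_ne_zero e 1)
  have ha := hb.pos
  have hbp := hb.pos'
  set D := ‖vee‖ * Cr * n0 / (m * (a / b) * n0 ^ 2) + ‖vee‖ * Cr * n1 / (m * (b / a) * n1 ^ 2) with hD
  refine hne (Subtype.ext (eq_of_quadratic (f := fun t => (g t : Mat)) (C := Kc * D + C)
    (by linarith [H.pos]) ?_))
  intro s t hs hst ht
  obtain ⟨w, hw, hdisp, -⟩ := H.exists_disp s t hs hst ht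
  have hsI : s ∈ Set.Icc α (α + T) := ⟨hs, by linarith⟩
  have htI : t ∈ Set.Icc α (α + T) := ⟨by linarith, ht⟩
  have hlip := H.lipschitz_aux hs hst ht
  set τ := t - s with hτ
  have hτ0 : 0 < τ := by rw [hτ]; linarith
  have hτ1 : τ ≤ 1 := by rw [hτ]; linarith [H.le_one]
  have hτ2 : τ ^ 2 ≤ τ := by nlinarith
  set k := (g s : Mat)ᵀ * g t with hk
  set ε := k - 1 - ctl (e 0) (e 1) w with hε
  have hkeq : k = 1 + ctl (e 0) (e 1) w + ε := by rw [hε]; abel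
  -- Both g(s) and g(t) pull the same X back to multiples of e₃, so k = g(s)ᵀ g(t) intertwines these
  -- multiples.
  have hcomm : k * (c t • (e 2 : Mat)) = (c s • (e 2 : Mat)) * k := by
    rw [← hc t htI, ← hc s hsI, hk]
    calc _ = (g s : Mat)ᵀ * ((g t : Mat) * (g t : Mat)ᵀ) * X * g t := by noncomm_ring
      _ = (g s : Mat)ᵀ * X * ((g s : Mat) * (g s : Mat)ᵀ) * g t := by
          rw [SO3.mul_transpose, SO3.mul_transpose, mul_one, mul_one]
      _ = _ := by noncomm_ring
  set R := -((c t - c s) • (ctl (e 0) (e 1) w * (e 2 : Mat))) - c t • (ε * (e 2 : Mat)) +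
    c s • ((e 2 : Mat) * ε) with hR
  -- The expansion of the intertwining relation to first order in w. Pairing with e₁ or e₂ removes
  -- the term with c(t) − c(s) and isolates one coordinate of w.
  have hmain : (c t - c s) • (e 2 : Mat) + c s • ((w.im * (a / b)) • (e 0 : Mat) -
      (w.re * (b / a)) • (e 1 : Mat)) = R := by
    rw [← bracket_ctl hb, hR]
    rw [hkeq] at hcomm
    simp only [add_mul, mul_add, one_mul, mul_one, smul_mul_assoc, mul_smul_comm, smul_add] at hcomm
    have h2 : c t • (e 2 : Mat) = c s • (e 2 : Mat) + c s • ((e 2 : Mat) * ctl (e 0) (e 1) w) +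
      c s • ((e 2 : Mat) * ε) - c t • (ctl (e 0) (e 1) w * (e 2 : Mat)) - c t • (ε * (e 2 : Mat)) := by
      rw [← hcomm]; abel
    simp only [sub_smul, smul_sub]
    rw [h2]
    abel
  have hcw : ‖ctl (e 0) (e 1) w‖ ≤ Kc * (2 * τ) :=
    ((ctl (e 0) (e 1)).le_opNorm w).trans (by gcongr; linarith)
  have hcdiff : |c t - c s| * ‖(e 2 : Mat)‖ ≤ 2 * ‖X‖ * (L * τ) := by
    rw [← Real.norm_eq_abs, ← norm_smul, sub_smul, ← hc t htI, ← hc s hsI]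
    have := norm_mul_mul_transpose_sub_le (g t : Mat)ᵀ (g s : Mat)ᵀ X (g t).norm_transpose_eq_one.le
      (g s).norm_transpose_eq_one.le
    rw [Matrix.transpose_transpose, Matrix.transpose_transpose, ← Matrix.transpose_sub,
      norm_transpose_mat] at this
    refine this.trans ?_
    calc _ ≤ 2 * (L * τ) * ‖X‖ := by gcongr
      _ = _ := by ring
  have hRn : ‖R‖ ≤ Cr * τ ^ 2 := by
    have h1 : ‖-((c t - c s) • (ctl (e 0) (e 1) w * (e 2 : Mat)))‖ ≤ (2 * ‖X‖ * (L * τ)) * (Kc * (2 * τ)) := by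
      rw [norm_neg, norm_smul, Real.norm_eq_abs]
      calc _ ≤ |c t - c s| * (‖ctl (e 0) (e 1) w‖ * ‖(e 2 : Mat)‖) := by gcongr; exact norm_mul_le _ _
        _ = (|c t - c s| * ‖(e 2 : Mat)‖) * ‖ctl (e 0) (e 1) w‖ := by ring
        _ ≤ _ := by gcongr
    have h2 : ‖c t • (ε * (e 2 : Mat))‖ ≤ ‖X‖ * (C * τ ^ 2) := by
      rw [norm_smul, Real.norm_eq_abs]
      calc _ ≤ |c t| * (‖ε‖ * ‖(e 2 : Mat)‖) := by gcongr; exact norm_mul_le _ _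
        _ = (|c t| * ‖(e 2 : Mat)‖) * ‖ε‖ := by ring
        _ ≤ _ := by gcongr; exact hcle t htI
    have h3 : ‖c s • ((e 2 : Mat) * ε)‖ ≤ ‖X‖ * (C * τ ^ 2) := by
      rw [norm_smul, Real.norm_eq_abs]
      calc _ ≤ |c s| * (‖(e 2 : Mat)‖ * ‖ε‖) := by gcongr; exact norm_mul_le _ _
        _ = (|c s| * ‖(e 2 : Mat)‖) * ‖ε‖ := by ring
        _ ≤ _ := by gcongr; exact hcle s hsI
    calc _ ≤ _ := (norm_add_le _ _).trans (add_le_add ((norm_sub_le _ _).trans (add_le_add h1 h2)) h3)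
      _ = _ := by rw [hCr]; ring
  have i10 := hb.inner₀₁
  rw [real_inner_comm] at i10
  have hveeR : ‖vee R‖ ≤ ‖vee‖ * (Cr * τ ^ 2) := (vee.le_opNorm _).trans (by gcongr)
  have hcs := hcge s hsI
  have him : |w.im| ≤ ‖vee‖ * Cr * n0 / (m * (a / b) * n0 ^ 2) * τ ^ 2 := by
    have h1 : ⟪vee R, vee (e 0 : Mat)⟫_ℝ = c s * (w.im * (a / b) * n0 ^ 2) := by
      rw [← hmain]
      simp only [map_add, map_sub, map_smul, inner_add_left, inner_sub_left, real_inner_smul_left,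
        hb.inner₂₀, i10, real_inner_self_eq_norm_sq]
      ring
    have h2 := abs_real_inner_le_norm (vee R) (vee (e 0 : Mat))
    rw [h1, abs_mul, abs_mul, abs_mul, abs_of_pos (div_pos ha hbp), abs_of_nonneg (sq_nonneg n0)] at h2
    rw [div_mul_eq_mul_div, le_div_iff₀ (by positivity)]
    calc _ = m * (|w.im| * (a / b) * n0 ^ 2) := by ring
      _ ≤ |c s| * (|w.im| * (a / b) * n0 ^ 2) := by gcongr
      _ ≤ _ := h2
      _ ≤ ‖vee‖ * (Cr * τ ^ 2) * n0 := by gcongr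
      _ = _ := by ring
  have hre : |w.re| ≤ ‖vee‖ * Cr * n1 / (m * (b / a) * n1 ^ 2) * τ ^ 2 := by
    have h1 : ⟪vee R, vee (e 1 : Mat)⟫_ℝ = -(c s * (w.re * (b / a) * n1 ^ 2)) := by
      rw [← hmain]
      simp only [map_add, map_sub, map_smul, inner_add_left, inner_sub_left, real_inner_smul_left,
        hb.inner₂₁, hb.inner₀₁, real_inner_self_eq_norm_sq]
      ring
    have h2 := abs_real_inner_le_norm (vee R) (vee (e 1 : Mat))
    rw [h1, abs_neg, abs_mul, abs_mul, abs_mul, abs_of_pos (div_pos hbp ha),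
      abs_of_nonneg (sq_nonneg n1)] at h2
    rw [div_mul_eq_mul_div, le_div_iff₀ (by positivity)]
    calc _ = m * (|w.re| * (b / a) * n1 ^ 2) := by ring
      _ ≤ |c s| * (|w.re| * (b / a) * n1 ^ 2) := by gcongr
      _ ≤ _ := h2
      _ ≤ ‖vee‖ * (Cr * τ ^ 2) * n1 := by gcongr
      _ = _ := by ring
  have hwD : ‖w‖ ≤ D * τ ^ 2 := by
    refine (Complex.norm_le_abs_re_add_abs_im w).trans ?_
    rw [hD, add_mul]
    linarith
  rw [SO3.norm_transpose_mul_sub_one]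
  calc _ = ‖ε + ctl (e 0) (e 1) w‖ := by rw [hε, hk, sub_add_cancel]
    _ ≤ C * τ ^ 2 + Kc * (D * τ ^ 2) :=
      (norm_add_le _ _).trans (add_le_add hdisp (((ctl (e 0) (e 1)).le_opNorm w).trans (by gcongr)))
    _ = _ := by ring

end SubRiemannianSO3

/-! ### Discretization of an arc and estimates for its increments. -/

theorem norm_push_comp_cov_sub_le (e₁ e₂ : so3) (X Y : SO3) :
    ‖push e₁ e₂ X ∘L cov e₁ e₂ X - push e₁ e₂ Y ∘L cov e₁ e₂ Y‖ ≤
      4 * pushBound e₁ e₂ ^ 2 * ‖(X : Mat) - Y‖ := by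
  have hpb := pushBound_nonneg e₁ e₂
  refine ContinuousLinearMap.opNorm_le_bound _ (by positivity) fun x => ?_
  have : (push e₁ e₂ X ∘L cov e₁ e₂ X - push e₁ e₂ Y ∘L cov e₁ e₂ Y) x =
      (push e₁ e₂ X - push e₁ e₂ Y) (cov e₁ e₂ X x) +
        push e₁ e₂ Y (cov e₁ e₂ X x - cov e₁ e₂ Y x) := by
    simp
  rw [this]
  calc _ ≤ (2 * pushBound e₁ e₂ * ‖(X : Mat) - Y‖) * (pushBound e₁ e₂ * ‖x‖) +
        pushBound e₁ e₂ * (2 * pushBound e₁ e₂ * ‖(X : Mat) - Y‖ * ‖x‖) := by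
        refine (norm_add_le _ _).trans (add_le_add ?_ ?_)
        · refine (ContinuousLinearMap.le_opNorm _ _).trans ?_
          gcongr
          exacts [norm_push_sub_le _ _ _ _, norm_cov_le _ _ _ _]
        · refine (ContinuousLinearMap.le_opNorm _ _).trans ?_
          gcongr
          exacts [norm_push_le _ _ _, norm_cov_sub_le _ _ _ _ _]
    _ = _ := by ring

theorem norm_mul_ctl_cov_sub_le (e₁ e₂ : so3) (X Y : SO3) (M M' : V3) :
    ‖(X : Mat) * ctl e₁ e₂ (cov e₁ e₂ X M') - (Y : Mat) * ctl e₁ e₂ (cov e₁ e₂ Y M)‖ ≤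
      ‖ctl e₁ e₂‖ * pushBound e₁ e₂ * (3 * ‖M‖ * ‖(X : Mat) - Y‖ + ‖M' - M‖) := by
  have hpb := pushBound_nonneg e₁ e₂
  have : (X : Mat) * ctl e₁ e₂ (cov e₁ e₂ X M') - (Y : Mat) * ctl e₁ e₂ (cov e₁ e₂ Y M) =
      (X : Mat) * ctl e₁ e₂ (cov e₁ e₂ X (M' - M)) +
      (X : Mat) * ctl e₁ e₂ (cov e₁ e₂ X M - cov e₁ e₂ Y M) +
      ((X : Mat) - Y) * ctl e₁ e₂ (cov e₁ e₂ Y M) := by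
    simp only [map_sub, mul_sub, sub_mul]; abel
  rw [this]
  calc _ ≤ ‖ctl e₁ e₂‖ * (pushBound e₁ e₂ * ‖M' - M‖) +
        ‖ctl e₁ e₂‖ * (2 * pushBound e₁ e₂ * ‖(X : Mat) - Y‖ * ‖M‖) +
        ‖(X : Mat) - Y‖ * (‖ctl e₁ e₂‖ * (pushBound e₁ e₂ * ‖M‖)) := by
        refine (norm_add_le _ _).trans (add_le_add ((norm_add_le _ _).trans (add_le_add ?_ ?_)) ?_)
        · refine (SO3.norm_mul_le _ _).trans ((ContinuousLinearMap.le_opNorm _ _).trans ?_)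
          gcongr
          exact norm_cov_le _ _ _ _
        · refine (SO3.norm_mul_le _ _).trans ((ContinuousLinearMap.le_opNorm _ _).trans ?_)
          gcongr
          exact norm_cov_sub_le _ _ _ _ _
        · refine (norm_mul_le _ _).trans ?_
          gcongr
          refine (ContinuousLinearMap.le_opNorm _ _).trans ?_
          gcongr
          exact norm_cov_le _ _ _ _
    _ = _ := by ring

theorem exists_norm_exp_smul_sub_le (e₁ e₂ : so3) : ∃ C ≥ 0, ∃ h₀ > 0, ∀ h > 0, h ≤ h₀ → ∀ w : ℂ, ‖w‖ ≤ 2 →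
    ‖exp (h • ctl e₁ e₂ w) - 1 - h • ctl e₁ e₂ w‖ ≤ C * h ^ 2 := by
  obtain ⟨C₁, hC₁, r, hr, hexp⟩ := exists_norm_exp_sub_exp_le
  set K := ‖ctl e₁ e₂‖ with hK
  have hK0 : 0 ≤ K := norm_nonneg (ctl e₁ e₂)
  refine ⟨C₁ * (K * 2) ^ 2, by positivity, r / (2 * K + 1), by positivity, ?_⟩
  intro h hh hh0 w hw
  rw [le_div_iff₀ (by positivity)] at hh0
  have hcw : ‖h • ctl e₁ e₂ w‖ ≤ K * 2 * h := by
    rw [norm_smul, Real.norm_of_nonneg hh.le]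
    calc _ ≤ h * (K * 2) := by
          gcongr
          exact ((ctl e₁ e₂).le_opNorm w).trans (by gcongr)
      _ = _ := by ring
  have := hexp (K * 2 * h) (by nlinarith) 0 (h • ctl e₁ e₂ w) (by rw [norm_zero]; positivity) hcw
  rw [exp_zero, sub_zero] at this
  calc _ ≤ _ := this
    _ ≤ C₁ * (K * 2 * h) * (K * 2 * h) := by gcongr
    _ = _ := by ring

theorem norm_sub_sub_le_sum {E : Type*} [NormedAddCommGroup E] [NormedSpace ℝ E] {P : ℕ → E} {F : E}
    {h : ℝ} {β : ℕ → ℝ} {i j : ℕ} (hij : i ≤ j)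
    (H : ∀ k, i ≤ k → k < j → ‖P (k + 1) - P k - h • F‖ ≤ β k) :
    ‖P j - P i - ((j - i : ℝ) * h) • F‖ ≤ ∑ k ∈ Finset.Ico i j, β k := by
  induction j, hij using Nat.le_induction with
  | base => simp
  | succ j hij ih =>
    rw [Finset.sum_Ico_succ_top hij]
    have : P (j + 1) - P i - (((j + 1 : ℕ) - i : ℝ) * h) • F =
        (P j - P i - ((j - i : ℝ) * h) • F) + (P (j + 1) - P j - h • F) := by
      push_cast
      rw [show ((j : ℝ) + 1 - i) * h = (j - i) * h + h by ring, add_smul]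
      abel
    rw [this]
    exact (norm_add_le _ _).trans (add_le_add (ih fun k h1 h2 => H k h1 (by omega)) (H j hij (by omega)))

namespace HasDisplacement

variable {e₁ e₂ : so3} {g : ℝ → SO3} {α T C : ℝ}

theorem grid_mem (_ : HasDisplacement e₁ e₂ g α T C) {h : ℝ} (hh : 0 < h) {N : ℕ} (hN : N * h = T) {j : ℕ}
    (hj : j ≤ N) : α + j * h ∈ Set.Icc α (α + T) := by
  have h1 : (j : ℝ) * h ≤ N * h := by gcongr
  have h2 : 0 ≤ (j : ℝ) * h := by positivity
  constructor <;> linarith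

/-- The control w_j is h⁻¹ times the displacement between consecutive grid points. One step errs by
O(h²); rotations are isometries, so errors add up without growing, and the total time is at most 1.
-/
theorem exists_discretization (H : HasDisplacement e₁ e₂ g α T C) {h : ℝ} (hh : 0 < h) {N : ℕ}
    (hN : N * h = T) : ∃ (P : ℕ → SO3) (w : ℕ → ℂ), P 0 = g α ∧
      (∀ j, P (j + 1) = P j * expSO3 (ctlSo e₁ e₂ (h • w j))) ∧ (∀ j, ‖w j‖ ≤ 1 + h) ∧
      ∀ j ≤ N, ‖(P j : Mat) - g (α + j * h)‖ ≤ C * h := by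
  have hC := H.nonneg
  have hex : ∀ j : ℕ, ∃ w : ℂ, ‖w‖ ≤ 1 + h ∧ (j < N →
      ‖(g (α + j * h) : Mat)ᵀ * g (α + (j + 1 : ℕ) * h) - exp (h • ctl e₁ e₂ w)‖ ≤ C * h ^ 2) := by
    intro j
    by_cases hj : j < N
    · have h1 := H.grid_mem hh hN hj.le
      have h2 := H.grid_mem hh hN (Nat.succ_le_of_lt hj)
      have h3 : α + ((j + 1 : ℕ) : ℝ) * h - (α + j * h) = h := by push_cast; ring
      obtain ⟨w, hw, -, hw2⟩ := H.exists_disp _ _ h1.1 (by linarith) h2.2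
      rw [Nat.succ_eq_add_one, h3] at hw hw2
      refine ⟨h⁻¹ • w, ?_, fun _ => ?_⟩
      · rw [norm_smul, norm_inv, Real.norm_of_nonneg hh.le, inv_mul_le_iff₀ hh]
        linarith
      · rwa [map_smul, smul_smul, mul_inv_cancel₀ hh.ne', one_smul]
    -- Beyond the arc the control is immaterial; 0 satisfies the norm bound.
    · exact ⟨0, by simp; positivity, fun h => absurd h hj⟩
  choose w hw hw2 using hex
  refine ⟨expPath (g α) fun j => ctlSo e₁ e₂ (h • w j), w, rfl, fun _ => rfl, hw, ?_⟩
  set P := expPath (g α) fun j => ctlSo e₁ e₂ (h • w j) with hP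
  have key : ∀ j : ℕ, j ≤ N → ‖(P j : Mat) - g (α + j * h)‖ ≤ C * (j * h) * h := by
    intro j
    induction j with
    | zero => intro _; simp [hP, expPath]
    | succ j ih =>
      intro hj
      have h1 := ih (by omega)
      have h2 := hw2 j (by omega)
      have e1 : (P (j + 1) : Mat) = P j * exp (h • ctl e₁ e₂ (w j)) := coe_mul_expSO3_ctlSo _ _ _ _ _
      set g1 := g (α + j * h)
      set g2 := g (α + (j + 1 : ℕ) * h)
      have e2 : (P (j + 1) : Mat) - g2 = -((P j : Mat) * ((g1 : Mat)ᵀ * g2 - exp (h • ctl e₁ e₂ (w j)))) +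
          ((P j : Mat) - g1) * (g1 : Mat)ᵀ * g2 := by
        rw [e1, sub_mul, SO3.mul_transpose, sub_mul, one_mul, mul_sub, mul_assoc (P j : Mat) (g1 : Mat)ᵀ]
        abel
      rw [e2]
      calc _ ≤ C * h ^ 2 + C * (j * h) * h := by
            refine (norm_add_le _ _).trans (add_le_add ?_ ?_)
            · rw [norm_neg]; exact (SO3.norm_mul_le _ _).trans h2
            · exact (SO3.norm_mul_coe_le _ _).trans ((SO3.norm_mul_transpose_le _ _).trans h1)
        _ = _ := by push_cast; ring
  intro j hj
  refine (key j hj).trans ?_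
  have h1 : (j : ℝ) * h ≤ 1 := by
    have : (j : ℝ) * h ≤ N * h := by gcongr
    linarith [H.le_one]
  calc _ ≤ C * 1 * h := by gcongr
    _ = _ := by ring

-- The increment of g is the sum of the steps of P between s and t. Freezing the control at cov (g
-- s) M costs O(τ + h + ‖M' − M‖) per unit time, and the residual contributes O(D). All terms except
-- A(t − s)² vanish when h and D tend to 0 and M' tends to M.
set_option maxHeartbeats 1000000 in
theorem exists_increment_bound (H : HasDisplacement e₁ e₂ g α T C) (B : ℝ) (hB : 0 ≤ B) :
    ∃ A ≥ 0, ∃ h₀ > 0, ∀ h > 0, h ≤ h₀ → ∀ N : ℕ, N * h = T → ∀ (P : ℕ → SO3) (w : ℕ → ℂ) (M M' : V3) (D : ℝ),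
      (∀ j, P (j + 1) = P j * expSO3 (ctlSo e₁ e₂ (h • w j))) → (∀ j, ‖w j‖ ≤ 2) →
      (∀ j ≤ N, ‖(P j : Mat) - g (α + j * h)‖ ≤ C * h) → ‖M‖ ≤ B →
      h * ∑ j ∈ Finset.range N, ‖w j - cov e₁ e₂ (P j) M'‖ ^ 2 ≤ D ^ 2 → 0 ≤ D →
      ∀ s t, α ≤ s → s < t → t ≤ α + T →
        ‖(g t : Mat) - g s - (t - s) • ((g s : Mat) * ctl e₁ e₂ (cov e₁ e₂ (g s) M))‖ ≤
          A * (t - s) ^ 2 + A * (h + D + ‖M' - M‖) := by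
  obtain ⟨C₁, hC₁, h₀, hh₀, hexp⟩ := exists_norm_exp_smul_sub_le e₁ e₂
  have hC := H.nonneg
  set K := ‖ctl e₁ e₂‖ with hK
  have hK0 : 0 ≤ K := norm_nonneg (ctl e₁ e₂)
  set pb := pushBound e₁ e₂ with hpb
  have hpb0 : 0 ≤ pb := pushBound_nonneg _ _
  set L := 2 * K + C with hL
  have hL0 : 0 ≤ L := by positivity
  set A₁ := K * pb * (3 * B) with hA₁
  have hA₁0 : 0 ≤ A₁ := by positivity
  set A := A₁ * L + K + 2 * K * pb + (C₁ + A₁ * (2 * C + 3 * L) + 2 * (L + C) + K * (pb * B)) with hA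
  refine ⟨A, by positivity, min h₀ 1, by positivity, ?_⟩
  intro h hh hhle N hN P w M M' D hP hw hPg hM hD hD0 s t hs hst ht
  obtain ⟨hhle, hh1⟩ := le_min_iff.1 hhle
  set τ := t - s with hτ
  have hτ0 : 0 < τ := by rw [hτ]; linarith
  have hT1 := H.le_one
  have hτ1 : τ ≤ 1 := by rw [hτ]; linarith
  set F := (g s : Mat) * ctl e₁ e₂ (cov e₁ e₂ (g s) M) with hF
  -- Rounding s and t down to the grid moves P and g by O(h), by the Lipschitz bound.
  set i := ⌊(s - α) / h⌋₊ with hi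
  set j := ⌊(t - α) / h⌋₊ with hj
  have hi1 : (i : ℝ) * h ≤ s - α := by
    rw [← le_div_iff₀ hh]; exact Nat.floor_le (div_nonneg (by linarith) hh.le)
  have hi2 : s - α < (i + 1 : ℝ) * h := by
    rw [← div_lt_iff₀ hh]; exact Nat.lt_floor_add_one _
  have hj1 : (j : ℝ) * h ≤ t - α := by
    rw [← le_div_iff₀ hh]; exact Nat.floor_le (div_nonneg (by linarith) hh.le)
  have hj2 : t - α < (j + 1 : ℝ) * h := by
    rw [← div_lt_iff₀ hh]; exact Nat.lt_floor_add_one _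
  have hij : i ≤ j := Nat.floor_le_floor (by gcongr)
  have hjN : j ≤ N := by
    have : (j : ℝ) * h ≤ N * h := by linarith
    exact_mod_cast le_of_mul_le_mul_right this hh
  set r : ℕ → ℂ := fun k => w k - cov e₁ e₂ (P k) M' with hr
  set m := ‖M' - M‖ with hm
  have hm0 : 0 ≤ m := norm_nonneg _
  have hstep : ∀ k, i ≤ k → k < j → ‖(P (k + 1) : Mat) - P k - h • F‖ ≤
      (C₁ * h ^ 2 + h * (K * pb * (3 * B * (C * h + L * (τ + h)) + m))) + h * (K * ‖r k‖) := by
    intro k hik hkj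
    have hk1 : (i : ℝ) * h ≤ k * h := by gcongr
    have hk2 : ((k : ℝ) + 1) * h ≤ j * h := by gcongr; exact_mod_cast hkj
    have habs : |α + k * h - s| ≤ τ + h := by
      rw [abs_le]
      constructor <;> nlinarith
    have hkN : k ≤ N := by omega
    have hPs : ‖(P k : Mat) - g s‖ ≤ C * h + L * (τ + h) := by
      calc _ = ‖((P k : Mat) - g (α + k * h)) + ((g (α + k * h) : Mat) - g s)‖ := by rw [sub_add_sub_cancel]
        _ ≤ C * h + L * |α + k * h - s| := (norm_add_le _ _).trans (add_le_add (hPg k hkN)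
            (H.lipschitz ⟨hs, by linarith⟩ (H.grid_mem hh hN hkN)))
        _ ≤ _ := by gcongr
    have hid : (P (k + 1) : Mat) - P k - h • F =
        (P k : Mat) * (exp (h • ctl e₁ e₂ (w k)) - 1 - h • ctl e₁ e₂ (w k)) +
        h • ((P k : Mat) * ctl e₁ e₂ (cov e₁ e₂ (P k) M') - F) + h • ((P k : Mat) * ctl e₁ e₂ (r k)) := by
      rw [hP, coe_mul_expSO3_ctlSo]
      simp only [hr, map_sub, mul_sub, mul_one, smul_sub, mul_smul_comm]
      abel
    rw [hid]
    refine (norm_add_le _ _).trans (add_le_add ((norm_add_le _ _).trans (add_le_add ?_ ?_)) ?_)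
    · exact (SO3.norm_mul_le _ _).trans (hexp h hh hhle _ (hw k))
    · rw [norm_smul, Real.norm_of_nonneg hh.le]
      gcongr
      refine (norm_mul_ctl_cov_sub_le _ _ _ _ _ _).trans ?_
      gcongr
    · rw [norm_smul, Real.norm_of_nonneg hh.le]
      gcongr
      exact (SO3.norm_mul_le _ _).trans ((ctl e₁ e₂).le_opNorm _)
  have hsum := norm_sub_sub_le_sum (P := fun k => (P k : Mat)) hij hstep
  rw [Finset.sum_add_distrib, Finset.sum_const, Nat.card_Ico, nsmul_eq_mul, Nat.cast_sub hij] at hsum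
  -- Cauchy–Schwarz, with total time N h = T ≤ 1, bounds the mean of ‖r‖ by its mean square.
  have hrsum : ∑ k ∈ Finset.Ico i j, h * (K * ‖r k‖) ≤ K * D := by
    have h1 : (h * ∑ k ∈ Finset.range N, ‖r k‖) ^ 2 ≤ D ^ 2 := by
      have h2 := sq_sum_le_card_mul_sum_sq (s := Finset.range N) (f := fun j => ‖r j‖)
      rw [Finset.card_range] at h2
      calc _ = h ^ 2 * (∑ k ∈ Finset.range N, ‖r k‖) ^ 2 := by ring
        _ ≤ h ^ 2 * (N * ∑ k ∈ Finset.range N, ‖r k‖ ^ 2) := by gcongr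
        _ = (N * h) * (h * ∑ k ∈ Finset.range N, ‖r k‖ ^ 2) := by ring
        _ ≤ 1 * D ^ 2 := by
          rw [hN]
          gcongr
        _ = _ := one_mul _
    have h3 : h * ∑ k ∈ Finset.range N, ‖r k‖ ≤ D := le_of_sq_le_sq h1 hD0
    calc _ ≤ ∑ k ∈ Finset.range N, h * (K * ‖r k‖) := by
          refine Finset.sum_le_sum_of_subset_of_nonneg (fun k hk => ?_) fun _ _ _ => by positivity
          rw [Finset.mem_Ico] at hk
          exact Finset.mem_range.2 (by omega)
      _ = K * (h * ∑ k ∈ Finset.range N, ‖r k‖) := by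
          rw [Finset.mul_sum, Finset.mul_sum]
          exact Finset.sum_congr rfl fun _ _ => by ring
      _ ≤ _ := by gcongr
  have hn1 : ((j : ℝ) - i) * h ≤ τ + h := by rw [hτ]; linarith
  have hn0 : 0 ≤ ((j : ℝ) - i) * h := by
    have : (i : ℝ) ≤ j := by exact_mod_cast hij
    exact mul_nonneg (by linarith) hh.le
  have hnT : ((j : ℝ) - i) * h ≤ 1 := by
    have : 0 ≤ (i : ℝ) * h := by positivity
    linarith
  have hn2 : |((j : ℝ) - i) * h - τ| ≤ h := by
    rw [abs_le, hτ]; constructor <;> linarith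
  have hbulk : ((j : ℝ) - i) * (C₁ * h ^ 2 + h * (K * pb * (3 * B * (C * h + L * (τ + h)) + m))) ≤
      C₁ * h + A₁ * (L * τ ^ 2 + (2 * C + 3 * L) * h) + 2 * (K * pb) * m := by
    have hτh : τ * h ≤ 1 * h := by gcongr
    have hh2 : h * h ≤ 1 * h := by gcongr
    have hτm : τ * m ≤ 1 * m := by gcongr
    have hhm : h * m ≤ 1 * m := by gcongr
    calc _ = C₁ * (((j : ℝ) - i) * h) * h + (((j : ℝ) - i) * h) * (A₁ * (C * h + L * (τ + h))) +
          (((j : ℝ) - i) * h) * (K * pb * m) := by rw [hA₁]; ring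
      _ ≤ C₁ * 1 * h + (τ + h) * (A₁ * (C * h + L * (τ + h))) + (τ + h) * (K * pb * m) := by
          gcongr
      _ = C₁ * h + A₁ * (L * τ ^ 2 + C * (τ * h) + C * (h * h) + L * (2 * (τ * h) + h * h)) +
          K * pb * (τ * m + h * m) := by ring
      _ ≤ C₁ * h + A₁ * (L * τ ^ 2 + C * (1 * h) + C * (1 * h) + L * (2 * (1 * h) + 1 * h)) +
          K * pb * (1 * m + 1 * m) := by gcongr
      _ = _ := by ring
  have hFn : ‖F‖ ≤ K * (pb * B) := by
    refine (SO3.norm_mul_le _ _).trans (((ctl e₁ e₂).le_opNorm _).trans ?_)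
    gcongr
    exact (norm_cov_le _ _ _ _).trans (by gcongr)
  have hend : ∀ k ≤ N, ∀ σ ∈ Set.Icc α (α + T), |α + k * h - σ| ≤ h → ‖(P k : Mat) - g σ‖ ≤ (L + C) * h := by
    intro k hk σ hσ habs
    calc _ = ‖((P k : Mat) - g (α + k * h)) + ((g (α + k * h) : Mat) - g σ)‖ := by rw [sub_add_sub_cancel]
      _ ≤ C * h + L * |α + k * h - σ| := (norm_add_le _ _).trans (add_le_add (hPg k hk)
          (H.lipschitz hσ (H.grid_mem hh hN hk)))
      _ ≤ C * h + L * h := by gcongr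
      _ = _ := by ring
  have e1 := hend j hjN t ⟨by linarith, ht⟩ (by rw [abs_le]; constructor <;> linarith)
  have e2 := hend i (hij.trans hjN) s ⟨hs, by linarith⟩ (by rw [abs_le]; constructor <;> linarith)
  have e3 : ‖(((j : ℝ) - i) * h - τ) • F‖ ≤ h * (K * (pb * B)) := by
    rw [norm_smul, Real.norm_eq_abs]; gcongr
  have hid : (g t : Mat) - g s - τ • F = ((P j : Mat) - P i - (((j : ℝ) - i) * h) • F) -
      ((P j : Mat) - g t) + ((P i : Mat) - g s) + (((j : ℝ) - i) * h - τ) • F := by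
    rw [sub_smul (((j : ℝ) - i) * h) τ F]; abel
  rw [hid]
  have hfin := (norm_add_le _ _).trans (add_le_add ((norm_add_le _ _).trans
    (add_le_add ((norm_sub_le _ _).trans (add_le_add hsum e1)) e2)) e3)
  refine hfin.trans ?_
  have q1 : 0 ≤ (K + 2 * K * pb + (C₁ + A₁ * (2 * C + 3 * L) + 2 * (L + C) + K * (pb * B))) * τ ^ 2 := by
    positivity
  have q2 : 0 ≤ (A₁ * L + K + 2 * K * pb) * h := by positivity
  have q3 : 0 ≤ (A₁ * L + 2 * K * pb + (C₁ + A₁ * (2 * C + 3 * L) + 2 * (L + C) + K * (pb * B))) * D := by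
    positivity
  have q4 : 0 ≤ (A₁ * L + K + (C₁ + A₁ * (2 * C + 3 * L) + 2 * (L + C) + K * (pb * B))) * m := by
    positivity
  rw [hA]
  linarith

end HasDisplacement

theorem HasDisplacement.continuousOn {e₁ e₂ : so3} {g : ℝ → SO3} {α T C : ℝ}
    (H : HasDisplacement e₁ e₂ g α T C) :
    ContinuousOn (fun t => push e₁ e₂ (g t) ∘L cov e₁ e₂ (g t)) (Set.Icc α (α + T)) := by
  have hC := H.nonneg
  have hpb := pushBound_nonneg e₁ e₂
  have : LipschitzOnWith ⟨4 * pushBound e₁ e₂ ^ 2 * (2 * ‖ctl e₁ e₂‖ + C), by positivity⟩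
      (fun t => push e₁ e₂ (g t) ∘L cov e₁ e₂ (g t)) (Set.Icc α (α + T)) := by
    refine LipschitzOnWith.of_dist_le_mul fun s hs t ht => ?_
    rw [dist_eq_norm, dist_comm, Real.dist_eq]
    change _ ≤ 4 * pushBound e₁ e₂ ^ 2 * (2 * ‖ctl e₁ e₂‖ + C) * |t - s|
    rw [norm_sub_rev, mul_assoc]
    refine (norm_push_comp_cov_sub_le _ _ _ _).trans ?_
    gcongr
    exact H.lipschitz hs ht
  exact this.continuousOn

/-- The Gram operator is a Riemann sum of a Lipschitz integrand, taken at points P_j within O(h) of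
the curve. -/
theorem HasDisplacement.norm_gram_sub_integral_le {e₁ e₂ : so3} {g : ℝ → SO3} {α T C : ℝ}
    (H : HasDisplacement e₁ e₂ g α T C) {h : ℝ} (hh : 0 < h) {N : ℕ} (hN : N * h = T) {P : ℕ → SO3} {C₀ : ℝ}
    (hP : ∀ j ≤ N, ‖(P j : Mat) - g (α + j * h)‖ ≤ C₀ * h) :
    ‖gram e₁ e₂ h N P - ∫ t in α..α + T, push e₁ e₂ (g t) ∘L cov e₁ e₂ (g t)‖ ≤
      4 * pushBound e₁ e₂ ^ 2 * (C₀ + (2 * ‖ctl e₁ e₂‖ + C)) * h := by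
  have hC := H.nonneg
  have hpb := pushBound_nonneg e₁ e₂
  set L := 2 * ‖ctl e₁ e₂‖ + C with hL
  have hL0 : 0 ≤ L := by positivity
  set G : SO3 → V3 →L[ℝ] V3 := fun X => push e₁ e₂ X ∘L cov e₁ e₂ X with hG
  have hcont : ContinuousOn (fun t => G (g t)) (Set.Icc α (α + T)) := H.continuousOn
  have hsub : ∀ j < N, Set.uIcc (α + j * h) (α + (j + 1 : ℕ) * h) ⊆ Set.Icc α (α + T) := fun j hj => by
    have h1 := H.grid_mem hh hN hj.le
    have h2 := H.grid_mem hh hN (Nat.succ_le_of_lt hj)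
    exact Set.uIcc_subset_Icc h1 h2
  have hint : ∀ j < N, IntervalIntegrable (fun t => G (g t)) MeasureTheory.volume (α + j * h)
      (α + (j + 1 : ℕ) * h) := fun j hj => (hcont.mono (hsub j hj)).intervalIntegrable
  have hadj := intervalIntegral.sum_integral_adjacent_intervals (a := fun j : ℕ => α + j * h) hint
  simp only [Nat.cast_zero, zero_mul, add_zero, hN] at hadj
  have hgram : gram e₁ e₂ h N P = ∑ j ∈ Finset.range N, ∫ _t in (α + j * h)..(α + (j + 1 : ℕ) * h), G (P j) := by
    rw [gram, Finset.smul_sum]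
    refine Finset.sum_congr rfl fun j _ => ?_
    rw [intervalIntegral.integral_const]
    congr 1
    push_cast; ring
  change ‖gram e₁ e₂ h N P - ∫ t in α..α + T, G (g t)‖ ≤ _
  rw [← hadj, hgram, ← Finset.sum_sub_distrib]
  calc _ ≤ ∑ j ∈ Finset.range N, 4 * pushBound e₁ e₂ ^ 2 * (C₀ * h + L * h) * h := by
        refine norm_sum_le_of_le _ fun j hj => ?_
        have hj' := Finset.mem_range.1 hj
        rw [← intervalIntegral.integral_sub intervalIntegrable_const (hint j hj')]
        have hlen : |α + (j + 1 : ℕ) * h - (α + j * h)| = h := by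
          rw [show α + (j + 1 : ℕ) * h - (α + j * h) = h by push_cast; ring, abs_of_pos hh]
        have := intervalIntegral.norm_integral_le_of_norm_le_const
          (f := fun t => G (P j) - G (g t)) (a := α + j * h) (b := α + (j + 1 : ℕ) * h)
          (C := 4 * pushBound e₁ e₂ ^ 2 * (C₀ * h + L * h)) (fun t ht => by
            have htI := hsub j hj' (Set.uIoc_subset_uIcc ht)
            refine (norm_push_comp_cov_sub_le _ _ _ _).trans ?_
            gcongr
            rw [Set.uIoc_of_le (by push_cast; nlinarith)] at ht
            have habs : |α + j * h - t| ≤ h := by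
              rw [abs_le]
              have := ht.2
              push_cast at this
              constructor <;> linarith [ht.1]
            calc _ = ‖((P j : Mat) - g (α + j * h)) + ((g (α + j * h) : Mat) - g t)‖ := by
                  rw [sub_add_sub_cancel]
              _ ≤ C₀ * h + L * |α + j * h - t| := (norm_add_le _ _).trans (add_le_add (hP j hj'.le)
                  (H.lipschitz htI (H.grid_mem hh hN hj'.le)))
              _ ≤ _ := by gcongr)
        rwa [hlen] at this
    _ = (N * h) * (4 * pushBound e₁ e₂ ^ 2 * (C₀ + L) * h) := by simp; ring
    _ ≤ 1 * (4 * pushBound e₁ e₂ ^ 2 * (C₀ + L) * h) := by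
        have hC₀ : 0 ≤ C₀ * h := (norm_nonneg _).trans (hP 0 (Nat.zero_le _))
        have : 0 ≤ C₀ := nonneg_of_mul_nonneg_left hC₀ hh
        rw [hN]
        gcongr
        exact H.le_one
    _ = _ := one_mul _

/-! ### Coercivity and the limiting multiplier. -/

namespace SubRiemannianSO3

variable {S : SubRiemannianSO3} {a b : ℝ} {e : Module.Basis (Fin 3) ℝ so3}

/-- The limit form x ↦ ∫ |cov (g t) x|² is positive definite, because a null vector would be an
abnormal multiplier. Its minimum over the unit sphere is a coercivity constant, half of which
survives the O(h) error of the Gram operator. -/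
theorem IsNormalizedBasis.exists_coercive (hb : S.IsNormalizedBasis a b e) {g : ℝ → SO3} {α T C C₀ : ℝ}
    (H : HasDisplacement (e 0) (e 1) g α T C) (hne : g (α + T) ≠ g α) (hC₀ : 0 ≤ C₀) :
    ∃ κ > 0, ∃ h₀ > 0, ∀ h > 0, h ≤ h₀ → ∀ N : ℕ, N * h = T → ∀ P : ℕ → SO3,
      (∀ j ≤ N, ‖(P j : Mat) - g (α + j * h)‖ ≤ C₀ * h) →
      ∀ x, κ * ‖x‖ ^ 2 ≤ ⟪gram (e 0) (e 1) h N P x, x⟫_ℝ := by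
  set G : ℝ → V3 →L[ℝ] V3 := fun t => push (e 0) (e 1) (g t) ∘L cov (e 0) (e 1) (g t) with hG
  have hαT : α < α + T := by linarith [H.pos]
  have hcont : ContinuousOn G (Set.Icc α (α + T)) := H.continuousOn
  have hint : IntervalIntegrable G MeasureTheory.volume α (α + T) := by
    refine ContinuousOn.intervalIntegrable ?_
    rwa [Set.uIcc_of_le hαT.le]
  set A : V3 →L[ℝ] V3 := ∫ t in α..α + T, G t with hA
  have hAx : ∀ x, ⟪A x, x⟫_ℝ = ∫ t in α..α + T, ‖cov (e 0) (e 1) (g t) x‖ ^ 2 := by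
    intro x
    let Λ : (V3 →L[ℝ] V3) →L[ℝ] ℝ := (innerSL ℝ x) ∘L (ContinuousLinearMap.apply ℝ V3 x)
    have hΛ : ∀ f : V3 →L[ℝ] V3, Λ f = ⟪f x, x⟫_ℝ := fun f => by
      change ⟪x, f x⟫_ℝ = _
      exact real_inner_comm _ _
    rw [← hΛ, hA, ← Λ.intervalIntegral_comp_comm hint]
    congr 1
    funext t
    rw [hΛ, hG]
    simp only [ContinuousLinearMap.comp_apply]
    rw [inner_push, real_inner_self_eq_norm_sq]
  have hcontx : ∀ x, ContinuousOn (fun t => ‖cov (e 0) (e 1) (g t) x‖ ^ 2) (Set.Icc α (α + T)) := by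
    intro x
    have h1 : (fun t => ‖cov (e 0) (e 1) (g t) x‖ ^ 2) = fun t => ⟪G t x, x⟫_ℝ := by
      funext t
      rw [hG]
      simp only [ContinuousLinearMap.comp_apply]
      rw [inner_push, real_inner_self_eq_norm_sq]
    rw [h1]
    exact (hcont.clm_apply continuousOn_const).inner continuousOn_const
  have hpos : ∀ x ≠ 0, 0 < ⟪A x, x⟫_ℝ := by
    intro x hx
    rw [hAx]
    refine intervalIntegral.integral_pos hαT (hcontx x) (fun t _ => by positivity) ?_
    by_contra hcon
    push Not at hcon
    refine hx (hb.eq_of_cov_eq_zero H hne fun t ht => ?_)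
    have := hcon t ht
    have h2 : ‖cov (e 0) (e 1) (g t) x‖ = 0 := by
      have := sq_nonneg ‖cov (e 0) (e 1) (g t) x‖
      exact pow_eq_zero_iff two_ne_zero |>.1 (by linarith)
    exact norm_eq_zero.1 h2
  obtain ⟨x₀, hx₀, hmin⟩ := (isCompact_sphere (0 : V3) 1).exists_isMinOn
    (NormedSpace.sphere_nonempty.2 zero_le_one) (f := fun x => ⟪A x, x⟫_ℝ)
    (by fun_prop)
  set κ := ⟪A x₀, x₀⟫_ℝ with hκ
  have hκ0 : 0 < κ := hpos x₀ (by
    rintro rfl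
    simp at hx₀)
  have hAcoer : ∀ x, κ * ‖x‖ ^ 2 ≤ ⟪A x, x⟫_ℝ := by
    intro x
    rcases eq_or_ne x 0 with rfl | hx
    · simp
    · have hxn : ‖x‖ ≠ 0 := norm_ne_zero_iff.2 hx
      have h1 : κ ≤ ⟪A (‖x‖⁻¹ • x), ‖x‖⁻¹ • x⟫_ℝ := hmin (by
        rw [mem_sphere_zero_iff_norm, norm_smul, norm_inv, norm_norm, inv_mul_cancel₀ hxn])
      rw [map_smul, real_inner_smul_left, real_inner_smul_right] at h1
      calc κ * ‖x‖ ^ 2 ≤ (‖x‖⁻¹ * (‖x‖⁻¹ * ⟪A x, x⟫_ℝ)) * ‖x‖ ^ 2 := by gcongr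
        _ = _ := by field_simp
  have hpb := pushBound_nonneg (e 0) (e 1)
  have hC := H.nonneg
  set Q := 4 * pushBound (e 0) (e 1) ^ 2 * (C₀ + (2 * ‖ctl (e 0) (e 1)‖ + C)) with hQ
  have hQ0 : 0 ≤ Q := by positivity
  refine ⟨κ / 2, by positivity, κ / (2 * (Q + 1)), by positivity, ?_⟩
  intro h hh hh0 N hN P hP x
  rw [le_div_iff₀ (by positivity)] at hh0
  have h1 := H.norm_gram_sub_integral_le hh hN hP
  have h2 : |⟪(gram (e 0) (e 1) h N P - A) x, x⟫_ℝ| ≤ Q * h * ‖x‖ ^ 2 := by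
    refine (abs_real_inner_le_norm _ _).trans ?_
    calc _ ≤ (Q * h * ‖x‖) * ‖x‖ := by
          gcongr
          exact (ContinuousLinearMap.le_opNorm _ _).trans (by gcongr)
      _ = _ := by ring
  rw [sub_apply, inner_sub_left] at h2
  have h3 := (abs_le.1 h2).1
  have h4 : Q * h * ‖x‖ ^ 2 ≤ κ / 2 * ‖x‖ ^ 2 := by gcongr; linarith
  linarith [hAcoer x]

/-- The approximate multipliers for finer and finer grids lie in a fixed ball; along a convergent
subsequence the errors in the increment bound tend to 0. -/
theorem IsNormalizedBasis.exists_multiplier_arc (hb : S.IsNormalizedBasis a b e) {g : ℝ → SO3} {α T C : ℝ}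
    (H : HasDisplacement (e 0) (e 1) g α T C) (hne : g (α + T) ≠ g α)
    (hmin : ∀ l, S.Reach (g α) (g (α + T)) l → T ≤ l) :
    ∃ (M : V3) (A : ℝ), ∀ s t, α ≤ s → s < t → t ≤ α + T →
      ‖(g t : Mat) - g s - (t - s) • ((g s : Mat) * ctl (e 0) (e 1) (cov (e 0) (e 1) (g s) M))‖ ≤
        A * (t - s) ^ 2 := by
  have hC := H.nonneg
  have hT := H.pos
  obtain ⟨κ, hκ, h₁, hh₁, hcoer⟩ := hb.exists_coercive H hne hC
  obtain ⟨B, hB, D, hD, s₀, hs₀, hmult⟩ := hb.isFrame.exists_multiplier κ T C hκ hT hC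
  obtain ⟨A, hA, h₂, hh₂, hinc⟩ := H.exists_increment_bound B hB.le
  have hseq : ∀ n : ℕ, ∃ (h η : ℝ) (M' : V3), 0 ≤ h ∧ h ≤ 1 / ((n : ℝ) + 1) ∧ 0 ≤ η ∧
      η ^ 2 ≤ D * (1 / ((n : ℝ) + 1)) ∧ ‖M'‖ ≤ B ∧ ∀ M : V3, ‖M‖ ≤ B → ∀ s t, α ≤ s → s < t → t ≤ α + T →
        ‖(g t : Mat) - g s - (t - s) • ((g s : Mat) * ctl (e 0) (e 1) (cov (e 0) (e 1) (g s) M))‖ ≤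
          A * (t - s) ^ 2 + A * (h + η + ‖M' - M‖) := by
    intro n
    -- The variation parameter tends to 0 with n, and the mesh T/N is then taken below σ², as the
    -- multiplier estimate requires.
    set σ := min s₀ (1 / ((n : ℝ) + 1)) with hσ
    have hσ0 : 0 < σ := by positivity
    set hmax := min (min 1 (σ ^ 2)) (min (min h₁ h₂) (1 / ((n : ℝ) + 1))) with hhmax
    have hmax0 : 0 < hmax := by positivity
    obtain ⟨N, hNlt⟩ := exists_nat_gt (T / hmax)
    have hN0 : (0 : ℝ) < N := (by positivity : 0 < T / hmax).trans hNlt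
    set h := T / N with hh
    have hpos : 0 < h := by positivity
    have hN : N * h = T := by rw [hh]; field_simp
    have hle : h ≤ hmax := by
      rw [hh, div_le_iff₀ hN0, mul_comm]
      rw [div_lt_iff₀ hmax0] at hNlt
      exact hNlt.le
    simp only [hhmax, le_min_iff] at hle
    obtain ⟨⟨hl1, hl2⟩, ⟨hl3, hl4⟩, hl5⟩ := hle
    obtain ⟨P, w, hP0, hP, hw, hPg⟩ := H.exists_discretization hpos hN
    have hend := hPg N le_rfl
    rw [hN] at hend
    obtain ⟨M', hM', hdef⟩ := hmult σ hσ0 (min_le_left _ _) h hpos hl2 N hN P w hP hw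
      (hcoer h hpos hl3 N hN P hPg) (g (α + T)) hend (by rw [hP0]; exact hmin)
    set d := h * ∑ j ∈ Finset.range N, ‖w j - cov (e 0) (e 1) (P j) M'‖ ^ 2 with hd
    have hd0 : 0 ≤ d := by positivity
    refine ⟨h, Real.sqrt d, M', hpos.le, hl5, Real.sqrt_nonneg _, ?_, hM', ?_⟩
    · rw [Real.sq_sqrt hd0]
      exact hdef.trans (by gcongr; exact min_le_right _ _)
    · intro M hM
      exact hinc h hpos hl4 N hN P w M M' (Real.sqrt d) hP (fun j => (hw j).trans (by linarith)) hPg hM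
        (Real.sq_sqrt hd0).ge (Real.sqrt_nonneg _)
  choose h η M' hh0 hh hη0 hη hM' hbound using hseq
  obtain ⟨M, hM, φ, hφ, hlim⟩ := tendsto_subseq_of_bounded (Metric.isBounded_closedBall (x := (0 : V3)) (r := B))
    (x := M') (fun n => by simpa using hM' n)
  rw [Metric.isClosed_closedBall.closure_eq, mem_closedBall_zero_iff] at hM
  refine ⟨M, A, fun s t hs hst ht => ?_⟩
  have t1 : Filter.Tendsto (fun n : ℕ => 1 / ((n : ℝ) + 1)) Filter.atTop (nhds 0) :=
    tendsto_one_div_add_atTop_nhds_zero_nat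
  have th : Filter.Tendsto h Filter.atTop (nhds 0) := squeeze_zero hh0 hh t1
  have tη : Filter.Tendsto η Filter.atTop (nhds 0) := by
    have h1 : Filter.Tendsto (fun n => η n ^ 2) Filter.atTop (nhds 0) :=
      squeeze_zero (fun n => sq_nonneg _) hη (by simpa using t1.const_mul D)
    have h2 := (Real.continuous_sqrt.tendsto 0).comp h1
    simpa [Function.comp_def, Real.sqrt_sq, hη0] using h2
  have tM : Filter.Tendsto (fun n => ‖M' (φ n) - M‖) Filter.atTop (nhds 0) :=
    tendsto_iff_norm_sub_tendsto_zero.1 hlim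
  have tall : Filter.Tendsto (fun n => A * (t - s) ^ 2 + A * (h (φ n) + η (φ n) + ‖M' (φ n) - M‖))
      Filter.atTop (nhds (A * (t - s) ^ 2)) := by
    have := ((((th.comp hφ.tendsto_atTop).add (tη.comp hφ.tendsto_atTop)).add tM).const_mul A).const_add
      (A * (t - s) ^ 2)
    simpa using this
  exact ge_of_tendsto' tall fun n => hbound (φ n) M hM s t hs hst ht

theorem dist_self_eq (S : SubRiemannianSO3) (x : SO3) : S.dist x x = 0 := by
  have := (S.reach_refl x).dist_le
  simpa using this

/-- Every geodesic locally satisfies the equation of normal extremals. -/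
theorem IsNormalizedBasis.exists_local_multiplier (hb : S.IsNormalizedBasis a b e) {g : ℝ → SO3}
    (hg : S.IsArcLengthGeodesic g) (t₀ : ℝ) : ∃ ε > 0, ∃ M : V3,
      (∀ s t, t₀ - ε < s → s ≤ t → t < t₀ + ε → S.dist (g s) (g t) = ENNReal.ofReal (t - s)) ∧
      (∃ C, HasDisplacement (e 0) (e 1) g (t₀ - ε) (2 * ε) C) ∧
      ∀ t, t₀ - ε < t → t < t₀ + ε → HasDerivAt (fun s => (g s : Mat))
        ((g t : Mat) * ctl (e 0) (e 1) (cov (e 0) (e 1) (g t) M)) t := by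
  obtain ⟨δ, hδ, hdist⟩ := hg t₀
  obtain ⟨C, hC, τ₀, hτ₀, hτ₁, hdisp⟩ := hb.isFrame.exists_displacement_of_dist
  set ε := min (δ / 2) (τ₀ / 2) with hε
  have hε0 : 0 < ε := by positivity
  have hεδ : ε ≤ δ / 2 := min_le_left _ _
  have hετ : ε ≤ τ₀ / 2 := min_le_right _ _
  have hdist' : ∀ s t, t₀ - ε ≤ s → s ≤ t → t ≤ t₀ + ε → S.dist (g s) (g t) = ENNReal.ofReal (t - s) :=
    fun s t hs hst ht => hdist s t (by linarith) hst (by linarith)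
  have H : HasDisplacement (e 0) (e 1) g (t₀ - ε) (2 * ε) C :=
    ⟨hC, by linarith, by linarith, fun s t hs hst ht => hdisp (t - s) (by linarith) (by linarith) _ _
      (hdist' s t hs hst.le (by linarith))⟩
  have hend := hdist' (t₀ - ε) (t₀ - ε + 2 * ε) le_rfl (by linarith) (by linarith)
  rw [show t₀ - ε + 2 * ε - (t₀ - ε) = 2 * ε by ring] at hend
  obtain ⟨M, A, hM⟩ := hb.exists_multiplier_arc H (fun heq => by
    rw [heq, dist_self_eq] at hend
    have := ENNReal.ofReal_eq_zero.1 hend.symm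
    linarith) (fun l hl => by
    have h1 := hl.dist_le
    rw [hend] at h1
    exact (ENNReal.ofReal_le_ofReal_iff hl.nonneg).1 h1)
  refine ⟨ε, hε0, M, fun s t hs hst ht => hdist' s t hs.le hst ht.le, ⟨C, H⟩, fun t ht1 ht2 => ?_⟩
  set F : ℝ → Mat := fun s => (g s : Mat) * ctl (e 0) (e 1) (cov (e 0) (e 1) (g s) M) with hF
  set KF := ‖ctl (e 0) (e 1)‖ * pushBound (e 0) (e 1) * (3 * ‖M‖) * (2 * ‖ctl (e 0) (e 1)‖ + C) with hKF
  have hpb := pushBound_nonneg (e 0) (e 1)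
  have hKF0 : 0 ≤ KF := by positivity
  have hFlip : ∀ s t, s ∈ Set.Icc (t₀ - ε) (t₀ - ε + 2 * ε) → t ∈ Set.Icc (t₀ - ε) (t₀ - ε + 2 * ε) →
      ‖F t - F s‖ ≤ KF * |t - s| := by
    intro s t hs ht
    have h1 := norm_mul_ctl_cov_sub_le (e 0) (e 1) (g t) (g s) M M
    rw [sub_self, norm_zero, add_zero] at h1
    refine h1.trans ?_
    calc _ ≤ ‖ctl (e 0) (e 1)‖ * pushBound (e 0) (e 1) * (3 * ‖M‖ * ((2 * ‖ctl (e 0) (e 1)‖ + C) * |t - s|)) := by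
          gcongr
          exact H.lipschitz hs ht
      _ = _ := by rw [hKF]; ring
  refine hasDerivAt_of_quadratic (δ := min (t - (t₀ - ε)) (t₀ + ε - t)) (C := A + KF)
    (lt_min (by linarith) (by linarith)) fun y hy => ?_
  rw [lt_min_iff, abs_lt, abs_lt] at hy
  change ‖(g y : Mat) - g t - (y - t) • F t‖ ≤ _
  rw [sq_abs]
  rcases lt_trichotomy t y with hty | rfl | hty
  · have h1 := hM t y ht1.le hty (by linarith)
    have : 0 ≤ KF * (y - t) ^ 2 := by positivity
    refine h1.trans ?_
    linarith
  · simp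
  -- For y < t the estimate is anchored at y; the Lipschitz bound for F moves the anchor to t at
  -- quadratic cost.
  · have h1 := hM y t (by linarith) hty (by linarith)
    have h2 := hFlip t y ⟨ht1.le, by linarith⟩ ⟨by linarith, by linarith⟩
    have hid : (g y : Mat) - g t - (y - t) • F t =
        -((g t : Mat) - g y - (t - y) • F y) - (t - y) • (F y - F t) := by
      rw [smul_sub, show y - t = -(t - y) by ring, neg_smul]
      abel
    rw [hid]
    calc _ ≤ A * (t - y) ^ 2 + (t - y) * (KF * |y - t|) := by
          refine (norm_sub_le _ _).trans (add_le_add ?_ ?_)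
          · rw [norm_neg]; exact h1
          · rw [norm_smul, Real.norm_of_nonneg (by linarith)]
            gcongr
      _ = _ := by rw [abs_of_neg (by linarith)]; ring

end SubRiemannianSO3

/-! ### Momenta, smoothness and unit speed. -/

theorem cov_re (e₁ e₂ : so3) (X : Mat) (x : V3) :
    (cov e₁ e₂ X x).re = ⟪x, vee (X * (e₁ : Mat) * Xᵀ)⟫_ℝ := by
  have := inner_cov e₁ e₂ X x 1
  rw [push_apply, SubRiemannianSO3.ctl_one] at this
  rw [← this, Complex.inner]
  simp

theorem cov_im (e₁ e₂ : so3) (X : Mat) (x : V3) :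
    (cov e₁ e₂ X x).im = ⟪x, vee (X * (e₂ : Mat) * Xᵀ)⟫_ℝ := by
  have := inner_cov e₁ e₂ X x Complex.I
  rw [push_apply, SubRiemannianSO3.ctl_I] at this
  rw [← this, Complex.inner]
  simp

/-- Transposition as a continuous linear map. -/
noncomputable def transposeCLM : Mat →L[ℝ] Mat :=
  LinearMap.toContinuousLinearMap (Matrix.transposeLinearEquiv (Fin 3) (Fin 3) ℝ ℝ).toLinearMap

/-- The momentum component `⟨x, Ad_{g(t)} A⟩` along a curve. -/
noncomputable def momentum (g : ℝ → SO3) (x : V3) (A : Mat) (t : ℝ) : ℝ :=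
  ⟪x, vee ((g t : Mat) * A * (g t : Mat)ᵀ)⟫_ℝ

/-- Euler's equation in the moving frame: the derivative of Ad_g A is Ad_g [u, A]. -/
theorem hasDerivAt_momentum {e₁ e₂ : so3} {g : ℝ → SO3} {t : ℝ} {u : ℂ}
    (hg : HasDerivAt (fun s => (g s : Mat)) ((g t : Mat) * ctl e₁ e₂ u) t) (x : V3) (A : Mat) :
    HasDerivAt (momentum g x A) (momentum g x (ctl e₁ e₂ u * A - A * ctl e₁ e₂ u) t) t := by
  have h1 : HasDerivAt (fun s => (g s : Mat)ᵀ) ((g t : Mat) * ctl e₁ e₂ u)ᵀ t :=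
    transposeCLM.hasFDerivAt.comp_hasDerivAt t hg
  have h2 := (hg.mul_const A).mul h1
  let Λ : Mat →L[ℝ] ℝ := (innerSL ℝ x) ∘L vee
  have h3 := Λ.hasFDerivAt.comp_hasDerivAt t h2
  have e : (g t : Mat) * ctl e₁ e₂ u * A * (g t : Mat)ᵀ + (g t : Mat) * A * ((g t : Mat) * ctl e₁ e₂ u)ᵀ =
      (g t : Mat) * (ctl e₁ e₂ u * A - A * ctl e₁ e₂ u) * (g t : Mat)ᵀ := by
    rw [Matrix.transpose_mul, transpose_ctl]
    noncomm_ring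
  rw [e] at h3
  exact h3

theorem contDiffAt_momentum {n : WithTop ℕ∞} {g : ℝ → SO3} {t : ℝ}
    (hg : ContDiffAt ℝ n (fun s => (g s : Mat)) t) (x : V3) (A : Mat) :
    ContDiffAt ℝ n (momentum g x A) t := by
  let Λ : Mat →L[ℝ] ℝ := (innerSL ℝ x) ∘L vee
  have h1 : ContDiffAt ℝ n (fun s => (g s : Mat)ᵀ) t := transposeCLM.contDiff.contDiffAt.comp t hg
  exact Λ.contDiff.contDiffAt.comp t ((hg.mul contDiffAt_const).mul h1)

theorem momentum_smul (g : ℝ → SO3) (x : V3) (c : ℝ) (A : Mat) (t : ℝ) :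
    momentum g x (c • A) t = c * momentum g x A t := by
  simp [momentum, real_inner_smul_right]

theorem momentum_sub (g : ℝ → SO3) (x : V3) (A B : Mat) (t : ℝ) :
    momentum g x (A - B) t = momentum g x A t - momentum g x B t := by
  simp [momentum, mul_sub, sub_mul, map_sub, inner_sub_right]

namespace SubRiemannianSO3

variable {S : SubRiemannianSO3} {a b : ℝ} {e : Module.Basis (Fin 3) ℝ so3}

theorem bracket_ctl₀ (hb : S.IsNormalizedBasis a b e) (w : ℂ) :
    ctl (e 0) (e 1) w * (e 0 : Mat) - (e 0 : Mat) * ctl (e 0) (e 1) w =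
      (-(w.im * (a * b))) • (e 2 : Mat) := by
  rw [neg_smul, mul_smul, ← hb.coe_bracket₁₂, ctl_apply]
  simp only [add_mul, mul_add, smul_sub, smul_mul_assoc, mul_smul_comm]
  abel

theorem bracket_ctl₁ (hb : S.IsNormalizedBasis a b e) (w : ℂ) :
    ctl (e 0) (e 1) w * (e 1 : Mat) - (e 1 : Mat) * ctl (e 0) (e 1) w =
      (w.re * (a * b)) • (e 2 : Mat) := by
  rw [mul_smul, ← hb.coe_bracket₁₂, ctl_apply]
  simp only [add_mul, mul_add, smul_sub, smul_mul_assoc, mul_smul_comm]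
  abel

/-- `u` is the control of `g`, and is locally given by a constant multiplier. -/
structure IsNormalControl (e₁ e₂ : so3) (g : ℝ → SO3) (u : ℝ → ℂ) : Prop where
  hasDerivAt : ∀ t, HasDerivAt (fun s => (g s : Mat)) ((g t : Mat) * ctl e₁ e₂ (u t)) t
  exists_multiplier : ∀ t₀, ∃ M : V3, ∀ᶠ t in nhds t₀, u t = cov e₁ e₂ (g t) M

/-- The multipliers chosen around different times are not compared. The controls they define agree
where both represent g', because `ctl` is injective. -/
theorem IsNormalizedBasis.exists_control (hb : S.IsNormalizedBasis a b e) {g : ℝ → SO3}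
    (hg : S.IsArcLengthGeodesic g) : ∃ u : ℝ → ℂ, IsNormalControl (e 0) (e 1) g u := by
  choose ε hε M _ _ hM using fun t₀ => hb.exists_local_multiplier hg t₀
  refine ⟨fun t => cov (e 0) (e 1) (g t) (M t), fun t => hM t t (by linarith [hε t]) (by linarith [hε t]), ?_⟩
  intro t₀
  refine ⟨M t₀, ?_⟩
  filter_upwards [Ioo_mem_nhds (show t₀ - ε t₀ < t₀ by linarith [hε t₀])
    (show t₀ < t₀ + ε t₀ by linarith [hε t₀])] with t ht
  have h1 := (hM t t (by linarith [hε t]) (by linarith [hε t])).unique (hM t₀ t ht.1 ht.2)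
  have h2 := congrArg (fun X => (g t : Mat)ᵀ * X) h1
  simp only [← mul_assoc, SO3.transpose_mul, one_mul] at h2
  exact hb.isFrame.ctl_injective h2

theorem IsNormalControl.contDiffAt_control {e₁ e₂ : so3} {g : ℝ → SO3} {u : ℝ → ℂ}
    (h : IsNormalControl e₁ e₂ g u) {n : WithTop ℕ∞} (hg : ContDiff ℝ n (fun s => (g s : Mat))) :
    ContDiff ℝ n u := by
  rw [contDiff_iff_contDiffAt]
  intro t₀
  obtain ⟨M, hM⟩ := h.exists_multiplier t₀
  have h1 : ContDiffAt ℝ n (fun t => momentum g M (e₁ : Mat) t • (1 : ℂ) + momentum g M (e₂ : Mat) t • Complex.I) t₀ :=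
    ((contDiffAt_momentum hg.contDiffAt M _).smul contDiffAt_const).add
      ((contDiffAt_momentum hg.contDiffAt M _).smul contDiffAt_const)
  refine h1.congr_of_eventuallyEq (hM.mono fun t ht => ?_)
  rw [ht]
  apply Complex.ext
  · rw [cov_re]; simp [momentum]
  · rw [cov_im]; simp [momentum]

/-- Bootstrapping: with a locally constant multiplier the control is as smooth as g, and g' = g u
then gains one derivative. -/
theorem IsNormalControl.contDiff {e₁ e₂ : so3} {g : ℝ → SO3} {u : ℝ → ℂ}
    (h : IsNormalControl e₁ e₂ g u) : ContDiff ℝ ∞ (fun s => (g s : Mat)) := by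
  rw [contDiff_infty]
  intro n
  induction n with
  | zero =>
    exact contDiff_zero.2 (continuous_iff_continuousAt.2 fun t => (h.hasDerivAt t).continuousAt)
  | succ n ih =>
    push_cast
    rw [contDiff_succ_iff_deriv]
    refine ⟨fun t => (h.hasDerivAt t).differentiableAt, by simp, ?_⟩
    have : deriv (fun s => (g s : Mat)) = fun t => (g t : Mat) * ctl e₁ e₂ (u t) :=
      funext fun t => (h.hasDerivAt t).deriv
    rw [this]
    exact ih.mul ((ctl e₁ e₂).contDiff.comp (h.contDiffAt_control ih))

theorem IsNormalControl.contDiff_control {e₁ e₂ : so3} {g : ℝ → SO3} {u : ℝ → ℂ}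
    (h : IsNormalControl e₁ e₂ g u) : ContDiff ℝ ∞ u := h.contDiffAt_control h.contDiff

theorem IsFrame.reach_of_control {e₁ e₂ : so3} (hF : S.IsFrame e₁ e₂) {g : ℝ → SO3} {u : ℝ → ℂ}
    (h : IsNormalControl e₁ e₂ g u) {s t : ℝ} (hst : s ≤ t) :
    S.Reach (g s) (g t) (∫ r in s..t, ‖u r‖) := by
  choose v hv hvn using fun r => hF.exists_vector (u (s + r))
  have hsm : ContDiff ℝ ∞ (fun r => (g (s + r) : Mat)) :=
    h.contDiff.comp (contDiff_const.add contDiff_id)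
  refine ⟨t - s, fun r => g (s + r), v, ⟨by linarith, hsm.continuous.continuousOn, ∅, ?_, ?_⟩,
    by simp, by simp, ?_⟩
  · intro _ _ _ _ _ _
    exact contDiffOn_mat_iff.1 hsm.contDiffOn
  · intro r _ _
    have h1 := (h.hasDerivAt (s + r)).comp_const_add s r
    change HasDerivAt (fun r => (g (s + r) : Mat)) ((g (s + r) : Mat) * ((v r : so3) : Mat)) r
    rw [hv]
    exact h1
  · simp only [hvn]
    rw [intervalIntegral.integral_comp_add_left (fun r => ‖u r‖) s]
    simp

/-- The control is the limit of difference quotients of a left inverse of `ctl` applied to g(t₀)ᵀ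
g(t). The displacement estimate bounds each of them by 1 + O(t − t₀). -/
theorem IsNormalizedBasis.norm_control_le (hb : S.IsNormalizedBasis a b e) {g : ℝ → SO3}
    (hg : S.IsArcLengthGeodesic g) {u : ℝ → ℂ} (h : IsNormalControl (e 0) (e 1) g u) (t₀ : ℝ) :
    ‖u t₀‖ ≤ 1 := by
  obtain ⟨ε, hε, -, -, ⟨C, H⟩, -⟩ := hb.exists_local_multiplier hg t₀
  obtain ⟨ζ₀, hζ₀⟩ := LinearMap.exists_leftInverse_of_injective (ctl (e 0) (e 1) : ℂ →ₗ[ℝ] Mat)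
    (LinearMap.ker_eq_bot.2 hb.isFrame.ctl_injective)
  let ζ : Mat →L[ℝ] ℂ := LinearMap.toContinuousLinearMap ζ₀
  have hζ : ∀ w, ζ (ctl (e 0) (e 1) w) = w := fun w => LinearMap.congr_fun hζ₀ w
  have h1 := ζ.hasFDerivAt.comp_hasDerivAt t₀ ((h.hasDerivAt t₀).const_mul ((g t₀ : Mat)ᵀ))
  rw [← mul_assoc, SO3.transpose_mul, one_mul, hζ] at h1
  have h2 := hasDerivWithinAt_iff_tendsto_slope.1 (h1.hasDerivWithinAt (s := Set.Ioi t₀))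
  rw [Set.sdiff_singleton_eq_self (by simp)] at h2
  have h3 : Filter.Tendsto (fun t => 1 + (t - t₀) + ‖ζ‖ * C * (t - t₀)) (nhdsWithin t₀ (Set.Ioi t₀)) (nhds 1) := by
    have : Continuous fun t : ℝ => 1 + (t - t₀) + ‖ζ‖ * C * (t - t₀) := by fun_prop
    simpa using (this.tendsto t₀).mono_left nhdsWithin_le_nhds
  refine le_of_tendsto_of_tendsto h2.norm h3 ?_
  filter_upwards [Ioo_mem_nhdsGT (show t₀ < t₀ + ε by linarith)] with t ht
  obtain ⟨w, hw, hd, -⟩ := H.exists_disp t₀ t (by linarith) ht.1 (by linarith [ht.2])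
  have hτ : 0 < t - t₀ := by linarith [ht.1]
  have e1 : ζ ((g t₀ : Mat)ᵀ * g t) - ζ ((g t₀ : Mat)ᵀ * g t₀) =
      ζ ((g t₀ : Mat)ᵀ * g t - 1 - ctl (e 0) (e 1) w) + w := by
    rw [SO3.transpose_mul, map_sub, map_sub, hζ]; ring
  simp only [slope_def_module, Function.comp_apply]
  rw [e1, norm_smul, norm_inv, Real.norm_of_nonneg hτ.le, inv_mul_le_iff₀ hτ]
  calc _ ≤ ‖ζ‖ * (C * (t - t₀) ^ 2) + ((t - t₀) + (t - t₀) ^ 2) := by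
        refine (norm_add_le _ _).trans (add_le_add ((ζ.le_opNorm _).trans ?_) hw)
        gcongr
    _ = _ := by ring

/-- If the speed were below 1 at one time, g itself would be a horizontal path shorter than the
distance of its endpoints. -/
theorem IsNormalizedBasis.norm_control_eq (hb : S.IsNormalizedBasis a b e) {g : ℝ → SO3}
    (hg : S.IsArcLengthGeodesic g) {u : ℝ → ℂ} (h : IsNormalControl (e 0) (e 1) g u) (t₀ : ℝ) :
    ‖u t₀‖ = 1 := by
  refine le_antisymm (hb.norm_control_le hg h t₀) ?_
  by_contra hlt
  push Not at hlt
  obtain ⟨ε, hε, -, hdist, -, -⟩ := hb.exists_local_multiplier hg t₀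
  have hu := h.contDiff_control.continuous
  have h1 := (hb.isFrame.reach_of_control h (show t₀ ≤ t₀ + ε / 2 by linarith)).dist_le
  rw [hdist t₀ (t₀ + ε / 2) (by linarith) (by linarith) (by linarith)] at h1
  have h2 := (ENNReal.ofReal_le_ofReal_iff
    (hb.isFrame.reach_of_control h (show t₀ ≤ t₀ + ε / 2 by linarith)).nonneg).1 h1
  have h3 : 0 < ∫ r in t₀..(t₀ + ε / 2), (1 - ‖u r‖) :=
    intervalIntegral.integral_pos (by linarith) (by fun_prop)
      (fun r _ => sub_nonneg.2 (hb.norm_control_le hg h r)) ⟨t₀, ⟨le_rfl, by linarith⟩, by linarith⟩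
  rw [intervalIntegral.integral_sub (by simp) (hu.norm.intervalIntegrable _ _)] at h3
  simp at h3
  linarith

/-- Euler's equations make u rotate with angular velocity ab m₃, and m₃' = (a/b − b/a) cos ξ sin ξ.
The angle ξ is obtained by integrating this velocity. -/
theorem IsNormalizedBasis.exists_angle (hb : S.IsNormalizedBasis a b e) {g : ℝ → SO3}
    (hg : S.IsArcLengthGeodesic g) : ∃ ξ : ℝ → ℝ, ContDiff ℝ ∞ ξ ∧
      (∀ t, HasControlAt g (Real.cos (ξ t) • e 0 + Real.sin (ξ t) • e 1) t) ∧
      ∀ t, deriv (deriv ξ) t = (a ^ 2 - b ^ 2) / 2 * Real.sin (2 * ξ t) := by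
  obtain ⟨u, h⟩ := hb.exists_control hg
  have hnorm := hb.norm_control_eq hg h
  have hu := h.contDiff_control
  have ha := hb.pos
  have hbp := hb.pos'
  have hlocal : ∀ t₀, ∃ p : ℝ → ℝ, (∀ᶠ t in nhds t₀, HasDerivAt u (((a * b * p t : ℝ) : ℂ) * Complex.I * u t) t) ∧
      HasDerivAt p ((a / b - b / a) * ((u t₀).re * (u t₀).im)) t₀ := by
    intro t₀
    obtain ⟨M, hM⟩ := h.exists_multiplier t₀
    have hre : ∀ t, u t = cov (e 0) (e 1) (g t) M → (u t).re = momentum g M (e 0 : Mat) t ∧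
        (u t).im = momentum g M (e 1 : Mat) t := fun t ht => by
      rw [ht, cov_re, cov_im]; exact ⟨rfl, rfl⟩
    refine ⟨momentum g M (e 2 : Mat), ?_, ?_⟩
    · filter_upwards [hM.eventually_nhds] with t ht
      have d0 := hasDerivAt_momentum (h.hasDerivAt t) M (e 0 : Mat)
      have d1 := hasDerivAt_momentum (h.hasDerivAt t) M (e 1 : Mat)
      rw [bracket_ctl₀ hb, momentum_smul] at d0
      rw [bracket_ctl₁ hb, momentum_smul] at d1
      have d := (d0.smul_const (1 : ℂ)).add (d1.smul_const Complex.I)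
      refine (d.congr_of_eventuallyEq (ht.mono fun s hs => ?_)).congr_deriv ?_
      · obtain ⟨h1, h2⟩ := hre s hs
        apply Complex.ext
        · simp [h1]
        · simp [h2]
      · apply Complex.ext
        · simp; ring
        · simp; ring
    · have d2 := hasDerivAt_momentum (h.hasDerivAt t₀) M (e 2 : Mat)
      obtain ⟨h1, h2⟩ := hre t₀ hM.self_of_nhds
      rw [bracket_ctl hb, momentum_sub, momentum_smul, momentum_smul, ← h1, ← h2] at d2
      exact d2.congr_deriv (by ring)
  -- The angular velocity Im(ū u') is defined from u alone, so the local third momenta need not be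
  -- glued.
  set κ : ℝ → ℝ := fun t => ((starRingEnd ℂ) (u t) * deriv u t).im with hκ
  have hκp : ∀ (t q : ℝ), HasDerivAt u ((q : ℂ) * Complex.I * u t) t → κ t = q := by
    intro t q hq
    have h1 : (starRingEnd ℂ) (u t) * u t = 1 := by
      rw [mul_comm, Complex.mul_conj, Complex.normSq_eq_norm_sq, hnorm]; simp
    simp only [hκ]
    rw [hq.deriv, show (starRingEnd ℂ) (u t) * ((q : ℂ) * Complex.I * u t) =
      (q : ℂ) * Complex.I * ((starRingEnd ℂ) (u t) * u t) by ring, h1]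
    simp
  have huκ : ∀ t, HasDerivAt u ((κ t : ℂ) * Complex.I * u t) t := by
    intro t
    obtain ⟨p, hp, -⟩ := hlocal t
    have := hp.self_of_nhds
    rwa [← hκp t _ this] at this
  have hκs : ContDiff ℝ ∞ κ := by
    have h1 : ContDiff ℝ ∞ (deriv u) := (contDiff_infty_iff_deriv.1 hu).2
    have h2 : ContDiff ℝ ∞ fun t => (starRingEnd ℂ) (u t) := Complex.conjCLE.contDiff.comp hu
    exact Complex.imCLM.contDiff.comp (h2.mul h1)
  set ξ : ℝ → ℝ := fun t => (u 0).arg + ∫ r in (0 : ℝ)..t, κ r with hξ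
  have hξd : ∀ t, HasDerivAt ξ (κ t) t := fun t =>
    (intervalIntegral.integral_hasDerivAt_right (hκs.continuous.intervalIntegrable _ _)
      (hκs.continuous.stronglyMeasurableAtFilter _ _) hκs.continuous.continuousAt).const_add _
  have hdξ : deriv ξ = κ := funext fun t => (hξd t).deriv
  have hξu : ∀ t, u t = Complex.exp (ξ t * Complex.I) := by
    -- The lift is right because u e^{−iξ} has zero derivative and equals 1 at time 0.
    set f : ℝ → ℂ := fun t => u t * Complex.exp (-(ξ t * Complex.I)) with hf
    have hfd : ∀ t, HasDerivAt f 0 t := by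
      intro t
      have h1 : HasDerivAt (fun t => -((ξ t : ℂ) * Complex.I)) (-((κ t : ℂ) * Complex.I)) t :=
        (((hξd t).ofReal_comp).mul_const Complex.I).neg
      refine ((huκ t).mul h1.cexp).congr_deriv ?_
      ring
    have hconst : ∀ t, f t = f 0 := fun t =>
      is_const_of_deriv_eq_zero (fun t => (hfd t).differentiableAt) (fun t => (hfd t).deriv) t 0
    intro t
    have h0 : f 0 = 1 := by
      have h1 : ξ 0 = (u 0).arg := by simp [hξ]
      have h2 := Complex.norm_mul_exp_arg_mul_I (u 0)
      rw [hnorm] at h2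
      simp only [hf, h1]
      nth_rewrite 1 [← h2]
      rw [Complex.ofReal_one, one_mul, ← Complex.exp_add]
      simp
    have h1 := hconst t
    rw [h0] at h1
    simp only [hf, Complex.exp_neg] at h1
    exact (mul_inv_eq_one₀ (Complex.exp_ne_zero _)).1 h1
  have hcos : ∀ t, (u t).re = Real.cos (ξ t) := fun t => by
    rw [hξu, Complex.exp_ofReal_mul_I_re]
  have hsin : ∀ t, (u t).im = Real.sin (ξ t) := fun t => by
    rw [hξu, Complex.exp_ofReal_mul_I_im]
  refine ⟨ξ, ?_, fun t => ?_, fun t => ?_⟩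
  · rw [contDiff_infty_iff_deriv, hdξ]
    exact ⟨fun t => (hξd t).differentiableAt, hκs⟩
  · rw [← hcos, ← hsin]
    exact h.hasDerivAt t
  · rw [hdξ]
    obtain ⟨p, hp, hpd⟩ := hlocal t
    have h1 : κ =ᶠ[nhds t] fun s => a * b * p s := hp.mono fun s hs => hκp s _ hs
    rw [h1.deriv_eq, (hpd.const_mul (a * b)).deriv, hcos, hsin, Real.sin_two_mul]
    field_simp

end SubRiemannianSO3

/-! ### The Lie algebra so(3) and its generating subspaces. -/

/-- The linear isomorphism of `so(3)` and `ℝ³`. -/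
noncomputable def so3Equiv : so3 ≃ₗ[ℝ] V3 :=
  LinearEquiv.ofBijective
    { toFun := fun x : so3 => vee (x : Mat)
      map_add' := fun x y => map_add vee (x : Mat) (y : Mat)
      map_smul' := fun c x => map_smul vee c (x : Mat) } <| by
    constructor
    · intro x y hxy
      exact Subtype.ext (vee_inj_of_skew (so3_transpose x) (so3_transpose y) hxy)
    · intro x
      exact ⟨⟨hat x, (LieAlgebra.Orthogonal.mem_so _ _ _).2 (hat_transpose x)⟩, vee_hat x⟩

theorem finrank_so3 : Module.finrank ℝ so3 = 3 := by
  rw [so3Equiv.finrank_eq]; simp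

theorem coe_eq_hat (x : so3) : (x : Mat) = hat (so3Equiv x) :=
  vee_inj_of_skew (so3_transpose x) (hat_transpose _) (by rw [vee_hat]; rfl)

theorem inner_V3 (x y : V3) : ⟪x, y⟫_ℝ = x 0 * y 0 + x 1 * y 1 + x 2 * y 2 := by
  simp [PiLp.inner_apply, Fin.sum_univ_three]; ring

/-- The triple product formula for the cross product, checked entrywise. -/
theorem bracket_bracket (x y : so3) : ⁅⁅x, y⁆, x⁆ =
    ⟪so3Equiv x, so3Equiv x⟫_ℝ • y - ⟪so3Equiv x, so3Equiv y⟫_ℝ • x := by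
  apply Subtype.ext
  change ((x : Mat) * y - y * x) * x - x * ((x : Mat) * y - y * x) = _ • (y : Mat) - _ • (x : Mat)
  rw [inner_V3, inner_V3, coe_eq_hat x, coe_eq_hat y]
  generalize so3Equiv x = v
  generalize so3Equiv y = w
  ext i j
  fin_cases i <;> fin_cases j <;>
    simp [hat] <;> ring

theorem inner_bracket_self (x y : so3) : ⟪so3Equiv ⁅x, y⁆, so3Equiv x⟫_ℝ = 0 ∧
    ⟪so3Equiv ⁅x, y⁆, so3Equiv y⟫_ℝ = 0 :=
  SubRiemannianSO3.inner_vee_eq_zero_of_bracket (A := x) (B := y) (C := ⁅x, y⁆) one_ne_zero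
    (by rw [one_smul]; rfl)

theorem linearIndependent_so3_of_orthogonal {ι : Type*} {x : ι → so3} (h0 : ∀ i, x i ≠ 0)
    (h : Pairwise fun i j => ⟪so3Equiv (x i), so3Equiv (x j)⟫_ℝ = 0) : LinearIndependent ℝ x := by
  have h1 : LinearIndependent ℝ (fun i => so3Equiv (x i)) :=
    linearIndependent_of_ne_zero_of_inner_eq_zero (fun i => by simpa using h0 i) h
  exact LinearIndependent.of_comp so3Equiv.toLinearMap h1

theorem bracket_ne_zero {x y : so3} (h : LinearIndependent ℝ ![x, y]) : ⁅x, y⁆ ≠ 0 := by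
  intro h0
  have h1 := bracket_bracket x y
  rw [h0, zero_lie] at h1
  rw [LinearIndependent.pair_iff] at h
  have h2 := h (-⟪so3Equiv x, so3Equiv y⟫_ℝ) ⟪so3Equiv x, so3Equiv x⟫_ℝ (by rw [h1, neg_smul]; abel)
  have h3 : x = 0 := by simpa using h2.2
  have h4 := h 1 0 (by simp [h3])
  exact one_ne_zero h4.1

/-- For a basis x, y of the plane, [x, y] is nonzero and orthogonal to the plane, so the three
vectors span so(3). -/
theorem generates_of_finrank_eq_two {p : Submodule ℝ so3} (hp : Module.finrank ℝ p = 2) : Generates p := by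
  let f := Module.finBasisOfFinrankEq ℝ p hp
  let x : so3 := ((f 0 : p) : so3)
  let y : so3 := ((f 1 : p) : so3)
  have hli : LinearIndependent ℝ ![x, y] := by
    have h1 : LinearIndependent ℝ (fun i => (f i : so3)) :=
      f.linearIndependent.map' p.subtype p.ker_subtype
    convert h1 using 1
    ext i : 1
    fin_cases i <;> rfl
  have hb := bracket_ne_zero hli
  have hli3 : LinearIndependent ℝ ![⁅x, y⁆, x, y] := by
    refine linearIndependent_finCons.2 ⟨hli, fun hmem => ?_⟩
    rw [Matrix.range_cons, Matrix.range_cons, Matrix.range_empty, Set.union_empty, Set.singleton_union,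
      Submodule.mem_span_pair] at hmem
    obtain ⟨c, d, hcd⟩ := hmem
    obtain ⟨h1, h2⟩ := inner_bracket_self x y
    have h3 : ⟪so3Equiv ⁅x, y⁆, so3Equiv ⁅x, y⁆⟫_ℝ = 0 := by
      nth_rewrite 2 [← hcd]
      rw [map_add, map_smul, map_smul, inner_add_right, real_inner_smul_right, real_inner_smul_right, h1, h2]
      simp
    exact hb (by simpa using inner_self_eq_zero.1 h3)
  have htop := hli3.span_eq_top_of_card_eq_finrank (by rw [finrank_so3]; rfl)
  rw [Generates, ← LieSubalgebra.toSubmodule_inj, LieSubalgebra.top_toSubmodule, eq_top_iff, ← htop,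
    Submodule.span_le]
  have mx : x ∈ LieSubalgebra.lieSpan ℝ so3 (p : Set so3) := LieSubalgebra.subset_lieSpan (f 0).2
  have my : y ∈ LieSubalgebra.lieSpan ℝ so3 (p : Set so3) := LieSubalgebra.subset_lieSpan (f 1).2
  rintro _ ⟨i, rfl⟩
  fin_cases i
  · exact LieSubalgebra.lie_mem _ mx my
  · exact mx
  · exact my

/-- In dimension at most one all brackets vanish, so the subspace is already a subalgebra and
generates only itself. -/
theorem finrank_eq_two_of_generates {p : Submodule ℝ so3} (hp : p ≠ ⊤) (hg : Generates p) :
    Module.finrank ℝ p = 2 := by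
  have h3 := Submodule.finrank_lt hp
  rw [finrank_so3] at h3
  by_contra h2
  have h1 : Module.finrank ℝ p ≤ 1 := by omega
  obtain ⟨v, hv⟩ := finrank_le_one_iff.1 h1
  let q : LieSubalgebra ℝ so3 :=
    { p with
      lie_mem' := by
        intro x y hx hy
        obtain ⟨c, hc⟩ := hv ⟨x, hx⟩
        obtain ⟨d, hd⟩ := hv ⟨y, hy⟩
        have hx' : x = c • (v : so3) := (congrArg Subtype.val hc).symm
        have hy' : y = d • (v : so3) := (congrArg Subtype.val hd).symm
        have : ⁅x, y⁆ = 0 := by rw [hx', hy', smul_lie, lie_smul, lie_self, smul_zero, smul_zero]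
        change ⁅x, y⁆ ∈ p
        rw [this]
        exact p.zero_mem }
  have hle : LieSubalgebra.lieSpan ℝ so3 (p : Set so3) ≤ q := LieSubalgebra.lieSpan_le.2 fun x hx => hx
  rw [hg] at hle
  exact hp (eq_top_iff.2 fun x _ => hle (LieSubalgebra.mem_top x))

/-! ### Normalized bases and rescaling. -/

namespace SubRiemannianSO3

variable {S : SubRiemannianSO3} {a b : ℝ} {e : Module.Basis (Fin 3) ℝ so3}

theorem exists_orthonormal (S : SubRiemannianSO3) : ∃ x y : S.p, S.ip x x = 1 ∧ S.ip y y = 1 ∧ S.ip x y = 0 := by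
  let f := Module.finBasisOfFinrankEq ℝ S.p (finrank_eq_two_of_generates S.proper S.generates)
  have key : ∀ v : S.p, v ≠ 0 → ∀ r : ℝ, r = (Real.sqrt (S.ip v v))⁻¹ → r ≠ 0 ∧ S.ip (r • v) (r • v) = 1 := by
    rintro v hv r rfl
    have h := S.ip_pos v hv
    have h1 := Real.sqrt_pos.2 h
    refine ⟨by positivity, ?_⟩
    simp only [map_smul, LinearMap.smul_apply, smul_eq_mul]
    have := Real.mul_self_sqrt h.le
    field_simp
    rw [sq, this]
  obtain ⟨hr, hx⟩ := key (f 0) (f.ne_zero 0) _ rfl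
  set r := (Real.sqrt (S.ip (f 0) (f 0)))⁻¹
  set x := r • f 0 with hxdef
  have hy0 : f 1 - S.ip (f 1) x • x ≠ 0 := by
    intro h
    have h1 := congrArg f.repr h
    have h2 := DFunLike.congr_fun h1 1
    simp [hxdef] at h2
  obtain ⟨hs, hy⟩ := key _ hy0 _ rfl
  refine ⟨x, _, hx, hy, ?_⟩
  have h1 := S.ip_symm (f 1) x
  simp only [map_smul, map_sub, smul_eq_mul, hx, h1]
  ring

/-- Two forms live on `p`: the given scalar product and the restricted Euclidean one. A basis
orthonormal for the first and orthogonal for the second, completed by the rescaled bracket, is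
normalized with b = |e₁| and a = |e₂|. For instance [e₃, e₁] = |e₁|²/(ab) e₂ = (b/a) e₂. -/
theorem exists_isNormalizedBasis (S : SubRiemannianSO3) :
    ∃ (a b : ℝ) (e : Module.Basis (Fin 3) ℝ so3), S.IsNormalizedBasis a b e := by
  obtain ⟨f₁, f₂, h11, h22, h12⟩ := S.exists_orthonormal
  have h21 : S.ip f₂ f₁ = 0 := by rw [S.ip_symm, h12]
  set α := ⟪so3Equiv f₁, so3Equiv f₁⟫_ℝ with hα
  set β := ⟪so3Equiv f₁, so3Equiv f₂⟫_ℝ with hβ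
  set γ := ⟪so3Equiv f₂, so3Equiv f₂⟫_ℝ with hγ
  have hβ' : ⟪so3Equiv f₂, so3Equiv f₁⟫_ℝ = β := real_inner_comm _ _
  set z : ℂ := ⟨(α - γ) / 2, β⟩ with hz
  set θ := z.arg / 2 with hθ
  set c := Real.cos θ with hc
  set s := Real.sin θ with hs
  have hcs : c ^ 2 + s ^ 2 = 1 := Real.cos_sq_add_sin_sq θ
  have hzc : ‖z‖ * (c ^ 2 - s ^ 2) = (α - γ) / 2 := by
    rw [hc, hs, ← Real.cos_two_mul', hθ, mul_div_cancel₀ _ two_ne_zero]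
    exact Complex.norm_mul_cos_arg z
  have hzs : ‖z‖ * (2 * s * c) = β := by
    rw [hc, hs, ← Real.sin_two_mul, hθ, mul_div_cancel₀ _ two_ne_zero]
    exact Complex.norm_mul_sin_arg z
  set x : S.p := c • f₁ + s • f₂ with hx
  set y : S.p := -s • f₁ + c • f₂ with hy
  have ixx : S.ip x x = 1 := by
    simp only [hx, map_add, map_smul, LinearMap.add_apply, LinearMap.smul_apply, smul_eq_mul, h11, h22, h12, h21]
    linarith
  have iyy : S.ip y y = 1 := by
    simp only [hy, map_add, map_smul, LinearMap.add_apply, LinearMap.smul_apply, smul_eq_mul, h11, h22, h12, h21]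
    linarith
  have ixy : S.ip x y = 0 := by
    simp only [hx, hy, map_add, map_smul, LinearMap.add_apply, LinearMap.smul_apply, smul_eq_mul, h11, h22, h12, h21]
    ring
  have hx' : so3Equiv (x : so3) = c • so3Equiv f₁ + s • so3Equiv f₂ := by
    rw [← map_smul, ← map_smul, ← map_add]; rfl
  have hy' : so3Equiv (y : so3) = -s • so3Equiv f₁ + c • so3Equiv f₂ := by
    rw [← map_smul, ← map_smul, ← map_add]; rfl
  have kxy : ⟪so3Equiv (x : so3), so3Equiv (y : so3)⟫_ℝ = 0 := by
    rw [hx', hy']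
    simp only [inner_add_left, inner_add_right, real_inner_smul_left, real_inner_smul_right, ← hα, ← hβ, ← hγ, hβ']
    linear_combination (c ^ 2 - s ^ 2) * (-hzs) + (2 * s * c) * hzc
  have kyx : ⟪so3Equiv (y : so3), so3Equiv (x : so3)⟫_ℝ = 0 := by rw [real_inner_comm, kxy]
  have kdiff : ⟪so3Equiv (y : so3), so3Equiv (y : so3)⟫_ℝ ≤ ⟪so3Equiv (x : so3), so3Equiv (x : so3)⟫_ℝ := by
    rw [← sub_nonneg]
    have : ⟪so3Equiv (x : so3), so3Equiv (x : so3)⟫_ℝ - ⟪so3Equiv (y : so3), so3Equiv (y : so3)⟫_ℝ =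
        2 * ‖z‖ * (c ^ 2 + s ^ 2) ^ 2 := by
      rw [hx', hy']
      simp only [inner_add_left, inner_add_right, real_inner_smul_left, real_inner_smul_right, ← hα, ← hβ, ← hγ, hβ']
      linear_combination (c ^ 2 - s ^ 2) * (-2 * hzc) + (2 * s * c) * (-2 * hzs)
    rw [this]
    positivity
  have hx0 : (x : so3) ≠ 0 := by
    intro h
    have : x = 0 := Subtype.ext h
    rw [this] at ixx
    simp at ixx
  have hy0 : (y : so3) ≠ 0 := by
    intro h
    have : y = 0 := Subtype.ext h
    rw [this] at iyy
    simp at iyy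
  set b := ‖so3Equiv (x : so3)‖ with hb
  set a := ‖so3Equiv (y : so3)‖ with ha
  have hb0 : 0 < b := norm_pos_iff.2 (by simpa using hx0)
  have ha0 : 0 < a := norm_pos_iff.2 (by simpa using hy0)
  rw [real_inner_self_eq_norm_sq, real_inner_self_eq_norm_sq, ← hb, ← ha] at kdiff
  have hab : a ≤ b := le_of_sq_le_sq kdiff hb0.le
  have hli2 : LinearIndependent ℝ ![(x : so3), (y : so3)] := by
    refine linearIndependent_so3_of_orthogonal (fun i => ?_) fun i j hij => ?_
    · fin_cases i <;> assumption
    · fin_cases i <;> fin_cases j <;> first | exact absurd rfl hij | assumption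
  have hbr := bracket_ne_zero hli2
  obtain ⟨hbx, hby⟩ := inner_bracket_self (x : so3) (y : so3)
  set w : so3 := (a * b)⁻¹ • ⁅(x : so3), (y : so3)⁆ with hw
  have hwx : ⟪so3Equiv w, so3Equiv (x : so3)⟫_ℝ = 0 := by
    rw [hw, map_smul, real_inner_smul_left, hbx, mul_zero]
  have hwy : ⟪so3Equiv w, so3Equiv (y : so3)⟫_ℝ = 0 := by
    rw [hw, map_smul, real_inner_smul_left, hby, mul_zero]
  have hxw : ⟪so3Equiv (x : so3), so3Equiv w⟫_ℝ = 0 := by rw [real_inner_comm, hwx]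
  have hyw : ⟪so3Equiv (y : so3), so3Equiv w⟫_ℝ = 0 := by rw [real_inner_comm, hwy]
  have hw0 : w ≠ 0 := smul_ne_zero (by positivity) hbr
  have hli3 : LinearIndependent ℝ ![(x : so3), (y : so3), w] := by
    refine linearIndependent_so3_of_orthogonal (fun i => ?_) fun i j hij => ?_
    · fin_cases i <;> assumption
    · fin_cases i <;> fin_cases j <;> first | exact absurd rfl hij | assumption
  let e := basisOfLinearIndependentOfCardEqFinrank hli3 (by rw [finrank_so3]; rfl)
  have e0 : e 0 = x := by simp [e]
  have e1 : e 1 = y := by simp [e]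
  have e2 : e 2 = w := by simp [e]
  have m0 : e 0 ∈ S.p := e0 ▸ x.2
  have m1 : e 1 ∈ S.p := e1 ▸ y.2
  have s0 : (⟨e 0, m0⟩ : S.p) = x := Subtype.ext e0
  have s1 : (⟨e 1, m1⟩ : S.p) = y := Subtype.ext e1
  refine ⟨a, b, e, ha0, hab, ?_, m0, m1, by rw [s0, ixx], by rw [s1, iyy], by rw [s0, s1, ixy], ?_, ?_, ?_⟩
  · rw [e0, e1]
    refine Submodule.eq_of_le_of_finrank_eq ?_ ?_
    · rw [Submodule.span_le]
      rintro _ (rfl | rfl)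
      exacts [x.2, y.2]
    · rw [finrank_eq_two_of_generates S.proper S.generates]
      have := finrank_span_eq_card hli2
      rwa [Matrix.range_cons, Matrix.range_cons, Matrix.range_empty, Set.union_empty, Set.singleton_union] at this
  · rw [e0, e1, e2, hw, smul_smul, mul_inv_cancel₀ (by positivity), one_smul]
  · rw [e0, e1, e2, hw, smul_lie, bracket_bracket, kxy, zero_smul, sub_zero, real_inner_self_eq_norm_sq,
      ← hb, smul_smul]
    congr 1
    field_simp
  · have h1 := bracket_bracket (y : so3) (x : so3)
    rw [kyx, zero_smul, sub_zero, real_inner_self_eq_norm_sq, ← ha] at h1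
    rw [e0, e1, e2, hw, lie_smul, ← lie_skew (y : so3), ← lie_skew (x : so3) (y : so3), neg_lie, neg_neg, h1, smul_smul]
    congr 1
    field_simp

theorem scale_norm (S : SubRiemannianSO3) {c : ℝ} (hc : 0 < c) (v : S.p) :
    (S.scale c hc).norm v = c * S.norm v := by
  change Real.sqrt (((c ^ 2) • S.ip) v v) = c * Real.sqrt (S.ip v v)
  rw [LinearMap.smul_apply, LinearMap.smul_apply, smul_eq_mul, Real.sqrt_mul (sq_nonneg c), Real.sqrt_sq hc.le]

theorem dist_scale (S : SubRiemannianSO3) {c : ℝ} (hc : 0 < c) (g h : SO3) :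
    (S.scale c hc).dist g h = ENNReal.ofReal c * S.dist g h := by
  have hint : ∀ (T : ℝ) (u : ℝ → S.p), ENNReal.ofReal (∫ t in (0 : ℝ)..T, (S.scale c hc).norm (u t)) =
      ENNReal.ofReal c * ENNReal.ofReal (∫ t in (0 : ℝ)..T, S.norm (u t)) := by
    intro T u
    rw [← ENNReal.ofReal_mul hc.le, ← intervalIntegral.integral_const_mul]
    congr 2
    funext t
    exact S.scale_norm hc (u t)
  have hc0 : ENNReal.ofReal c ≠ 0 := (ENNReal.ofReal_pos.2 hc).ne'
  apply le_antisymm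
  · rw [mul_comm, ← ENNReal.div_le_iff hc0 ENNReal.ofReal_ne_top]
    refine le_sInf ?_
    rintro _ ⟨T, γ, u, h1, h2, h3, rfl⟩
    rw [ENNReal.div_le_iff hc0 ENNReal.ofReal_ne_top, mul_comm, ← hint]
    exact sInf_le ⟨T, γ, u, h1, h2, h3, rfl⟩
  · refine le_sInf ?_
    rintro _ ⟨T, γ, u, h1, h2, h3, rfl⟩
    refine le_of_le_of_eq ?_ (hint T u).symm
    gcongr
    exact sInf_le ⟨T, γ, u, h1, h2, h3, rfl⟩

theorem isArcLengthGeodesic_scale_iff (S : SubRiemannianSO3) {c : ℝ} (hc : 0 < c) (g : ℝ → SO3) :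
    S.IsArcLengthGeodesic g ↔ (S.scale c hc).IsArcLengthGeodesic (fun t => g (t / c)) := by
  constructor
  · intro H t
    obtain ⟨ε, hε, hd⟩ := H (t / c)
    refine ⟨c * ε, by positivity, fun t₁ t₂ h1 h12 h2 => ?_⟩
    rw [dist_scale, hd (t₁ / c) (t₂ / c), ← ENNReal.ofReal_mul hc.le]
    · congr 1
      field_simp
    · rw [lt_div_iff₀ hc, sub_mul, div_mul_cancel₀ _ hc.ne']; linarith
    · gcongr
    · rw [div_lt_iff₀ hc, add_mul, div_mul_cancel₀ _ hc.ne']; linarith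
  · intro H t
    obtain ⟨ε, hε, hd⟩ := H (c * t)
    refine ⟨ε / c, by positivity, fun t₁ t₂ h1 h12 h2 => ?_⟩
    have hεc : c * (ε / c) = ε := by field_simp
    have h3 := hd (c * t₁) (c * t₂) (by nlinarith) (by gcongr) (by nlinarith)
    beta_reduce at h3
    rw [dist_scale, mul_div_cancel_left₀ _ hc.ne', mul_div_cancel_left₀ _ hc.ne', ← mul_sub,
      ENNReal.ofReal_mul hc.le] at h3
    exact (ENNReal.mul_right_inj (ENNReal.ofReal_pos.2 hc).ne' ENNReal.ofReal_ne_top).1 h3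

/-- Keeping e₃ fixed is consistent: [e₁, e₂] acquires c⁻², as ab does, while the other two brackets
acquire c⁻¹ on both sides and a/b is unchanged. -/
theorem IsNormalizedBasis.exists_scale (hb : S.IsNormalizedBasis a b e) {c : ℝ} (hc : 0 < c) :
    ∃ e' : Module.Basis (Fin 3) ℝ so3, e' 0 = c⁻¹ • e 0 ∧ e' 1 = c⁻¹ • e 1 ∧ e' 2 = e 2 ∧
      (S.scale c hc).IsNormalizedBasis (a / c) (b / c) e' := by
  have ha := hb.pos
  have hbp := hb.pos'
  have hunit : ∀ i, IsUnit ((![c⁻¹, c⁻¹, 1] : Fin 3 → ℝ) i) := fun i => by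
    fin_cases i <;> simp [hc.ne']
  let e' := e.isUnitSMul hunit
  have e0 : e' 0 = c⁻¹ • e 0 := Module.Basis.isUnitSMul_apply hunit 0
  have e1 : e' 1 = c⁻¹ • e 1 := Module.Basis.isUnitSMul_apply hunit 1
  have e2 : e' 2 = e 2 := (Module.Basis.isUnitSMul_apply hunit 2).trans (one_smul ℝ _)
  have m0 : e' 0 ∈ S.p := e0 ▸ S.p.smul_mem _ hb.mem₁
  have m1 : e' 1 ∈ S.p := e1 ▸ S.p.smul_mem _ hb.mem₂
  have s0 : (⟨e' 0, m0⟩ : S.p) = c⁻¹ • ⟨e 0, hb.mem₁⟩ := Subtype.ext e0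
  have s1 : (⟨e' 1, m1⟩ : S.p) = c⁻¹ • ⟨e 1, hb.mem₂⟩ := Subtype.ext e1
  have hip : ∀ v w : S.p, ((c ^ 2) • S.ip) (c⁻¹ • v) (c⁻¹ • w) = S.ip v w := fun v w => by
    simp only [map_smul, LinearMap.smul_apply, smul_eq_mul]
    field_simp
  refine ⟨e', e0, e1, e2, ⟨by positivity, by gcongr; exact hb.le, ?_, m0, m1, ?_, ?_, ?_, ?_, ?_, ?_⟩⟩
  · change _ = S.p
    rw [e0, e1, ← hb.span_eq]
    apply le_antisymm
    · rw [Submodule.span_le]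
      rintro _ (rfl | rfl) <;> exact Submodule.smul_mem _ _ (Submodule.subset_span (by simp))
    · rw [Submodule.span_le]
      have key : ∀ v ∈ ({c⁻¹ • e 0, c⁻¹ • e 1} : Set so3), c • v ∈ Submodule.span ℝ ({c⁻¹ • e 0, c⁻¹ • e 1} : Set so3) :=
        fun v hv => Submodule.smul_mem _ _ (Submodule.subset_span hv)
      rintro _ (rfl | rfl)
      · have := key (c⁻¹ • e 0) (by simp)
        rwa [smul_smul, mul_inv_cancel₀ hc.ne', one_smul] at this
      · have := key (c⁻¹ • e 1) (by simp)
        rwa [smul_smul, mul_inv_cancel₀ hc.ne', one_smul] at this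
  · change ((c ^ 2) • S.ip) (⟨e' 0, m0⟩ : S.p) (⟨e' 0, m0⟩ : S.p) = 1
    rw [s0, hip, hb.ip₁₁]
  · change ((c ^ 2) • S.ip) (⟨e' 1, m1⟩ : S.p) (⟨e' 1, m1⟩ : S.p) = 1
    rw [s1, hip, hb.ip₂₂]
  · change ((c ^ 2) • S.ip) (⟨e' 0, m0⟩ : S.p) (⟨e' 1, m1⟩ : S.p) = 0
    rw [s0, s1, hip, hb.ip₁₂]
  · rw [e0, e1, e2, smul_lie, lie_smul, hb.bracket₁₂, smul_smul, smul_smul]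
    congr 1
    field_simp
  · rw [e0, e1, e2, lie_smul, hb.bracket₃₁, smul_smul, smul_smul]
    congr 1
    field_simp
  · rw [e0, e1, e2, smul_lie, hb.bracket₂₃, smul_smul, smul_smul]
    congr 1
    field_simp

end SubRiemannianSO3

theorem mainTheorem10 :
    (∀ p : Submodule ℝ so3, p ≠ ⊤ → (Generates p ↔ Module.finrank ℝ p = 2)) ∧
    ∀ S : SubRiemannianSO3,
      (∃ (a b : ℝ) (e : Module.Basis (Fin 3) ℝ so3), S.IsNormalizedBasis a b e) ∧
      ∀ (a b : ℝ) (e : Module.Basis (Fin 3) ℝ so3), S.IsNormalizedBasis a b e →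
        (∀ g : ℝ → SO3, S.IsArcLengthGeodesic g →
          ∃ ξ : ℝ → ℝ, ContDiff ℝ ∞ ξ ∧
            (∀ t, HasControlAt g (Real.cos (ξ t) • e 0 + Real.sin (ξ t) • e 1) t) ∧
            ∀ t, deriv (deriv ξ) t = (a ^ 2 - b ^ 2) / 2 * Real.sin (2 * ξ t)) ∧
        (a < b → ∀ (c : ℝ) (hc : 0 < c), c ^ 2 = b ^ 2 - a ^ 2 →
          (∀ g h : SO3, (S.scale c hc).dist g h = ENNReal.ofReal c * S.dist g h) ∧
          (∀ g : ℝ → SO3, S.IsArcLengthGeodesic g ↔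
            (S.scale c hc).IsArcLengthGeodesic (fun t => g (t / c))) ∧
          (a / c) ^ 2 - (b / c) ^ 2 = -1 ∧
          ∃ e' : Module.Basis (Fin 3) ℝ so3,
            e' 0 = c⁻¹ • e 0 ∧ e' 1 = c⁻¹ • e 1 ∧ e' 2 = e 2 ∧
            (S.scale c hc).IsNormalizedBasis (a / c) (b / c) e' ∧
            ∀ g : ℝ → SO3, (S.scale c hc).IsArcLengthGeodesic g →
              ∃ ξ w : ℝ → ℝ, ContDiff ℝ ∞ ξ ∧
                (∀ t, HasControlAt g (Real.cos (ξ t) • e' 0 + Real.sin (ξ t) • e' 1) t) ∧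
                (∀ t, deriv (deriv ξ) t =
                  ((a / c) ^ 2 - (b / c) ^ 2) / 2 * Real.sin (2 * ξ t)) ∧
                (∀ t, w t = 2 * ξ t) ∧
                ∀ t, deriv (deriv w) t = -Real.sin (w t)) := by
  refine ⟨fun p hp => ⟨finrank_eq_two_of_generates hp, generates_of_finrank_eq_two⟩, fun S =>
    ⟨S.exists_isNormalizedBasis, fun a b e hb => ⟨fun g hg => hb.exists_angle hg, fun _ c hc hcab => ?_⟩⟩⟩
  have hpar : (a / c) ^ 2 - (b / c) ^ 2 = -1 := by
    rw [div_pow, div_pow, ← sub_div, div_eq_iff (by positivity)]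
    linarith
  obtain ⟨e', h0, h1, h2, hb'⟩ := hb.exists_scale hc
  refine ⟨S.dist_scale hc, S.isArcLengthGeodesic_scale_iff hc, hpar, e', h0, h1, h2, hb', fun g hg => ?_⟩
  obtain ⟨ξ, hξ, hcontrol, hode⟩ := hb'.exists_angle hg
  refine ⟨ξ, fun t => 2 * ξ t, hξ, hcontrol, hode, fun _ => rfl, fun t => ?_⟩
  have hd : deriv (fun t => 2 * ξ t) = fun t => 2 * deriv ξ t := funext fun t => by simp
  rw [hd]
  have hd2 : deriv (fun t => 2 * deriv ξ t) t = 2 * deriv (deriv ξ) t := by simp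
  rw [hd2, hode, hpar]
  ring
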